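/- Let $n\ge 1$ and let $D,G\subset\mathbb C^n$ be bounded domains (non-empty, open, connected, bounded sets). Let $m_1,\dots,m_n\ge 1$ be integers with $\gcd(m_1,\dots,m_n)=1$. Suppose that $0\in G$ and that $G$ is $(m_1,\dots,m_n)$-circular, i.e. $(\lambda^{m_1}x_1,\dots,\lambda^{m_n}x_n)\in G$ for every $x\in G$ and every $\lambda\in\mathbb C$ with $|\lambda|=1$. Let $k_D(z,w)$ denote the Bergman kernel of $D$, i.e. the reproducing kernel of the space of holomorphic functions on $D$ that are square integrable with respect to Lebesgue measure: $k_D(\cdot,w)$ belongs to this space and $h(w)=\int_D h(z)\,\overline{k_D(z,w)}\,dz$ for every $w\in D$ and every $h$ in the space. For $K\subset\mathbb C^n$ put $\widetilde K=\{\overline x: x\in K\}$. Assume that for every open set $K$ that is relatively compact in $D$ there is an open set $U\supset\overline D$ such that the function $(z,w)\mapsto k_D(z,\overline w)$ on $D\times\widetilde K$ extends to a holomorphic function on $U\times\widetilde K$. Then every proper holomorphic map $f:D\to G$ extends holomorphically to a neighborhood of $\overline D$: there are an open set $V\supset\overline D$ and a holomorphic map $F:V\to\mathbb C^n$ with $F=f$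 on $D$. -/

import Mathlib

open MeasureTheory Set Metric Filter Topology

/-- The Bergman space of `D ⊆ ℂⁿ`: functions holomorphic on `D` and square integrable on `D` with
respect to Lebesgue measure. (Only the values on `D` matter.) -/
def bergmanSpace {n : ℕ} (D : Set (Fin n → ℂ)) : Set ((Fin n → ℂ) → ℂ) :=
  {h | DifferentiableOn ℂ h D ∧ MemLp h 2 (volume.restrict D)}

/-- `k` is the reproducing kernel of the Bergman space of `D`: for each `w ∈ D` the function
`k(·, w)` is in the Bergman space and `h(w) = ⟨h, k(·, w)⟩ = ∫_D h(z) conj (k(z, w)) dz`. -/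
structure IsBergmanKernel {n : ℕ} (D : Set (Fin n → ℂ))
    (k : (Fin n → ℂ) → (Fin n → ℂ) → ℂ) : Prop where
  mem : ∀ w ∈ D, (fun z => k z w) ∈ bergmanSpace D
  reproducing : ∀ h ∈ bergmanSpace D, ∀ w ∈ D, h w = ∫ z in D, h z * star (k z w)

/-- Mean value property of holomorphic functions over polydiscs. -/
theorem integral_closedBall_of_holomorphic {n : ℕ} {f : (Fin n → ℂ) → ℂ} {D : Set (Fin n → ℂ)}
    (hD : IsOpen D) (hf : DifferentiableOn ℂ f D) {w : Fin n → ℂ} {r : ℝ}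
    (hB : closedBall w r ⊆ D) :
    ∫ z in closedBall w r, f z = (volume.real (closedBall (0 : Fin n → ℂ) r) : ℂ) * f w := by
  set F : ℝ → (Fin n → ℂ) → ℂ := fun θ v => f (w + circleMap 0 1 θ • v) with hF
  have hmem : ∀ (l : ℂ) (v : Fin n → ℂ), ‖l‖ ≤ 1 → v ∈ closedBall (0 : Fin n → ℂ) r →
      w + l • v ∈ D := by
    intro l v hl hv
    apply hB
    rw [mem_closedBall_zero_iff] at hv
    rw [mem_closedBall, dist_eq_norm, add_sub_cancel_left, norm_smul]
    nlinarith [norm_nonneg v, norm_nonneg l]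
  have hc1 : ∀ θ, ‖circleMap 0 1 θ‖ = 1 := by intro θ; simp
  have ha : ∀ θ, ∫ v in closedBall (0 : Fin n → ℂ) r, F θ v = ∫ z in closedBall w r, f z := by
    intro θ
    have hmp : MeasurePreserving (fun v : Fin n → ℂ => w + circleMap 0 1 θ • v) volume volume := by
      refine (measurePreserving_add_left volume w).comp (g := fun x => w + x)
        (f := fun v : Fin n → ℂ => circleMap 0 1 θ • v) ?_
      refine volume_preserving_pi (f := fun _ (z : ℂ) => circleMap 0 1 θ * z) fun i => ?_
      exact (rotation ⟨circleMap 0 1 θ, by simp [Submonoid.unitSphere]⟩).measurePreserving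
    have hne : circleMap 0 1 θ ≠ 0 := by
      intro h; have := hc1 θ; rw [h] at this; simp at this
    have hemb : MeasurableEmbedding (fun v : Fin n → ℂ => w + circleMap 0 1 θ • v) := by
      refine Continuous.measurableEmbedding (by fun_prop) ?_
      intro a b hab
      exact smul_right_injective _ hne (add_left_cancel hab)
    rw [← hmp.setIntegral_preimage_emb hemb f (closedBall w r)]
    have hpre : (fun v : Fin n → ℂ => w + circleMap 0 1 θ • v) ⁻¹' closedBall w r =
        closedBall (0 : Fin n → ℂ) r := by
      ext v
      simp [dist_eq_norm, norm_smul]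
    rw [hpre]
  have hb : ∀ v ∈ closedBall (0 : Fin n → ℂ) r,
      ∫ θ in (0 : ℝ)..2 * Real.pi, F θ v = 2 * Real.pi * f w := by
    intro v hv
    have hd : ∀ l ∈ closedBall (0 : ℂ) |1|, DifferentiableAt ℂ (fun l : ℂ => f (w + l • v)) l := by
      intro l hl
      have : ‖l‖ ≤ 1 := by simpa using hl
      have h1 := (hf _ (hmem l v this hv)).differentiableAt (hD.mem_nhds (hmem l v this hv))
      exact DifferentiableAt.comp (g := f) (f := fun l : ℂ => w + l • v) l h1 (by fun_prop)
    have := circleAverage_of_differentiable_on_off_countable (c := 0) (R := 1)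
      (f := fun l : ℂ => f (w + l • v)) countable_empty
      (fun l hl => (hd l hl).continuousAt.continuousWithinAt)
      (fun l hl => hd l (ball_subset_closedBall hl.1))
    rw [Real.circleAverage_def] at this
    simp only [zero_smul, add_zero] at this
    rw [← this, Complex.real_smul]
    push_cast
    have hpi : (Real.pi : ℂ) ≠ 0 := by exact_mod_cast Real.pi_ne_zero
    field_simp
    rfl
  have hint : Integrable (Function.uncurry F)
      ((volume.restrict (uIoc 0 (2 * Real.pi))).prod
        (volume.restrict (closedBall (0 : Fin n → ℂ) r))) := by
    rw [Measure.prod_restrict, ← Measure.volume_eq_prod]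
    have hcont : ContinuousOn (Function.uncurry F)
        (Icc 0 (2 * Real.pi) ×ˢ closedBall (0 : Fin n → ℂ) r) := by
      refine hf.continuousOn.comp (f := fun p : ℝ × (Fin n → ℂ) => w + circleMap 0 1 p.1 • p.2)
        ?_ ?_
      · have := continuous_circleMap 0 1
        fun_prop
      · intro p hp
        exact hmem _ _ (hc1 _).le hp.2
    refine (hcont.integrableOn_compact (isCompact_Icc.prod (isCompact_closedBall _ _))).mono_set ?_
    refine prod_mono ?_ subset_rfl
    rw [uIoc_of_le (by positivity)]
    exact Ioc_subset_Icc_self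
  have hswap := intervalIntegral_integral_swap hint
  rw [setIntegral_congr_fun measurableSet_closedBall hb] at hswap
  simp only [ha] at hswap
  rw [intervalIntegral.integral_const, setIntegral_const, sub_zero, Complex.real_smul,
    Complex.real_smul] at hswap
  have hpi : (Real.pi : ℂ) ≠ 0 := by exact_mod_cast Real.pi_ne_zero
  push_cast at hswap
  have h2 : (2 * Real.pi : ℂ) ≠ 0 := by simp
  apply mul_left_cancel₀ h2
  rw [hswap]; ring

/-- The normalised indicator of a polydisc; pairing with it evaluates holomorphic functions at the
centre. Auxiliary, used only to prove that the Bergman kernel exists. -/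
noncomputable def bergmanEval {n : ℕ} (D : Set (Fin n → ℂ)) (w : Fin n → ℂ) (r : ℝ) :
    Lp ℂ 2 (volume.restrict D) :=
  ((volume.real (closedBall (0 : Fin n → ℂ) r) : ℂ)⁻¹) •
    indicatorConstLp 2 (measurableSet_closedBall (x := w) (ε := r))
      ((Measure.restrict_apply_le _ _).trans_lt measure_closedBall_lt_top).ne (1 : ℂ)

theorem inner_bergmanEval {n : ℕ} {f : (Fin n → ℂ) → ℂ} {D : Set (Fin n → ℂ)}
    (hD : IsOpen D) (hf : DifferentiableOn ℂ f D) {w : Fin n → ℂ} {r : ℝ} (hr : 0 < r)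
    (hB : closedBall w r ⊆ D) (g : Lp ℂ 2 (volume.restrict D))
    (hg : g =ᵐ[volume.restrict D] f) : inner ℂ (bergmanEval D w r) g = f w := by
  rw [bergmanEval, inner_smul_left, L2.inner_indicatorConstLp_one,
    Measure.restrict_restrict measurableSet_closedBall, inter_eq_left.2 hB]
  have : ∫ z in closedBall w r, g z = ∫ z in closedBall w r, f z :=
    integral_congr_ae (ae_mono (Measure.restrict_mono hB le_rfl) hg)
  rw [this, integral_closedBall_of_holomorphic hD hf hB]
  have h0 : volume.real (closedBall (0 : Fin n → ℂ) r) ≠ 0 :=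
    (ENNReal.toReal_pos (measure_closedBall_pos _ _ hr).ne' measure_closedBall_lt_top.ne).ne'
  have h0' : (volume.real (closedBall (0 : Fin n → ℂ) r) : ℂ) ≠ 0 := by exact_mod_cast h0
  simp only [map_inv₀, Complex.conj_ofReal]
  field_simp

theorem norm_bergmanEval_le {n : ℕ} (D : Set (Fin n → ℂ)) (r : ℝ) :
    ∃ C : ℝ, 0 ≤ C ∧ ∀ w, ‖bergmanEval D w r‖ ≤ C := by
  refine ⟨(volume.real (closedBall (0 : Fin n → ℂ) r))⁻¹ *
    volume.real (closedBall (0 : Fin n → ℂ) r) ^ (1 / (2 : ENNReal).toReal), by positivity, ?_⟩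
  intro w
  rw [bergmanEval, norm_smul, norm_indicatorConstLp (by simp) (by simp)]
  simp only [norm_inv, Complex.norm_real, norm_one, one_mul, Real.norm_eq_abs,
    abs_of_nonneg measureReal_nonneg]
  gcongr
  have : volume.real (closedBall (0 : Fin n → ℂ) r) = volume.real (closedBall w r) := by
    simp only [Measure.real, Measure.addHaar_closedBall_center volume w r]
  rw [this]
  exact ENNReal.toReal_mono measure_closedBall_lt_top.ne (Measure.restrict_apply_le _ _)

/-- `L²` limits of holomorphic functions are holomorphic (up to null sets). -/
theorem exists_holomorphic_of_tendsto {n : ℕ} {D : Set (Fin n → ℂ)} (hD : IsOpen D)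
    {h : ℕ → (Fin n → ℂ) → ℂ} (hh : ∀ k, DifferentiableOn ℂ (h k) D)
    {g : ℕ → Lp ℂ 2 (volume.restrict D)} {g₀ : Lp ℂ 2 (volume.restrict D)}
    (hgh : ∀ k, g k =ᵐ[volume.restrict D] h k) (hg : Tendsto g atTop (𝓝 g₀)) :
    ∃ h₀, DifferentiableOn ℂ h₀ D ∧ g₀ =ᵐ[volume.restrict D] h₀ := by
  have hball : ∀ w ∈ D, ∃ r > 0, closedBall w r ⊆ D := fun w hw =>
    nhds_basis_closedBall.mem_iff.1 (hD.mem_nhds hw)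
  choose! R hR0 hR using hball
  set h₀ : (Fin n → ℂ) → ℂ := fun w => inner ℂ (bergmanEval D w (R w)) g₀ with hh₀
  have hpt : ∀ w ∈ D, Tendsto (fun k => h k w) atTop (𝓝 (h₀ w)) := by
    intro w hw
    have : ∀ k, h k w = inner ℂ (bergmanEval D w (R w)) (g k) := fun k =>
      (inner_bergmanEval hD (hh k) (hR0 w hw) (hR w hw) (g k) (hgh k)).symm
    simp only [this]
    exact tendsto_const_nhds.inner hg
  refine ⟨h₀, ?_, ?_⟩
  · intro x hx
    set r := R x / 4 with hr
    have hr0 : 0 < r := by have := hR0 x hx; positivity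
    have hsub : ∀ y ∈ ball x r, ∀ z ∈ ball y r, closedBall z r ⊆ D := by
      intro y hy z hz u hu
      apply hR x hx
      rw [mem_ball] at hy hz
      rw [mem_closedBall] at hu ⊢
      linarith [dist_triangle u z x, dist_triangle z y x]
    obtain ⟨C, hC0, hC⟩ := norm_bergmanEval_le D r
    have hxD : ball x r ⊆ D := fun y hy =>
      hsub y hy y (mem_ball_self hr0) (mem_closedBall_self hr0.le)
    have hbd : ∀ k l, ∀ y ∈ ball x r, ∀ z ∈ ball y r, ‖h k z - h l z‖ ≤ C * ‖g k - g l‖ := by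
      intro k l y hy z hz
      rw [← inner_bergmanEval hD (hh k) hr0 (hsub y hy z hz) (g k) (hgh k),
        ← inner_bergmanEval hD (hh l) hr0 (hsub y hy z hz) (g l) (hgh l), ← inner_sub_right]
      refine (norm_inner_le_norm _ _).trans ?_
      gcongr
      exact hC z
    have hder : ∀ k l, ∀ y ∈ ball x r,
        ‖fderiv ℂ (h k) y - fderiv ℂ (h l) y‖ ≤ 2 * (C * ‖g k - g l‖) / r := by
      intro k l y hy
      have hy' := hxD hy
      have hbD : ball y r ⊆ D := fun z hz => hsub y hy z hz (mem_closedBall_self hr0.le)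
      rw [← fderiv_sub ((hh k y hy').differentiableAt (hD.mem_nhds hy'))
        ((hh l y hy').differentiableAt (hD.mem_nhds hy'))]
      refine Complex.norm_fderiv_le_div_of_mapsTo_ball
        (((hh k).sub (hh l)).mono hbD) ?_ hr0
      intro z hz
      rw [mem_closedBall, dist_eq_norm]
      refine (norm_sub_le _ _).trans ?_
      have h1 := hbd k l y hy z hz
      have h2 := hbd k l y hy y (mem_ball_self hr0)
      simp only [Pi.sub_apply]
      linarith
    have hcau : UniformCauchySeqOn (fun k => fderiv ℂ (h k)) atTop (ball x r) := by
      rw [Metric.uniformCauchySeqOn_iff]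
      intro ε hε
      obtain ⟨N, hN⟩ := Metric.cauchySeq_iff.1 hg.cauchySeq (ε * r / (2 * (C + 1))) (by positivity)
      refine ⟨N, fun k hk l hl y hy => ?_⟩
      have h1 := hN k hk l hl
      rw [dist_eq_norm] at h1 ⊢
      refine (hder k l y hy).trans_lt ?_
      rw [lt_div_iff₀ (by positivity)] at h1
      rw [div_lt_iff₀ hr0]
      nlinarith [norm_nonneg (g k - g l)]
    have hlim : ∀ y ∈ ball x r, Tendsto (fun k => fderiv ℂ (h k) y) atTop
        (𝓝 (limUnder atTop fun k => fderiv ℂ (h k) y)) := fun y hy =>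
      (hcau.cauchySeq hy).tendsto_limUnder
    have hunif := hcau.tendstoUniformlyOn_of_tendsto hlim
    have := hasFDerivAt_of_tendstoUniformlyOn isOpen_ball hunif
      (fun k y hy => ((hh k y (hxD hy)).differentiableAt (hD.mem_nhds (hxD hy))).hasFDerivAt)
      (fun y hy => hpt y (hxD hy)) (mem_ball_self hr0)
    exact this.differentiableAt.differentiableWithinAt
  · obtain ⟨ns, hns, hae⟩ := (tendstoInMeasure_of_tendsto_Lp hg).exists_seq_tendsto_ae
    have hall : ∀ᵐ z ∂(volume.restrict D), ∀ k, g k z = h k z := ae_all_iff.2 hgh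
    filter_upwards [hae, hall, ae_restrict_mem hD.measurableSet] with z h1 h2 hz
    simp only [h2] at h1
    exact tendsto_nhds_unique h1 ((hpt z hz).comp hns.tendsto_atTop)

theorem exists_isBergmanKernel {n : ℕ} {D : Set (Fin n → ℂ)} (hD : IsOpen D) :
    ∃ k, IsBergmanKernel D k := by
  let A : Submodule ℂ (Lp ℂ 2 (volume.restrict D)) :=
    { carrier := {g | ∃ h, DifferentiableOn ℂ h D ∧ g =ᵐ[volume.restrict D] h}
      add_mem' := by
        rintro a b ⟨f, hf, haf⟩ ⟨g, hg, hbg⟩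
        exact ⟨f + g, hf.add hg, (Lp.coeFn_add a b).trans (haf.add hbg)⟩
      zero_mem' := ⟨0, differentiableOn_const 0, Lp.coeFn_zero _ _ _⟩
      smul_mem' := by
        rintro c a ⟨f, hf, haf⟩
        exact ⟨c • f, hf.const_smul c, (Lp.coeFn_smul c a).trans (haf.const_smul c)⟩ }
  have hA : IsClosed (A : Set (Lp ℂ 2 (volume.restrict D))) := by
    refine IsSeqClosed.isClosed fun g g₀ hg hlim => ?_
    choose h hh hgh using hg
    exact exists_holomorphic_of_tendsto hD hh hgh hlim
  have : CompleteSpace A := hA.completeSpace_coe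
  have hball : ∀ w ∈ D, ∃ r > 0, closedBall w r ⊆ D := fun w hw =>
    nhds_basis_closedBall.mem_iff.1 (hD.mem_nhds hw)
  choose! R hR0 hR using hball
  have hrep : ∀ w, ∃ h, DifferentiableOn ℂ h D ∧
      (A.orthogonalProjectionOnto (bergmanEval D w (R w)) : Lp ℂ 2 (volume.restrict D))
        =ᵐ[volume.restrict D] h := fun w =>
    (A.orthogonalProjectionOnto (bergmanEval D w (R w))).2
  choose κ hκ hκae using hrep
  refine ⟨fun z w => κ w z, ⟨fun w _ => ⟨hκ w, (Lp.memLp _).ae_eq (hκae w)⟩, ?_⟩⟩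
  rintro h ⟨hh, hh2⟩ w hw
  have hmem : hh2.toLp h ∈ A := ⟨h, hh, hh2.coeFn_toLp⟩
  have h1 := inner_bergmanEval hD hh (hR0 w hw) (hR w hw) _ hh2.coeFn_toLp
  have h2 := Submodule.inner_orthogonalProjectionOnto_eq_of_mem_right
    (⟨hh2.toLp h, hmem⟩ : A) (bergmanEval D w (R w))
  rw [← h1, ← h2, Submodule.coe_inner, L2.inner_def]
  refine integral_congr_ae ?_
  filter_upwards [hκae w, hh2.coeFn_toLp] with z hz1 hz2
  rw [hz1, hz2]
  simp

/-- Uniqueness of the Bergman kernel on `D × D`. -/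
theorem IsBergmanKernel.eq {n : ℕ} {D : Set (Fin n → ℂ)}
    {k k' : (Fin n → ℂ) → (Fin n → ℂ) → ℂ} (hk : IsBergmanKernel D k)
    (hk' : IsBergmanKernel D k') {z w : Fin n → ℂ} (hz : z ∈ D) (hw : w ∈ D) :
    k z w = k' z w := by
  have key : ∀ {a b : (Fin n → ℂ) → (Fin n → ℂ) → ℂ}, IsBergmanKernel D a →
      IsBergmanKernel D b → a z w = star (b w z) := by
    intro a b ha hb
    have h1 := hb.reproducing _ (ha.mem w hw) z hz
    have h2 := ha.reproducing _ (hb.mem z hz) w hw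
    rw [h1, h2]
    simp only [Complex.star_def]
    rw [← integral_conj]
    congr 1
    ext u
    simp [mul_comm]
  rw [key hk hk', ← key hk' hk']

open Classical in
/-- The Bergman kernel `k_D(z, w)` of `D`. For open `D` it exists (`exists_isBergmanKernel`) and is
uniquely determined on `D × D` (`IsBergmanKernel.eq`). -/
noncomputable def bergmanKernel {n : ℕ} (D : Set (Fin n → ℂ)) :
    (Fin n → ℂ) → (Fin n → ℂ) → ℂ :=
  if h : ∃ k, IsBergmanKernel D k then h.choose else 0

theorem isBergmanKernel_bergmanKernel {n : ℕ} {D : Set (Fin n → ℂ)} (hD : IsOpen D) :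
    IsBergmanKernel D (bergmanKernel D) := by
  have h := exists_isBergmanKernel hD
  rw [bergmanKernel, dif_pos h]
  exact h.choose_spec

/-- A bounded domain: a nonempty, open, connected and bounded set. -/
structure IsBoundedDomain {n : ℕ} (D : Set (Fin n → ℂ)) : Prop where
  isOpen : IsOpen D
  isConnected : IsConnected D
  isBounded : Bornology.IsBounded D

/-- `G` is `(m₁, …, mₙ)`-circular: `(λ^{m₁} x₁, …, λ^{mₙ} xₙ) ∈ G` for all `|λ| = 1`, `x ∈ G`. -/
def IsQuasiCircular {n : ℕ} (m : Fin n → ℕ) (G : Set (Fin n → ℂ)) : Prop :=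
  ∀ c : ℂ, ‖c‖ = 1 → ∀ x ∈ G, (fun i => c ^ m i * x i) ∈ G

/-- The set `K̃ = {conj x : x ∈ K}`. -/
def conjSet {n : ℕ} (K : Set (Fin n → ℂ)) : Set (Fin n → ℂ) :=
  (fun x => star x) '' K

/-- For every open `K` that is relatively compact in `D` there is an open `U ⊇ closure D` such that
`(z, w) ↦ k_D(z, conj w)`, defined on `D × K̃`, extends to a holomorphic function on `U × K̃`. -/
def BergmanKernelExtends {n : ℕ} (D : Set (Fin n → ℂ)) : Prop :=
  ∀ K : Set (Fin n → ℂ), IsOpen K → IsCompact (closure K) → closure K ⊆ D →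
    ∃ U : Set (Fin n → ℂ), IsOpen U ∧ closure D ⊆ U ∧
      ∃ F : (Fin n → ℂ) × (Fin n → ℂ) → ℂ, DifferentiableOn ℂ F (U ×ˢ conjSet K) ∧
        ∀ z ∈ D, ∀ w ∈ conjSet K, F (z, w) = bergmanKernel D z (star w)

/-- `f` restricts to a proper holomorphic map `D → G`. -/
structure IsProperHolomorphic {n : ℕ} (f : (Fin n → ℂ) → (Fin n → ℂ))
    (D G : Set (Fin n → ℂ)) : Prop where
  mapsTo : MapsTo f D G
  holomorphic : DifferentiableOn ℂ f D
  proper : IsProperMap (mapsTo.restrict f D G)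

/-! Write `u` for the Jacobian determinant of `f`. The heart of the matter is that `u · (q ∘ f)`
extends past the boundary of `D` for every weighted homogeneous polynomial `q`, in particular for
all powers of the coordinates.

Transformation rule. For `g` in the Bergman space of `D`, the complex measure `f_* (g ū)` is
`∂̄`-closed on `G`: properness of `f` makes the integration by parts legitimate, and the Piola
identity removes the derivatives of the Jacobian (`integral_mul_dbar_comp_eq_zero`). By Weyl's lemma
(`exists_holomorphic_of_integral_dbar_eq_zero`) it has a holomorphic density `h`, and `h` is in the
Bergman space of `G` (`mem_bergmanSpace_of_pushforward`). Hence pairing `g` with `u · (q ∘ f)` over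
`D` is pairing `h` with `q` over `G`, and no analysis of the branch locus is needed.

Homogeneity. If `q` is weighted homogeneous, its pairing with `h` over `G` sees only the component
of `h` of the same weighted degree. It is therefore a constant multiple of the pairing over a
dilated copy `T` of `G`, and `T` fits into a small closed ball around `0` inside `G`
(`exists_integral_eq_integral_image_weightedDilation`). Pulled back to `D`, the pairing becomes an
integral over the compact preimage of that ball. With `g = k_D(·, z)` this represents `u(z) q(f(z))`
as an integral of `k_D(z, w)` over `w` in a compact subset of `D`, and the assumption on the kernel
continues it in `z` to a neighbourhood of the closure (`exists_extension_det_mul_comp`).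

Division. Let `H k` be the extension of `u · f_i ^ k`. Then `(H 1) ^ k · H 0 = (H 0) ^ k · H k` for
all `k`. Comparing orders of vanishing on complex lines and letting `k` grow shows that `H 0`
divides `H 1` (`exists_differentiableOn_eq_mul_of_pow_dvd`); the quotient extends `f_i`. Cancelling
`u` requires that it not vanish identically, which is `exists_det_jacobianMatrix_ne_zero`. -/

/-! ### Parameter integrals and derivatives of holomorphic functions of several variables. -/

/-- Holomorphic dependence of dominated integrals on a parameter. -/
theorem differentiableOn_integral_of_dominated {E X : Type*} [NormedAddCommGroup E]
    [NormedSpace ℂ E] [FiniteDimensional ℂ E] [MeasurableSpace X] {μ : Measure X}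
    {F : E → X → ℂ} {U : Set E} (hU : IsOpen U)
    (hm : ∀ z ∈ U, AEStronglyMeasurable (F z) μ)
    (hd : ∀ᵐ x ∂μ, DifferentiableOn ℂ (fun z => F z x) U)
    (hb : ∀ z ∈ U, ∃ ε > 0, ∃ b : X → ℝ, Integrable b μ ∧
      ∀ᵐ x ∂μ, ∀ y ∈ ball z ε, y ∈ U → ‖F y x‖ ≤ b x) :
    DifferentiableOn ℂ (fun z => ∫ x, F z x ∂μ) U := by
  intro z hz
  obtain ⟨ε₁, hε₁, b, hbi, hbd⟩ := hb z hz
  obtain ⟨ε₂, hε₂, hεU⟩ := Metric.isOpen_iff.1 hU z hz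
  set ε := min ε₁ ε₂ with hε
  have hε0 : 0 < ε := lt_min hε₁ hε₂
  have hsub : ball z ε ⊆ U := (ball_subset_ball (min_le_right _ _)).trans hεU
  have hsub1 : ball z ε ⊆ ball z ε₁ := ball_subset_ball (min_le_left _ _)
  have hdz : ∀ᵐ x ∂μ, HasFDerivAt (fun y => F y x) (fderiv ℂ (fun y => F y x) z) z := by
    filter_upwards [hd] with x hx
    exact ((hx z hz).differentiableAt (hU.mem_nhds hz)).hasFDerivAt
  have hmeas : ∀ v : E, AEStronglyMeasurable (fun x => fderiv ℂ (fun y => F y x) z v) μ := by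
    intro v
    have hlim : Tendsto (fun k : ℕ => z + ((k : ℂ) + 1)⁻¹ • v) atTop (𝓝 z) := by
      have h1 : Tendsto (fun k : ℕ => ((k : ℂ) + 1)⁻¹) atTop (𝓝 0) := by
        simpa using tendsto_one_div_add_atTop_nhds_zero_nat (𝕜 := ℂ)
      simpa using tendsto_const_nhds.add (h1.smul_const v)
    obtain ⟨N, hN⟩ := eventually_atTop.1 (hlim.eventually (hU.mem_nhds hz))
    -- The directional derivative is a pointwise limit of difference quotients with steps `1 / (k +
    -- 1)`; the shift by `N` keeps the base points in `U`, where measurability is assumed.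
    refine aestronglyMeasurable_of_tendsto_ae atTop
      (f := fun (k : ℕ) x => ((k + N : ℕ) + 1 : ℂ) •
        (F (z + (((k + N : ℕ) : ℂ) + 1)⁻¹ • v) x - F z x)) ?_ ?_
    · intro k
      exact AEStronglyMeasurable.const_smul
        ((hm _ (hN _ (Nat.le_add_left _ _))).sub (hm z hz)) ((k + N : ℕ) + 1 : ℂ)
    · filter_upwards [hdz] with x hx
      have h1 : Tendsto (fun k : ℕ => ‖((k : ℂ) + 1)‖) atTop atTop := by
        have : ∀ k : ℕ, ‖((k : ℂ) + 1)‖ = (k : ℝ) + 1 := by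
          intro k; rw [← Nat.cast_succ, Complex.norm_natCast]; simp
        simp only [this]
        exact tendsto_atTop_add_const_right _ _ tendsto_natCast_atTop_atTop
      have h2 := hx.lim v h1
      exact (tendsto_add_atTop_iff_nat N).2 h2
  have hmeas' : AEStronglyMeasurable (fun x => fderiv ℂ (fun y => F y x) z) μ := by
    let B := Module.finBasis ℂ E
    have : (fun x => fderiv ℂ (fun y => F y x) z) = fun x =>
        ∑ i, (fderiv ℂ (fun y => F y x) z (B i)) • LinearMap.toContinuousLinearMap (B.coord i) := by
      ext x v
      conv_lhs => rw [← B.sum_repr v, map_sum]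
      simp [mul_comm]
    rw [this]
    exact Finset.aestronglyMeasurable_fun_sum _ fun i _ => (hmeas (B i)).smul_const _
  refine HasFDerivAt.differentiableAt (f' := ∫ x, fderiv ℂ (fun y => F y x) z ∂μ)
    ?_ |>.differentiableWithinAt
  refine (hasFDerivAt_integral_of_dominated_loc_of_lip' (s := ball z ε)
    (bound := fun x => (b x + b x) / ε) (ball_mem_nhds z hε0) (fun y hy => hm y (hsub hy)) ?_ hmeas'
    ?_ ((hbi.add hbi).div_const _) hdz).2
  · refine hbi.mono' (hm z hz) ?_
    filter_upwards [hbd] with x hx using hx z (mem_ball_self hε₁) hz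
  · filter_upwards [hbd, hd] with x hx hdx y hy
    -- No bound on the derivative is assumed. The bound on `F` puts the values in a disc of radius
    -- `2 * b x`, and the Schwarz lemma converts this into a Lipschitz estimate at `z` with constant
    -- `2 * b x / ε`.
    have hmaps : MapsTo (fun y => F y x) (ball z ε) (closedBall (F z x) (b x + b x)) := by
      intro y hy
      rw [mem_closedBall, dist_eq_norm]
      exact (norm_sub_le _ _).trans
        (add_le_add (hx y (hsub1 hy) (hsub hy)) (hx z (mem_ball_self hε₁) hz))
    have := Complex.dist_le_div_mul_dist_of_mapsTo_ball (hdx.mono hsub) hmaps hy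
    simpa [dist_eq_norm] using this

/-- Integrals over a compact set of jointly continuous functions that are holomorphic in the
parameter are holomorphic. -/
theorem differentiableOn_setIntegral_of_continuousOn {E X : Type*} [NormedAddCommGroup E]
    [NormedSpace ℂ E] [FiniteDimensional ℂ E] [TopologicalSpace X] [T2Space X]
    [SecondCountableTopology X] [MeasurableSpace X]
    [BorelSpace X] {μ : Measure X} {F : E → X → ℂ} {a : X → ℂ} {U : Set E} {K : Set X}
    (hU : IsOpen U) (hK : IsCompact K)
    (hc : ContinuousOn (Function.uncurry F) (U ×ˢ K))
    (hd : ∀ x ∈ K, DifferentiableOn ℂ (fun z => F z x) U) (ha : IntegrableOn a K μ) :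
    DifferentiableOn ℂ (fun z => ∫ x in K, F z x * a x ∂μ) U := by
  have : ProperSpace E := FiniteDimensional.proper ℂ E
  refine differentiableOn_integral_of_dominated hU ?_ ?_ ?_
  · intro z hz
    refine AEStronglyMeasurable.mul ?_ ha.aestronglyMeasurable
    refine ContinuousOn.aestronglyMeasurable ?_ hK.measurableSet
    exact hc.comp (f := fun x => (z, x)) (by fun_prop) (fun x hx => ⟨hz, hx⟩)
  · filter_upwards [ae_restrict_mem hK.measurableSet] with x hx
    exact (hd x hx).mul_const _
  · intro z hz
    obtain ⟨ε, hε, hεU⟩ := nhds_basis_closedBall.mem_iff.1 (hU.mem_nhds hz)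
    obtain ⟨C, hC⟩ := ((isCompact_closedBall z ε).prod hK).exists_bound_of_continuousOn
      (hc.mono (prod_mono hεU le_rfl))
    refine ⟨ε, hε, fun x => C * ‖a x‖, ha.norm.const_mul C, ?_⟩
    filter_upwards [ae_restrict_mem hK.measurableSet] with x hx y hy _
    rw [norm_mul]
    gcongr
    exact hC (y, x) ⟨ball_subset_closedBall hy, hx⟩

theorem differentiableOn_circleIntegral {E : Type*} [NormedAddCommGroup E]
    [NormedSpace ℂ E] [FiniteDimensional ℂ E] {F : E → ℂ → ℂ} {U : Set E} {c : ℂ} {R : ℝ}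
    (hU : IsOpen U) (hR : 0 ≤ R) (hc : ContinuousOn (Function.uncurry F) (U ×ˢ sphere c R))
    (hd : ∀ x ∈ sphere c R, DifferentiableOn ℂ (fun z => F z x) U) :
    DifferentiableOn ℂ (fun z => ∮ x in C(c, R), F z x) U := by
  have h1 : ∀ z, (∮ x in C(c, R), F z x) = ∫ θ in Icc 0 (2 * Real.pi),
      F z (circleMap c R θ) * deriv (circleMap c R) θ := by
    intro z
    rw [circleIntegral, intervalIntegral.integral_of_le (by positivity), integral_Icc_eq_integral_Ioc]
    simp [mul_comm]
  simp only [h1]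
  refine differentiableOn_setIntegral_of_continuousOn
    (F := fun z θ => F z (circleMap c R θ)) hU isCompact_Icc ?_ ?_ ?_
  · refine hc.comp (f := fun p : E × ℝ => (p.1, circleMap c R p.2)) ?_ ?_
    · have := continuous_circleMap c R
      fun_prop
    · intro p hp
      exact ⟨hp.1, circleMap_mem_sphere c hR _⟩
  · intro θ _
    exact hd _ (circleMap_mem_sphere c hR _)
  · refine Continuous.integrableOn_Icc ?_
    have h2 : deriv (circleMap c R) = fun θ => circleMap 0 R θ * Complex.I :=
      funext fun θ => deriv_circleMap c R θ
    have := continuous_circleMap 0 R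
    rw [h2]
    fun_prop

/-- Directional derivatives of holomorphic functions are holomorphic. -/
theorem DifferentiableOn.fderiv_apply_holomorphic {E : Type*} [NormedAddCommGroup E]
    [NormedSpace ℂ E] [FiniteDimensional ℂ E] {h : E → ℂ} {U : Set E} (hU : IsOpen U)
    (hh : DifferentiableOn ℂ h U) (v : E) : DifferentiableOn ℂ (fun z => fderiv ℂ h z v) U := by
  intro z₀ hz₀
  obtain ⟨r, hr, hrU⟩ := Metric.isOpen_iff.1 hU z₀ hz₀
  obtain ⟨R, hR, hRv⟩ : ∃ R : ℝ, 0 < R ∧ R * ‖v‖ < r / 2 := by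
    refine ⟨r / 2 / (‖v‖ + 1), by positivity, ?_⟩
    rw [div_mul_eq_mul_div, div_lt_iff₀ (by positivity)]
    nlinarith [norm_nonneg v]
  have hmem : ∀ z ∈ ball z₀ (r / 2), ∀ ζ ∈ closedBall (0 : ℂ) R, z + ζ • v ∈ U := by
    intro z hz ζ hζ
    apply hrU
    rw [mem_ball, dist_eq_norm] at hz ⊢
    rw [mem_closedBall_zero_iff] at hζ
    calc ‖z + ζ • v - z₀‖ = ‖(z - z₀) + ζ • v‖ := by congr 1; abel
      _ ≤ ‖z - z₀‖ + ‖ζ‖ * ‖v‖ := (norm_add_le _ _).trans (by rw [norm_smul])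
      _ < r := by nlinarith [norm_nonneg v, norm_nonneg ζ]
  have hdiff : ∀ z ∈ ball z₀ (r / 2), ∀ ζ ∈ closedBall (0 : ℂ) R,
      DifferentiableAt ℂ (fun ζ : ℂ => h (z + ζ • v)) ζ := by
    intro z hz ζ hζ
    have h1 := (hh _ (hmem z hz ζ hζ)).differentiableAt (hU.mem_nhds (hmem z hz ζ hζ))
    exact DifferentiableAt.comp (g := h) (f := fun ζ : ℂ => z + ζ • v) ζ h1 (by fun_prop)
  -- Cauchy's formula for the derivative at `0` of the slice `ζ ↦ h (z + ζ • v)`. The right-hand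
  -- side is a circle integral whose integrand is holomorphic in `z`, and the radius `R` does not
  -- depend on `z`.
  have heq : ∀ z ∈ ball z₀ (r / 2), fderiv ℂ h z v =
      (2 * Real.pi * Complex.I)⁻¹ * ∮ ζ in C(0, R), ζ⁻¹ ^ 2 * h (z + ζ • v) := by
    intro z hz
    have hz0 : z + (0 : ℂ) • v ∈ U := hmem z hz 0 (mem_closedBall_self hR.le)
    have hzU : z ∈ U := by simpa using hz0
    have h1 : HasDerivAt (fun ζ : ℂ => h (z + ζ • v)) (fderiv ℂ h z v) 0 := by
      have h2 : HasFDerivAt h (fderiv ℂ h z) (z + (0 : ℂ) • v) := by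
        simpa using ((hh z hzU).differentiableAt (hU.mem_nhds hzU)).hasFDerivAt
      have h3 : HasDerivAt (fun ζ : ℂ => z + ζ • v) v 0 := by
        simpa using ((hasDerivAt_id (0 : ℂ)).smul_const v).const_add z
      exact h2.comp_hasDerivAt (0 : ℂ) h3
    have hcl : DiffContOnCl ℂ (fun ζ : ℂ => h (z + ζ • v)) (ball 0 R) := by
      refine DifferentiableOn.diffContOnCl_ball (U := closedBall 0 R) ?_ le_rfl
      exact fun ζ hζ => (hdiff z hz ζ hζ).differentiableWithinAt
    have h4 := hcl.deriv_eq_smul_circleIntegral hR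
    rw [h1.deriv, smul_eq_mul] at h4
    have h5 : (∮ ζ in C(0, R), ζ⁻¹ ^ 2 * h (z + ζ • v)) =
        ∮ ζ in C(0, R), (1 / (ζ - 0) ^ 2) • h (z + ζ • v) :=
      circleIntegral.integral_congr hR.le fun ζ _ => by simp
    rw [h5, h4, inv_mul_cancel_left₀]
    simp [Real.pi_ne_zero]
  have hmain : DifferentiableOn ℂ (fun z => (2 * Real.pi * Complex.I)⁻¹ *
      ∮ ζ in C(0, R), ζ⁻¹ ^ 2 * h (z + ζ • v)) (ball z₀ (r / 2)) := by
    refine DifferentiableOn.const_mul ?_ _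
    refine differentiableOn_circleIntegral (F := fun z ζ => ζ⁻¹ ^ 2 * h (z + ζ • v))
      isOpen_ball hR.le ?_ ?_
    · have h1 : ContinuousOn (fun p : E × ℂ => h (p.1 + p.2 • v))
          (ball z₀ (r / 2) ×ˢ sphere 0 R) :=
        hh.continuousOn.comp (by fun_prop) fun p hp =>
          hmem _ hp.1 _ (sphere_subset_closedBall hp.2)
      have h2 : ContinuousOn (fun p : E × ℂ => p.2⁻¹) (ball z₀ (r / 2) ×ˢ sphere 0 R) := by
        refine continuousOn_snd.inv₀ fun p hp h0 => ?_
        have := hp.2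
        rw [h0] at this
        simp at this
        exact hR.ne this
      exact (h2.pow 2).mul h1
    · intro ζ hζ
      refine DifferentiableOn.const_mul ?_ _
      exact hh.comp (f := fun z => z + ζ • v) (by fun_prop) fun z hz =>
        hmem z hz ζ (sphere_subset_closedBall hζ)
  have hz0 : z₀ ∈ ball z₀ (r / 2) := mem_ball_self (by positivity)
  have := (hmain z₀ hz0).differentiableAt (isOpen_ball.mem_nhds hz0)
  refine (this.congr_of_eventuallyEq ?_).differentiableWithinAt
  filter_upwards [isOpen_ball.mem_nhds hz0] with z hz using heq z hz

/-- The derivative of a scalar holomorphic function is holomorphic. -/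
theorem DifferentiableOn.fderiv_holomorphic {E : Type*} [NormedAddCommGroup E]
    [NormedSpace ℂ E] [FiniteDimensional ℂ E] {h : E → ℂ} {U : Set E} (hU : IsOpen U)
    (hh : DifferentiableOn ℂ h U) : DifferentiableOn ℂ (fderiv ℂ h) U := by
  let B := Module.finBasis ℂ E
  have : fderiv ℂ h = fun z =>
      ∑ i, (fderiv ℂ h z (B i)) • LinearMap.toContinuousLinearMap (B.coord i) := by
    ext z v
    conv_lhs => rw [← B.sum_repr v, map_sum]
    simp [mul_comm]
  rw [this]
  exact DifferentiableOn.fun_sum fun i _ =>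
    (hh.fderiv_apply_holomorphic hU (B i)).smul_const _

/-- Real `C¹` regularity is the form in which holomorphy enters integration by parts and the inverse
function theorem. -/
theorem DifferentiableOn.contDiffOn_one_real {E : Type*} [NormedAddCommGroup E]
    [NormedSpace ℂ E] [FiniteDimensional ℂ E] {h : E → ℂ} {U : Set E} (hU : IsOpen U)
    (hh : DifferentiableOn ℂ h U) : ContDiffOn ℝ 1 h U := by
  have : ContDiffOn ℂ 1 h U := by
    rw [← zero_add 1, contDiffOn_succ_iff_fderiv_of_isOpen hU]
    exact ⟨hh, by simp, contDiffOn_zero.2 (hh.fderiv_holomorphic hU).continuousOn⟩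
  exact this.restrict_scalars ℝ

/-- Mixed second derivatives of a holomorphic function are symmetric. -/
theorem DifferentiableOn.fderiv_fderiv_comm {E : Type*} [NormedAddCommGroup E]
    [NormedSpace ℂ E] [FiniteDimensional ℂ E] {h : E → ℂ} {U : Set E} (hU : IsOpen U)
    (hh : DifferentiableOn ℂ h U) {z : E} (hz : z ∈ U) (v w : E) :
    fderiv ℂ (fun x => fderiv ℂ h x v) z w = fderiv ℂ (fun x => fderiv ℂ h x w) z v := by
  have hd : DifferentiableAt ℂ (fderiv ℂ h) z :=
    (hh.fderiv_holomorphic hU z hz).differentiableAt (hU.mem_nhds hz)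
  have key : ∀ v w : E, fderiv ℂ (fun x => fderiv ℂ h x v) z w = fderiv ℂ (fderiv ℂ h) z w v := by
    intro v w
    have h2 : HasFDerivAt (fun x => fderiv ℂ h x v)
        ((fderiv ℂ (fderiv ℂ h) z).flip v) z := by
      simpa using hd.hasFDerivAt.clm_apply (hasFDerivAt_const v z)
    rw [h2.fderiv]; rfl
  rw [key, key]
  refine second_derivative_symmetric_of_eventually (𝕜 := ℂ) (f := h) ?_ hd.hasFDerivAt w v
  filter_upwards [hU.mem_nhds hz] with y hy
  exact ((hh y hy).differentiableAt (hU.mem_nhds hy)).hasFDerivAt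

/-! ### Identity theorem and density of the non-vanishing set. -/

/-- Identity theorem on connected open sets. -/
theorem eqOn_of_preconnected_of_eventuallyEq_holomorphic {E : Type*} [NormedAddCommGroup E]
    [NormedSpace ℂ E] {f g : E → ℂ} {U : Set E} (hU : IsOpen U) (hUc : IsPreconnected U)
    (hf : DifferentiableOn ℂ f U) (hg : DifferentiableOn ℂ g U) {z₀ : E} (hz₀ : z₀ ∈ U)
    (h : f =ᶠ[𝓝 z₀] g) : EqOn f g U := by
  let S : Set E := {z | f =ᶠ[𝓝 z] g}
  have hS : IsOpen S := isOpen_setOfPred_eventually_nhds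
  have hsub : U ⊆ S := by
    refine hUc.subset_of_closure_inter_subset hS ⟨z₀, hz₀, h⟩ ?_
    rintro x ⟨hxS, hxU⟩
    obtain ⟨r, hr, hrU⟩ := Metric.isOpen_iff.1 hU x hxU
    obtain ⟨y, hyS, hyx⟩ := Metric.mem_closure_iff.1 hxS r hr
    have hyb : y ∈ ball x r := by rwa [mem_ball, dist_comm]
    change f =ᶠ[𝓝 x] g
    filter_upwards [isOpen_ball.mem_nhds (mem_ball_self hr)] with z hz
    -- The complex line through `y` and `z` meets the ball in a convex set of parameters, on which
    -- the one-variable identity theorem carries equality from `y` to `z`.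
    let A : ℂ → E := fun ζ => y + ζ • (z - y)
    have hAc : Continuous A := by fun_prop
    let W : Set ℂ := A ⁻¹' ball x r
    have hW : IsOpen W := isOpen_ball.preimage hAc
    have hWconv : Convex ℝ W := by
      intro a ha b hb s t hs ht hst
      have h1 := convex_ball x r ha hb hs ht hst
      have : A (s • a + t • b) = s • A a + t • A b := by
        have hy : y = s • y + t • y := by rw [← add_smul, hst, one_smul]
        have hA : ∀ ζ, A ζ = y + ζ • (z - y) := fun _ => rfl
        rw [hA, hA, hA, smul_add, smul_add, add_smul, smul_assoc, smul_assoc, add_add_add_comm,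
          ← hy]
      change A (s • a + t • b) ∈ ball x r
      rwa [this]
    have hcomp : ∀ k : E → ℂ, DifferentiableOn ℂ k U → AnalyticOnNhd ℂ (k ∘ A) W := by
      intro k hk
      refine DifferentiableOn.analyticOnNhd ?_ hW
      exact hk.comp (by fun_prop) fun ζ hζ => hrU hζ
    have h0 : (0 : ℂ) ∈ W := by simpa [W, A] using hyb
    have h1 : (1 : ℂ) ∈ W := by simpa [W, A] using hz
    have hev : f ∘ A =ᶠ[𝓝 0] g ∘ A := by
      have : Tendsto A (𝓝 0) (𝓝 y) := by
        have := hAc.tendsto 0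
        simpa [A] using this
      exact this.eventually hyS
    have := (hcomp f hf).eqOn_of_preconnected_of_eventuallyEq (hcomp g hg)
      hWconv.isPreconnected h0 hev h1
    simpa [A] using this
  exact fun z hz => (hsub hz).self_of_nhds

/-- The zero set of a holomorphic function that does not vanish identically on a connected open
set has empty interior. -/
theorem subset_closure_ne_zero_of_holomorphic {E : Type*} [NormedAddCommGroup E]
    [NormedSpace ℂ E] {f : E → ℂ} {U : Set E} (hU : IsOpen U) (hUc : IsPreconnected U)
    (hf : DifferentiableOn ℂ f U) {z₀ : E} (hz₀ : z₀ ∈ U) (h : f z₀ ≠ 0) :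
    U ⊆ closure {z | z ∈ U ∧ f z ≠ 0} := by
  intro x hx
  by_contra hcl
  have h1 : f =ᶠ[𝓝 x] fun _ => 0 := by
    filter_upwards [isClosed_closure.isOpen_compl.mem_nhds hcl, hU.mem_nhds hx] with z hz hzU
    by_contra h0
    exact hz (subset_closure ⟨hzU, h0⟩)
  exact h (eqOn_of_preconnected_of_eventuallyEq_holomorphic hU hUc hf
    (differentiableOn_const 0) hx h1 hz₀)

/-! ### Test functions and the conjugate-linear part of a real derivative. -/

/-- `ψ` is a continuous function with compact support contained in `G`. -/
structure IsCompactlySupportedIn {n : ℕ} (G : Set (Fin n → ℂ)) (ψ : (Fin n → ℂ) → ℂ) : Prop where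
  continuous : Continuous ψ
  hasCompactSupport : HasCompactSupport ψ
  tsupport_subset : tsupport ψ ⊆ G

/-- Twice the conjugate-linear part of a real-linear functional. -/
noncomputable def dbar {E : Type*} [NormedAddCommGroup E] [NormedSpace ℂ E]
    (L : E →L[ℝ] ℂ) (v : E) : ℂ :=
  L v + Complex.I * L (Complex.I • v)

theorem dbar_smul {E : Type*} [NormedAddCommGroup E] [NormedSpace ℂ E]
    (L : E →L[ℝ] ℂ) (c : ℂ) (v : E) : dbar L (c • v) = star c * dbar L v := by
  have h1 : ∀ w : E, L (c • w) = c.re * L w + c.im * L (Complex.I • w) := by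
    intro w
    have : c • w = c.re • w + c.im • (Complex.I • w) := by
      conv_lhs => rw [← Complex.re_add_im c]
      rw [add_smul, mul_smul]
      simp
    rw [this, map_add, map_smul, map_smul]
    simp
  have h2 : Complex.I • c • v = c • Complex.I • v := smul_comm _ _ _
  have h3 : L (Complex.I • Complex.I • v) = - L v := by
    rw [smul_smul, Complex.I_mul_I, neg_one_smul, map_neg]
  have h4 : star c = (c.re : ℂ) - c.im * Complex.I := by
    rw [Complex.star_def]; apply Complex.ext <;> simp
  rw [dbar, dbar, h2, h1, h1, h3, h4]
  linear_combination ((c.im : ℂ) * L (Complex.I • v)) * Complex.I_sq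

theorem dbar_sum {E ι : Type*} [NormedAddCommGroup E] [NormedSpace ℂ E]
    (L : E →L[ℝ] ℂ) (s : Finset ι) (v : ι → E) :
    dbar L (∑ i ∈ s, v i) = ∑ i ∈ s, dbar L (v i) := by
  simp only [dbar, Finset.smul_sum, map_sum, Finset.mul_sum, Finset.sum_add_distrib]

/-- A real derivative without conjugate-linear part is a complex derivative. -/
theorem HasFDerivAt.differentiableAt_of_dbar_eq_zero {n : ℕ} {h : (Fin n → ℂ) → ℂ}
    {L : (Fin n → ℂ) →L[ℝ] ℂ} {x : Fin n → ℂ} (hL : HasFDerivAt h L x)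
    (h0 : ∀ j, dbar L (Pi.single j 1) = 0) : DifferentiableAt ℂ h x := by
  have h1 : ∀ v, dbar L v = 0 := by
    intro v
    have : v = ∑ j, v j • (Pi.single j 1 : Fin n → ℂ) := by
      ext i; simp [Finset.sum_apply, Pi.single_apply]
    rw [this, dbar_sum]
    simp [dbar_smul, h0]
  have hI : ∀ v, L (Complex.I • v) = Complex.I * L v := by
    intro v
    have := h1 v
    rw [dbar] at this
    linear_combination (-Complex.I) * this + L (Complex.I • v) * Complex.I_sq
  let g' : (Fin n → ℂ) →L[ℂ] ℂ :=
    { toFun := L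
      map_add' := map_add L
      map_smul' := by
        intro c v
        have : c • v = c.re • v + c.im • (Complex.I • v) := by
          conv_lhs => rw [← Complex.re_add_im c]
          rw [add_smul, mul_smul]
          simp
        rw [this, map_add, map_smul, map_smul, hI]
        simp only [RingHom.id_apply, smul_eq_mul, Complex.real_smul]
        conv_rhs => rw [← Complex.re_add_im c]
        ring
      cont := L.cont }
  exact (hasFDerivAt_of_restrictScalars ℝ (g' := L) (f' := g') hL rfl).differentiableAt

/-! ### Circular mollifiers and cutoff functions. -/

/-- A smooth probability density supported in a small ball and invariant under multiplication by
unimodular scalars. -/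
structure IsCircularMollifier {n : ℕ} (ρ : (Fin n → ℂ) → ℂ) (ε : ℝ) : Prop where
  contDiff : ContDiff ℝ 1 ρ
  nonneg : ∀ v, ρ v = ‖ρ v‖
  circular : ∀ (c : ℂ) v, ‖c‖ = 1 → ρ (c • v) = ρ v
  support_subset : Function.support ρ ⊆ closedBall 0 ε
  integral_eq : ∫ v, ρ v = 1

theorem exists_isCircularMollifier (n : ℕ) {ε : ℝ} (hε : 0 < ε) :
    ∃ ρ : (Fin n → ℂ) → ℂ, IsCircularMollifier ρ ε := by
  -- The sum of squares is smooth, unlike the sup norm of `Fin n → ℂ`, and depends only on the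
  -- moduli of the coordinates; the Euclidean ball of radius `ε` lies in the sup-norm ball.
  let p : (Fin n → ℂ) → ℝ := fun v => Real.smoothTransition (1 - (∑ i, ‖v i‖ ^ 2) / ε ^ 2)
  have hp : ContDiff ℝ 1 p := by
    refine (Real.smoothTransition.contDiff (n := 1)).comp ?_
    refine contDiff_const.sub (ContDiff.div_const (ContDiff.sum fun i _ => ?_) _)
    exact (contDiff_apply ℝ ℂ i).norm_sq ℝ
  have hp0 : ∀ v, 0 ≤ p v := fun v => Real.smoothTransition.nonneg _
  have hps : Function.support p ⊆ closedBall 0 ε := by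
    intro v hv
    rw [mem_closedBall_zero_iff, pi_norm_le_iff_of_nonneg hε.le]
    intro i
    by_contra! hlt
    refine hv (Real.smoothTransition.zero_of_nonpos ?_)
    have h1 : ‖v i‖ ^ 2 ≤ ∑ i, ‖v i‖ ^ 2 :=
      Finset.single_le_sum (f := fun i => ‖v i‖ ^ 2) (fun _ _ => by positivity) (Finset.mem_univ i)
    have h2 : ε ^ 2 ≤ ‖v i‖ ^ 2 := by gcongr
    rw [sub_nonpos, one_le_div (by positivity)]
    linarith
  have hpc : HasCompactSupport p :=
    HasCompactSupport.intro (isCompact_closedBall 0 ε) fun v hv => by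
      by_contra h
      exact hv (hps h)
  have hpos : 0 < ∫ v, p v := by
    refine hp.continuous.integral_pos_of_hasCompactSupport_nonneg_nonzero (x := 0) hpc hp0 ?_
    simp [p]
  refine ⟨fun v => (((∫ v, p v)⁻¹ * p v : ℝ) : ℂ), ?_, ?_, ?_, ?_, ?_⟩
  · exact Complex.ofRealCLM.contDiff.comp (contDiff_const.mul hp)
  · intro v
    rw [Complex.norm_real, Real.norm_of_nonneg (mul_nonneg (inv_nonneg.2 hpos.le) (hp0 v))]
  · intro c v hc
    simp [p, hc]
  · intro v hv
    refine hps fun h => hv ?_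
    simp [h]
  · rw [integral_complex_ofReal, integral_const_mul, inv_mul_cancel₀ hpos.ne']
    simp

theorem IsCircularMollifier.hasCompactSupport {n : ℕ} {ρ : (Fin n → ℂ) → ℂ} {ε : ℝ}
    (h : IsCircularMollifier ρ ε) : HasCompactSupport ρ :=
  HasCompactSupport.intro (isCompact_closedBall 0 ε) fun v hv => by
    by_contra h'
    exact hv (h.support_subset h')

theorem IsCircularMollifier.integrable {n : ℕ} {ρ : (Fin n → ℂ) → ℂ} {ε : ℝ}
    (h : IsCircularMollifier ρ ε) : Integrable ρ :=
  h.contDiff.continuous.integrable_of_hasCompactSupport h.hasCompactSupport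

theorem IsCircularMollifier.apply_neg {n : ℕ} {ρ : (Fin n → ℂ) → ℂ} {ε : ℝ}
    (h : IsCircularMollifier ρ ε) (v : Fin n → ℂ) : ρ (-v) = ρ v := by
  have := h.circular (-1) v (by simp)
  simpa using this

theorem IsCircularMollifier.tsupport_subset {n : ℕ} {ρ : (Fin n → ℂ) → ℂ} {ε : ℝ}
    (h : IsCircularMollifier ρ ε) : tsupport ρ ⊆ closedBall 0 ε :=
  closure_minimal h.support_subset isClosed_closedBall

/-- Mean value property of holomorphic functions with respect to a weight that is invariant under
multiplication by unimodular scalars. -/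
theorem integral_mul_of_circular {n : ℕ} {f ρ : (Fin n → ℂ) → ℂ} {D : Set (Fin n → ℂ)}
    (hD : IsOpen D) (hf : DifferentiableOn ℂ f D) {w : Fin n → ℂ} {r : ℝ}
    (hB : closedBall w r ⊆ D) (hρ : Continuous ρ)
    (hc : ∀ (c : ℂ) v, ‖c‖ = 1 → ρ (c • v) = ρ v) (hs : Function.support ρ ⊆ closedBall 0 r) :
    ∫ v, ρ v * f (w + v) = (∫ v, ρ v) * f w := by
  have hset : ∀ g : (Fin n → ℂ) → ℂ,
      ∫ v in closedBall (0 : Fin n → ℂ) r, ρ v * g v = ∫ v, ρ v * g v := fun g =>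
    setIntegral_eq_integral_of_forall_compl_eq_zero fun v hv => by
      have : ρ v = 0 := by
        by_contra h'
        exact hv (hs h')
      simp [this]
  -- Average over the rotations of `v`: the `v`-integral does not depend on `θ` since `ρ` and
  -- Lebesgue measure are circular, while for fixed `v` the `θ`-average is the one-variable mean
  -- value `f w`.
  set F : ℝ → (Fin n → ℂ) → ℂ := fun θ v => ρ v * f (w + circleMap 0 1 θ • v) with hF
  have hmem : ∀ (l : ℂ) (v : Fin n → ℂ), ‖l‖ ≤ 1 → v ∈ closedBall (0 : Fin n → ℂ) r →
      w + l • v ∈ D := by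
    intro l v hl hv
    apply hB
    rw [mem_closedBall_zero_iff] at hv
    rw [mem_closedBall, dist_eq_norm, add_sub_cancel_left, norm_smul]
    nlinarith [norm_nonneg v, norm_nonneg l]
  have hc1 : ∀ θ, ‖circleMap 0 1 θ‖ = 1 := by intro θ; simp
  have ha : ∀ θ, ∫ v in closedBall (0 : Fin n → ℂ) r, F θ v = ∫ v, ρ v * f (w + v) := by
    intro θ
    have hmp : MeasurePreserving (fun v : Fin n → ℂ => circleMap 0 1 θ • v) volume volume := by
      refine volume_preserving_pi (f := fun _ (z : ℂ) => circleMap 0 1 θ * z) fun i => ?_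
      exact (rotation ⟨circleMap 0 1 θ, by simp [Submonoid.unitSphere]⟩).measurePreserving
    have hne : circleMap 0 1 θ ≠ 0 := by
      intro h; have := hc1 θ; rw [h] at this; simp at this
    have hemb : MeasurableEmbedding (fun v : Fin n → ℂ => circleMap 0 1 θ • v) :=
      Continuous.measurableEmbedding (by fun_prop) (smul_right_injective _ hne)
    rw [← hmp.integral_comp hemb, hset]
    simp only [hc _ _ (hc1 θ)]
  have hb : ∀ v ∈ closedBall (0 : Fin n → ℂ) r,
      ∫ θ in (0 : ℝ)..2 * Real.pi, F θ v = 2 * Real.pi * (ρ v * f w) := by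
    intro v hv
    have hd : ∀ l ∈ closedBall (0 : ℂ) |1|, DifferentiableAt ℂ (fun l : ℂ => f (w + l • v)) l := by
      intro l hl
      have : ‖l‖ ≤ 1 := by simpa using hl
      have h1 := (hf _ (hmem l v this hv)).differentiableAt (hD.mem_nhds (hmem l v this hv))
      exact DifferentiableAt.comp (g := f) (f := fun l : ℂ => w + l • v) l h1 (by fun_prop)
    have := circleAverage_of_differentiable_on_off_countable (c := 0) (R := 1)
      (f := fun l : ℂ => f (w + l • v)) countable_empty
      (fun l hl => (hd l hl).continuousAt.continuousWithinAt)
      (fun l hl => hd l (ball_subset_closedBall hl.1))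
    rw [Real.circleAverage_def] at this
    simp only [zero_smul, add_zero] at this
    simp only [hF]
    rw [intervalIntegral.integral_const_mul, ← this, Complex.real_smul]
    push_cast
    field_simp
  have hint : Integrable (Function.uncurry F)
      ((volume.restrict (uIoc 0 (2 * Real.pi))).prod
        (volume.restrict (closedBall (0 : Fin n → ℂ) r))) := by
    rw [Measure.prod_restrict, ← Measure.volume_eq_prod]
    have hcont : ContinuousOn (Function.uncurry F)
        (Icc 0 (2 * Real.pi) ×ˢ closedBall (0 : Fin n → ℂ) r) := by
      refine (by fun_prop : ContinuousOn (fun p : ℝ × (Fin n → ℂ) => ρ p.2) _).mul ?_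
      refine hf.continuousOn.comp (f := fun p : ℝ × (Fin n → ℂ) => w + circleMap 0 1 p.1 • p.2)
        ?_ ?_
      · have := continuous_circleMap 0 1
        fun_prop
      · intro p hp
        exact hmem _ _ (hc1 _).le hp.2
    refine (hcont.integrableOn_compact (isCompact_Icc.prod (isCompact_closedBall _ _))).mono_set ?_
    refine prod_mono ?_ subset_rfl
    rw [uIoc_of_le (by positivity)]
    exact Ioc_subset_Icc_self
  have hswap := intervalIntegral_integral_swap hint
  rw [setIntegral_congr_fun measurableSet_closedBall hb] at hswap
  simp only [ha] at hswap
  rw [intervalIntegral.integral_const, integral_const_mul, hset (fun _ => f w),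
    integral_mul_const, sub_zero, Complex.real_smul] at hswap
  push_cast at hswap
  have h2 : (2 * Real.pi : ℂ) ≠ 0 := by simp
  exact mul_left_cancel₀ h2 hswap

/-- Urysohn's lemma. The clause `χ x = ‖χ x‖` encodes that the complex-valued `χ` is real and
nonnegative. -/
theorem exists_isCompactlySupportedIn_eqOn_one {n : ℕ} {G K : Set (Fin n → ℂ)} (hG : IsOpen G)
    (hK : IsCompact K) (hKG : K ⊆ G) :
    ∃ χ : (Fin n → ℂ) → ℂ, IsCompactlySupportedIn G χ ∧ EqOn χ 1 K ∧
      ∀ x, ‖χ x‖ ≤ 1 ∧ χ x = ‖χ x‖ := by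
  obtain ⟨χ, h1, h2, h3, h4⟩ := exists_continuousMap_one_of_isCompact_subset_isOpen hK hG hKG
  have hsub : tsupport (fun x => (χ x : ℂ)) ⊆ tsupport χ := by
    refine closure_mono fun x hx h => hx ?_
    simp [h]
  refine ⟨fun x => (χ x : ℂ), ⟨by fun_prop, h2.of_isClosed_subset (isClosed_tsupport _) hsub,
    hsub.trans h3⟩, fun x hx => by simp [h1 hx], fun x => ?_⟩
  rw [Complex.norm_real, Real.norm_of_nonneg (h4 x).1]
  exact ⟨(h4 x).2, rfl⟩

/-! ### Weyl's lemma for push-forwards of complex measures. -/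

/-- If `a · ψ ∘ f` is integrable for all `ψ ∈ C_c(G)`, then `a` has an integrable majorant on the
preimage of every compact subset of `G`. -/
theorem exists_integrable_bound_of_isCompact {n : ℕ} {X : Type*} [MeasurableSpace X] {μ : Measure X}
    {f : X → Fin n → ℂ} {a : X → ℂ} {G : Set (Fin n → ℂ)} (hG : IsOpen G)
    (hint : ∀ ψ, IsCompactlySupportedIn G ψ → Integrable (fun x => a x * ψ (f x)) μ)
    {K : Set (Fin n → ℂ)} (hK : IsCompact K) (hKG : K ⊆ G) :
    ∃ b : X → ℝ, Integrable b μ ∧ (∀ x, 0 ≤ b x) ∧ ∀ x, f x ∈ K → ‖a x‖ ≤ b x := by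
  obtain ⟨χ, hχ, h1, -⟩ := exists_isCompactlySupportedIn_eqOn_one hG hK hKG
  refine ⟨fun x => ‖a x * χ (f x)‖, (hint χ hχ).norm, fun x => norm_nonneg _, fun x hx => ?_⟩
  simp [h1 hx]

/-- This is the domain of a mollification at scale `ε`; the strict inequality leaves room to move
the centre. -/
theorem isOpen_setOf_closedBall_subset {E : Type*} [PseudoMetricSpace E] (G : Set E) (ε : ℝ) :
    IsOpen {y | ∃ s > ε, closedBall y s ⊆ G} := by
  rw [Metric.isOpen_iff]
  rintro y ⟨s, hs, hsG⟩
  refine ⟨(s - ε) / 2, by linarith, fun z hz => ⟨ε + (s - ε) / 2, by linarith, ?_⟩⟩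
  refine (closedBall_subset_closedBall' ?_).trans hsG
  rw [mem_ball] at hz
  linarith

/-- Mollification `y ↦ ∫ a ρ(y - f)` of the complex measure `f_* (a μ)`. -/
noncomputable def pushMollify {n : ℕ} {X : Type*} [MeasurableSpace X] (μ : Measure X)
    (f : X → Fin n → ℂ) (a : X → ℂ) (ρ : (Fin n → ℂ) → ℂ) (y : Fin n → ℂ) : ℂ :=
  ∫ x, a x * ρ (y - f x) ∂μ

/-- Differentiating under the integral, the `∂̄`-derivative of the mollification at `y` is minus the
integral of `a` against the `∂̄`-derivative of the test function `z ↦ ρ (y - z)`, which vanishes by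
`hdbar`. -/
theorem differentiableOn_pushMollify {n : ℕ} {X : Type*} [MeasurableSpace X] {μ : Measure X}
    {f : X → Fin n → ℂ} {a : X → ℂ} {G : Set (Fin n → ℂ)} (hG : IsOpen G)
    (hf : AEStronglyMeasurable f μ) (ha : AEStronglyMeasurable a μ)
    (hint : ∀ ψ, IsCompactlySupportedIn G ψ → Integrable (fun x => a x * ψ (f x)) μ)
    (hdbar : ∀ ψ, IsCompactlySupportedIn G ψ → ContDiff ℝ 1 ψ → ∀ j,
      ∫ x, a x * dbar (fderiv ℝ ψ (f x)) (Pi.single j 1) ∂μ = 0)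
    {ρ : (Fin n → ℂ) → ℂ} {ε : ℝ} (hρ : IsCircularMollifier ρ ε) :
    DifferentiableOn ℂ (pushMollify μ f a ρ) {y | ∃ s > ε, closedBall y s ⊆ G} := by
  rintro y ⟨s, hs, hsG⟩
  obtain ⟨b, hb, hb0, hba⟩ := exists_integrable_bound_of_isCompact hG hint
    (isCompact_closedBall y s) hsG
  have hρd : Continuous (fderiv ℝ ρ) := hρ.contDiff.continuous_fderiv (by simp)
  obtain ⟨C, hC⟩ := (hρ.hasCompactSupport.fderiv (𝕜 := ℝ)).exists_bound_of_continuous hρd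
  obtain ⟨M, hM⟩ := hρ.hasCompactSupport.exists_bound_of_continuous hρ.contDiff.continuous
  have hC0 : 0 ≤ C := (norm_nonneg _).trans (hC 0)
  have hM0 : 0 ≤ M := (norm_nonneg _).trans (hM 0)
  -- For `z` near `y`, points `x` with `f x` outside `closedBall y s` do not contribute, so the
  -- majorant `b` of `a` over that compact ball dominates everything.
  have hz0 : ∀ z x, dist z y < s - ε → f x ∉ closedBall y s → z - f x ∉ closedBall 0 ε := by
    intro z x hz hx h
    apply hx
    rw [mem_closedBall_zero_iff, ← dist_eq_norm] at h
    rw [mem_closedBall]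
    rw [dist_comm] at h
    linarith [dist_triangle (f x) z y]
  have hbd : ∀ x, ∀ z ∈ ball y (s - ε), ‖a x • fderiv ℝ ρ (z - f x)‖ ≤ C * b x := by
    intro x z hz
    by_cases hx : f x ∈ closedBall y s
    · rw [norm_smul, mul_comm]
      gcongr
      exacts [hC _, hba x hx]
    · have : fderiv ℝ ρ (z - f x) = 0 := by
        by_contra h
        exact hz0 z x hz hx (hρ.tsupport_subset (support_fderiv_subset ℝ h))
      rw [norm_smul, this, norm_zero, mul_zero]
      exact mul_nonneg hC0 (hb0 x)
  have hsub : ∀ z, AEStronglyMeasurable (fun x => z - f x) μ := fun z =>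
    aestronglyMeasurable_const.sub hf
  have hF'm : ∀ z, AEStronglyMeasurable (fun x => a x • fderiv ℝ ρ (z - f x)) μ := fun z =>
    ha.smul (hρd.comp_aestronglyMeasurable (hsub z))
  have hyb : y ∈ ball y (s - ε) := mem_ball_self (by linarith)
  have hder : HasFDerivAt (pushMollify μ f a ρ) (∫ x, a x • fderiv ℝ ρ (y - f x) ∂μ) y := by
    refine hasFDerivAt_integral_of_dominated_of_fderiv_le (𝕜 := ℝ)
      (F := fun y x => a x * ρ (y - f x)) (F' := fun y x => a x • fderiv ℝ ρ (y - f x))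
      (bound := fun x => C * b x) (ball_mem_nhds y (by linarith : 0 < s - ε)) ?_ ?_ (hF'm y)
      (Eventually.of_forall hbd) (hb.const_mul C) ?_
    · exact Eventually.of_forall fun z =>
        ha.mul (hρ.contDiff.continuous.comp_aestronglyMeasurable (hsub z))
    · refine (hb.const_mul M).mono'
        (ha.mul (hρ.contDiff.continuous.comp_aestronglyMeasurable (hsub y))) ?_
      refine Eventually.of_forall fun x => ?_
      by_cases hx : f x ∈ closedBall y s
      · rw [norm_mul, mul_comm]
        gcongr
        exacts [hM _, hba x hx]
      · have : ρ (y - f x) = 0 := by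
          by_contra h
          exact hz0 y x hyb hx (hρ.support_subset h)
        rw [this, mul_zero, norm_zero]
        exact mul_nonneg hM0 (hb0 x)
    · refine Eventually.of_forall fun x z _ => ?_
      have h1 : HasFDerivAt (fun z => ρ (z - f x)) (fderiv ℝ ρ (z - f x)) z :=
        by simpa [Function.comp_def] using ((hρ.contDiff.differentiable (by simp) (z - f x)).hasFDerivAt.comp z
          ((hasFDerivAt_id z).sub_const (f x)))
      exact h1.const_smul (a x)
  have hF'i : Integrable (fun x => a x • fderiv ℝ ρ (y - f x)) μ :=
    (hb.const_mul C).mono' (hF'm y) (Eventually.of_forall fun x => hbd x y hyb)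
  refine (hder.differentiableAt_of_dbar_eq_zero fun j => ?_).differentiableWithinAt
  have hψ : IsCompactlySupportedIn G (fun z => ρ (y - z)) := by
    have hsupp : Function.support (fun z => ρ (y - z)) ⊆ closedBall y ε := by
      intro z hz
      have := hρ.support_subset hz
      rwa [mem_closedBall_zero_iff, ← dist_eq_norm, dist_comm] at this
    have hts : tsupport (fun z => ρ (y - z)) ⊆ closedBall y ε :=
      closure_minimal hsupp isClosed_closedBall
    refine ⟨hρ.contDiff.continuous.comp (by fun_prop), ?_, ?_⟩
    · exact (isCompact_closedBall y ε).of_isClosed_subset (isClosed_tsupport _) hts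
    · exact hts.trans ((closedBall_subset_closedBall hs.le).trans hsG)
  have h1 := hdbar _ hψ (hρ.contDiff.comp (contDiff_const.sub contDiff_id)) j
  have h2 : ∀ x, fderiv ℝ (fun z => ρ (y - z)) (f x) = - fderiv ℝ ρ (y - f x) := by
    intro x
    refine HasFDerivAt.fderiv ?_
    simpa [Function.comp_def] using ((hρ.contDiff.differentiable (by simp) (y - f x)).hasFDerivAt.comp (f x)
      ((hasFDerivAt_id (f x)).const_sub y))
  simp only [h2] at h1
  have h3 : ∀ v, (∫ x, a x • fderiv ℝ ρ (y - f x) ∂μ) v = ∫ x, a x * fderiv ℝ ρ (y - f x) v ∂μ :=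
    fun v => ContinuousLinearMap.integral_apply hF'i v
  have h4 : ∀ v, Integrable (fun x => a x * fderiv ℝ ρ (y - f x) v) μ := fun v =>
    hF'i.apply_continuousLinearMap v
  rw [dbar, h3, h3, ← integral_const_mul, ← integral_add (h4 _) ((h4 _).const_mul _),
    ← neg_eq_zero, ← integral_neg, ← h1]
  congr 1
  ext x
  simp only [dbar, neg_apply]
  ring

/-- Each mollification is holomorphic, hence equals its own average against the other circular
mollifier. Both sides become the integral of `a` against the same convolution of `ρ` and `σ`,
evaluated at `y - f x`. -/
theorem pushMollify_eq_pushMollify {n : ℕ} {X : Type*} [MeasurableSpace X] {μ : Measure X}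
    [SFinite μ] {f : X → Fin n → ℂ} {a : X → ℂ} {G : Set (Fin n → ℂ)} (hG : IsOpen G)
    (hf : AEStronglyMeasurable f μ) (ha : AEStronglyMeasurable a μ)
    (hint : ∀ ψ, IsCompactlySupportedIn G ψ → Integrable (fun x => a x * ψ (f x)) μ)
    (hdbar : ∀ ψ, IsCompactlySupportedIn G ψ → ContDiff ℝ 1 ψ → ∀ j,
      ∫ x, a x * dbar (fderiv ℝ ψ (f x)) (Pi.single j 1) ∂μ = 0)
    {ρ σ : (Fin n → ℂ) → ℂ} {ε δ : ℝ} (hρ : IsCircularMollifier ρ ε)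
    (hσ : IsCircularMollifier σ δ) {y : Fin n → ℂ} {s : ℝ}
    (hs : ε + δ < s) (hsG : closedBall y s ⊆ G) :
    pushMollify μ f a ρ y = pushMollify μ f a σ y := by
  have hmv : ∀ {ρ σ : (Fin n → ℂ) → ℂ} {ε δ : ℝ}, IsCircularMollifier ρ ε →
      IsCircularMollifier σ δ → ε + δ < s →
      pushMollify μ f a ρ y = ∫ v, σ v * pushMollify μ f a ρ (y + v) := by
    intro ρ σ ε δ hρ hσ hs
    rw [integral_mul_of_circular (isOpen_setOf_closedBall_subset G ε)
      (differentiableOn_pushMollify hG hf ha hint hdbar hρ) (r := δ) ?_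
      hσ.contDiff.continuous hσ.circular hσ.support_subset, hσ.integral_eq, one_mul]
    intro z hz
    refine ⟨s - δ, by linarith, (closedBall_subset_closedBall' ?_).trans hsG⟩
    rw [mem_closedBall] at hz
    linarith
  obtain ⟨b, hb, hb0, hba⟩ := exists_integrable_bound_of_isCompact hG hint
    (isCompact_closedBall y s) hsG
  have hfub : ∀ {ρ σ : (Fin n → ℂ) → ℂ} {ε δ : ℝ}, IsCircularMollifier ρ ε →
      IsCircularMollifier σ δ → ε + δ < s → Integrable (Function.uncurry fun (v : Fin n → ℂ)
        (x : X) => σ v * (a x * ρ (y + v - f x))) ((volume : Measure (Fin n → ℂ)).prod μ) := by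
    intro ρ σ ε δ hρ hσ hs
    obtain ⟨M, hM⟩ := hρ.hasCompactSupport.exists_bound_of_continuous hρ.contDiff.continuous
    have hM0 : 0 ≤ M := (norm_nonneg _).trans (hM 0)
    refine ((hσ.integrable.norm.mul_prod hb).const_mul M).mono' ?_ (Eventually.of_forall ?_)
    · refine (hσ.contDiff.continuous.comp_aestronglyMeasurable
        measurable_fst.aestronglyMeasurable).mul (ha.comp_snd.mul ?_)
      refine hρ.contDiff.continuous.comp_aestronglyMeasurable ?_
      exact (aestronglyMeasurable_const.add measurable_fst.aestronglyMeasurable).sub hf.comp_snd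
    · rintro ⟨v, x⟩
      simp only [Function.uncurry, norm_mul]
      by_cases hv : v ∈ closedBall 0 δ
      · by_cases hx : f x ∈ closedBall y s
        · calc ‖σ v‖ * (‖a x‖ * ‖ρ (y + v - f x)‖) ≤ ‖σ v‖ * (b x * M) := by
                gcongr
                exacts [hb0 x, hba x hx, hM _]
            _ = M * (‖σ v‖ * b x) := by ring
        · have : ρ (y + v - f x) = 0 := by
            by_contra h
            have h1 := hρ.support_subset h
            apply hx
            rw [mem_closedBall_zero_iff, ← dist_eq_norm, dist_comm] at h1
            rw [mem_closedBall_zero_iff] at hv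
            have h2 : dist (y + v) y = ‖v‖ := by simp [dist_eq_norm]
            rw [mem_closedBall]
            linarith [dist_triangle (f x) (y + v) y]
          rw [this]
          have := hb0 x
          simp only [norm_zero, mul_zero]
          positivity
      · have : σ v = 0 := by
          by_contra h
          exact hv (hσ.support_subset h)
        simp [this]
  rw [hmv hρ hσ hs, hmv hσ hρ (by linarith)]
  simp only [pushMollify, ← integral_const_mul]
  rw [integral_integral_swap (hfub hρ hσ hs)]
  -- The substitution `v ↦ f x - y - v` and the evenness of both mollifiers exchange `ρ` and `σ`.
  have hswap2 : ∀ x, ∫ v, σ v * (a x * ρ (y + v - f x)) = ∫ v, ρ v * (a x * σ (y + v - f x)) := by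
    intro x
    rw [← integral_sub_left_eq_self (fun v => σ v * (a x * ρ (y + v - f x))) volume (f x - y)]
    congr 1
    ext v
    have h1 : σ (f x - y - v) = σ (y + v - f x) := by
      rw [← hσ.apply_neg]; congr 1; abel
    have h2 : ρ (y + (f x - y - v) - f x) = ρ v := by
      rw [← hρ.apply_neg]; congr 1; abel
    rw [h1, h2]; ring
  simp only [hswap2]
  exact integral_integral_swap (hfub hσ hρ (by linarith)).swap

/-- The density `ρ` is a probability density, so averaging against it cannot increase the distance
from `c`. -/
theorem IsCircularMollifier.norm_integral_sub_le {n : ℕ} {ρ g : (Fin n → ℂ) → ℂ} {ε η : ℝ}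
    (hρ : IsCircularMollifier ρ ε) (hg : Continuous g) {c : ℂ}
    (h : ∀ v ∈ closedBall 0 ε, ‖g v - c‖ ≤ η) : ‖(∫ v, ρ v * g v) - c‖ ≤ η := by
  have h1 : ∫ v, ‖ρ v‖ = 1 := by
    have h2 := hρ.integral_eq
    rw [integral_congr_ae (Eventually.of_forall hρ.nonneg), integral_complex_ofReal] at h2
    exact_mod_cast h2
  have h3 : Integrable fun v => ρ v * g v :=
    (hρ.contDiff.continuous.mul hg).integrable_of_hasCompactSupport hρ.hasCompactSupport.mul_right
  have h4 : (∫ v, ρ v * g v) - c = ∫ v, ρ v * (g v - c) := by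
    simp only [mul_sub]
    rw [integral_sub h3 (hρ.integrable.mul_const c), integral_mul_const, hρ.integral_eq, one_mul]
  rw [h4]
  calc ‖∫ v, ρ v * (g v - c)‖ ≤ ∫ v, ‖ρ v‖ * η := by
        refine norm_integral_le_of_norm_le (hρ.integrable.norm.mul_const η)
          (Eventually.of_forall fun v => ?_)
        rw [norm_mul]
        by_cases hv : v ∈ closedBall 0 ε
        · gcongr
          exact h v hv
        · have : ρ v = 0 := by
            by_contra h'
            exact hv (hρ.support_subset h')
          simp [this]
    _ = η := by rw [integral_mul_const, h1, one_mul]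

/-- Weyl's lemma for the complex measure `f_* (a μ)`: if its `∂̄`-derivatives vanish on `G`, then
it has a holomorphic density on `G`. -/
theorem exists_holomorphic_of_integral_dbar_eq_zero {n : ℕ} {X : Type*} [MeasurableSpace X]
    {μ : Measure X} [SFinite μ] {f : X → Fin n → ℂ} {a : X → ℂ} {G : Set (Fin n → ℂ)}
    (hG : IsOpen G) (hf : AEStronglyMeasurable f μ) (ha : AEStronglyMeasurable a μ)
    (hint : ∀ ψ, IsCompactlySupportedIn G ψ → Integrable (fun x => a x * ψ (f x)) μ)
    (hdbar : ∀ ψ, IsCompactlySupportedIn G ψ → ContDiff ℝ 1 ψ → ∀ j,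
      ∫ x, a x * dbar (fderiv ℝ ψ (f x)) (Pi.single j 1) ∂μ = 0) :
    ∃ h : (Fin n → ℂ) → ℂ, DifferentiableOn ℂ h G ∧ ∀ ψ, IsCompactlySupportedIn G ψ →
      ∫ x, a x * ψ (f x) ∂μ = ∫ y, h y * ψ y := by
  have hex : ∀ ε : ℝ, 0 < ε → ∃ ρ : (Fin n → ℂ) → ℂ, IsCircularMollifier ρ ε := fun ε hε =>
    exists_isCircularMollifier n hε
  choose! ρ hρ using hex
  have hball : ∀ y ∈ G, ∃ r > 0, closedBall y r ⊆ G := fun y hy =>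
    nhds_basis_closedBall.mem_iff.1 (hG.mem_nhds hy)
  choose! R hR0 hR using hball
  set h : (Fin n → ℂ) → ℂ := fun y => pushMollify μ f a (ρ (R y / 3)) y with hh
  have key : ∀ y s ε, closedBall y s ⊆ G → 0 < ε → ε < s → pushMollify μ f a (ρ ε) y = h y := by
    intro y s ε hs hε hεs
    have hy : y ∈ G := hs (mem_closedBall_self (hε.trans hεs).le)
    have hRy := hR0 y hy
    -- The scales `ε` and `R y / 3` need not be comparable inside a single ball; a third scale is
    -- chosen small enough to be compared with each of them.
    have hδ : 0 < min (s - ε) (R y) / 3 := by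
      have : 0 < min (s - ε) (R y) := lt_min (by linarith) hRy
      positivity
    have h1 := min_le_left (s - ε) (R y)
    have h2 := min_le_right (s - ε) (R y)
    rw [pushMollify_eq_pushMollify hG hf ha hint hdbar (hρ ε hε) (hρ _ hδ) (by linarith) hs, hh]
    exact pushMollify_eq_pushMollify hG hf ha hint hdbar (hρ _ hδ) (hρ _ (by positivity))
      (by linarith) (hR y hy)
  refine ⟨h, ?_, ?_⟩
  · intro y hy
    have hr := hR0 y hy
    have h1 := differentiableOn_pushMollify hG hf ha hint hdbar (hρ (R y / 3) (by positivity))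
    have h2 : y ∈ {z | ∃ s > R y / 3, closedBall z s ⊆ G} := ⟨R y, by linarith, hR y hy⟩
    have h3 := (h1 y h2).differentiableAt ((isOpen_setOf_closedBall_subset _ _).mem_nhds h2)
    refine (h3.congr_of_eventuallyEq ?_).differentiableWithinAt
    filter_upwards [ball_mem_nhds y (by positivity : 0 < R y / 3)] with z hz
    refine (key z (2 * R y / 3) (R y / 3) ((closedBall_subset_closedBall' ?_).trans (hR y hy))
      (by positivity) (by linarith)).symm
    rw [mem_ball] at hz
    linarith
  · intro ψ hψ
    obtain ⟨r, hr, hrG⟩ := hψ.hasCompactSupport.isCompact.exists_cthickening_subset_open hG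
      hψ.tsupport_subset
    set K' := cthickening r (tsupport ψ) with hK'
    have hK'c : IsCompact K' := hψ.hasCompactSupport.isCompact.cthickening
    obtain ⟨b, hb, hb0, hba⟩ := exists_integrable_bound_of_isCompact hG hint hK'c hrG
    obtain ⟨C, hC⟩ := hψ.hasCompactSupport.exists_bound_of_continuous hψ.continuous
    have hC0 : 0 ≤ C := (norm_nonneg _).trans (hC 0)
    set ε : ℕ → ℝ := fun k => r / 2 * (1 / ((k : ℝ) + 1)) with hε
    have hε0 : ∀ k, 0 < ε k := fun k => by positivity
    have hεr : ∀ k, ε k < r := by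
      intro k
      have : 1 / ((k : ℝ) + 1) ≤ 1 := by
        rw [div_le_one (by positivity)]; linarith [(Nat.cast_nonneg k : (0 : ℝ) ≤ k)]
      simp only [hε]
      nlinarith
    have hεlim : Tendsto ε atTop (𝓝 0) := by
      simpa [hε] using (tendsto_one_div_add_atTop_nhds_zero_nat (𝕜 := ℝ)).const_mul (r / 2)
    -- The test function is mollified instead of the measure. Since `ε k < r`, every `ψk k` vanishes
    -- outside the compact set `K'` in `G`.
    set ψk : ℕ → (Fin n → ℂ) → ℂ := fun k z => ∫ v, ρ (ε k) v * ψ (z + v) with hψk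
    have hψs : ∀ z, Continuous fun v => ψ (z + v) := fun z =>
      hψ.continuous.comp (continuous_const.add continuous_id)
    have hψkC : ∀ k z, ‖ψk k z‖ ≤ C := by
      intro k z
      simpa using (hρ _ (hε0 k)).norm_integral_sub_le (c := 0) (η := C) (hψs z)
        fun v _ => by simpa using hC (z + v)
    have hψk0 : ∀ k z, z ∉ K' → ψk k z = 0 := by
      intro k z hz
      have := (hρ _ (hε0 k)).norm_integral_sub_le (c := 0) (η := 0) (hψs z) fun v hv => by
        have h1 : ψ (z + v) = 0 := by
          by_contra h
          refine hz (closedBall_subset_cthickening (subset_closure h) r ?_)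
          rw [mem_closedBall_zero_iff] at hv
          rw [mem_closedBall, dist_eq_norm]
          have : z - (z + v) = - v := by abel
          rw [this, norm_neg]
          exact hv.trans (hεr k).le
        simp [h1]
      simpa using this
    have hψlim : ∀ z, Tendsto (fun k => ψk k z) atTop (𝓝 (ψ z)) := by
      intro z
      rw [Metric.tendsto_atTop]
      intro η hη
      obtain ⟨δ, hδ, hδψ⟩ := Metric.continuous_iff.1 hψ.continuous z (η / 2) (by positivity)
      obtain ⟨N, hN⟩ := Metric.tendsto_atTop.1 hεlim δ hδ
      refine ⟨N, fun k hk => ?_⟩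
      have h1 := hN k hk
      rw [Real.dist_0_eq_abs, abs_of_pos (hε0 k)] at h1
      rw [dist_eq_norm]
      refine ((hρ _ (hε0 k)).norm_integral_sub_le (hψs z) fun v hv => ?_).trans_lt (half_lt_self hη)
      rw [← dist_eq_norm]
      refine (hδψ _ ?_).le
      rw [mem_closedBall_zero_iff] at hv
      simpa [dist_eq_norm] using hv.trans_lt h1
    -- By Fubini the left side is the integral of `ψ` against the mollification at scale `ε k`,
    -- which already equals `h` on the support of `ψ`; so the value is independent of `k`.
    have heq : ∀ k, ∫ x, a x * ψk k (f x) ∂μ = ∫ y, h y * ψ y := by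
      intro k
      have hρk := hρ _ (hε0 k)
      obtain ⟨M, hM⟩ := hρk.hasCompactSupport.exists_bound_of_continuous hρk.contDiff.continuous
      have hM0 : 0 ≤ M := (norm_nonneg _).trans (hM 0)
      have h1 : ∀ y, h y * ψ y = ∫ x, ψ y * (a x * ρ (ε k) (y - f x)) ∂μ := by
        intro y
        rw [integral_const_mul]
        by_cases hy : y ∈ tsupport ψ
        · rw [← key y r (ε k) ((closedBall_subset_cthickening hy r).trans hrG) (hε0 k) (hεr k),
            mul_comm]
          rfl
        · simp [image_eq_zero_of_notMem_tsupport hy]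
      have h2 : ∀ x, a x * ψk k (f x) = ∫ y, ψ y * (a x * ρ (ε k) (y - f x)) := by
        intro x
        rw [← integral_add_left_eq_self _ (f x), hψk, ← integral_const_mul]
        congr 1
        ext v
        rw [add_sub_cancel_left]
        ring
      simp only [h1, h2]
      refine (integral_integral_swap ?_).symm
      have hψi : Integrable ψ :=
        hψ.continuous.integrable_of_hasCompactSupport hψ.hasCompactSupport
      refine ((hψi.norm.mul_prod hb).const_mul M).mono' ?_ (Eventually.of_forall ?_)
      · refine (hψ.continuous.comp_aestronglyMeasurable
          measurable_fst.aestronglyMeasurable).mul (ha.comp_snd.mul ?_)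
        exact hρk.contDiff.continuous.comp_aestronglyMeasurable
          (measurable_fst.aestronglyMeasurable.sub hf.comp_snd)
      · rintro ⟨y, x⟩
        simp only [Function.uncurry, norm_mul]
        have hgoal : ‖ψ y‖ * (b x * M) = M * (‖ψ y‖ * b x) := by ring
        rw [← hgoal]
        by_cases hy : y ∈ tsupport ψ
        · refine mul_le_mul_of_nonneg_left ?_ (norm_nonneg _)
          by_cases hx : f x ∈ K'
          · exact mul_le_mul (hba x hx) (hM _) (norm_nonneg _) (hb0 x)
          · have : ρ (ε k) (y - f x) = 0 := by
              by_contra h'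
              have h3 := hρk.support_subset h'
              apply hx
              refine closedBall_subset_cthickening hy r ?_
              rw [mem_closedBall_zero_iff, ← dist_eq_norm, dist_comm] at h3
              exact h3.trans (hεr k).le
            rw [this]
            have := hb0 x
            simp only [norm_zero, mul_zero]
            positivity
        · simp [image_eq_zero_of_notMem_tsupport hy]
    have hlim : Tendsto (fun k => ∫ x, a x * ψk k (f x) ∂μ) atTop (𝓝 (∫ x, a x * ψ (f x) ∂μ)) := by
      -- Continuity serves only to make the integrands measurable; it is read off from a
      -- convolution.
      have hψkc : ∀ k, Continuous (ψk k) := by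
        intro k
        have hρk := hρ _ (hε0 k)
        have h1 : ψk k = fun z => ∫ y, ρ (ε k) (z - y) * ψ y := by
          ext z
          rw [← integral_add_left_eq_self _ z]
          simp only [hψk]
          congr 1
          ext v
          rw [← hρk.apply_neg]
          congr 2
          abel
        have h2 : ψk k = MeasureTheory.convolution ψ (ρ (ε k)) (ContinuousLinearMap.mul ℂ ℂ)
            volume := by
          rw [h1]
          ext z
          simp [MeasureTheory.convolution, mul_comm]
        rw [h2]
        exact hρk.hasCompactSupport.continuous_convolution_right _
          (hψ.continuous.integrable_of_hasCompactSupport hψ.hasCompactSupport).locallyIntegrable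
          hρk.contDiff.continuous
      refine tendsto_integral_of_dominated_convergence (fun x => C * b x) ?_ (hb.const_mul C) ?_ ?_
      · exact fun k => ha.mul ((hψkc k).comp_aestronglyMeasurable hf)
      · refine fun k => Eventually.of_forall fun x => ?_
        by_cases hx : f x ∈ K'
        · rw [norm_mul, mul_comm]
          gcongr
          exacts [hψkC _ _, hba x hx]
        · rw [hψk0 k _ hx, mul_zero, norm_zero]
          exact mul_nonneg hC0 (hb0 x)
      · exact Eventually.of_forall fun x => (hψlim (f x)).const_mul _
    simp only [heq] at hlim
    exact tendsto_nhds_unique hlim tendsto_const_nhds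

/-! ### Jacobian matrices, the Piola identity and integration by parts. -/

/-- The complex Jacobian matrix of `f` at `w`. -/
noncomputable def jacobianMatrix {n : ℕ} (f : (Fin n → ℂ) → (Fin n → ℂ)) (w : Fin n → ℂ) :
    Matrix (Fin n) (Fin n) ℂ :=
  Matrix.of fun i j => fderiv ℂ (fun z => f z i) w (Pi.single j 1)

/-- Jacobi's formula: the derivative of a determinant, column by column. -/
theorem fderiv_det_eq_sum {n : ℕ} {E : Type*} [NormedAddCommGroup E] [NormedSpace ℂ E]
    {M : E → Matrix (Fin n) (Fin n) ℂ} {w : E}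
    (hM : ∀ i j, DifferentiableAt ℂ (fun z => M z i j) w) (v : E) :
    fderiv ℂ (fun z => (M z).det) w v =
      ∑ l, ((M w).updateCol l fun k => fderiv ℂ (fun z => M z k l) w v).det := by
  have h1 : HasFDerivAt (fun z => (M z).det) (∑ σ : Equiv.Perm (Fin n),
      ((Equiv.Perm.sign σ : ℤ) : ℂ) • ∑ l, (∏ m ∈ Finset.univ.erase l, M w (σ m) m) •
        fderiv ℂ (fun z => M z (σ l) l) w) w := by
    simp only [Matrix.det_apply']
    refine HasFDerivAt.fun_sum fun σ _ => ?_
    refine HasFDerivAt.const_mul ?_ _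
    exact HasFDerivAt.finsetProd fun l _ => (hM (σ l) l).hasFDerivAt
  rw [h1.fderiv]
  simp only [Matrix.det_apply', sum_apply, smul_apply, smul_eq_mul]
  rw [Finset.sum_comm]
  refine Finset.sum_congr rfl fun σ _ => ?_
  rw [Finset.mul_sum]
  refine Finset.sum_congr rfl fun l _ => ?_
  rw [← Finset.mul_prod_erase Finset.univ _ (Finset.mem_univ l)]
  simp only [Matrix.updateCol_self]
  congr 1
  rw [mul_comm]
  congr 1
  refine Finset.prod_congr rfl fun m hm => ?_
  rw [Matrix.updateCol_ne (Finset.ne_of_mem_erase hm)]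

theorem differentiableOn_jacobianMatrix_apply {n : ℕ} {f : (Fin n → ℂ) → (Fin n → ℂ)}
    {D : Set (Fin n → ℂ)} (hD : IsOpen D) (hf : DifferentiableOn ℂ f D) (i j : Fin n) :
    DifferentiableOn ℂ (fun w => jacobianMatrix f w i j) D :=
  (differentiableOn_pi.1 hf i).fderiv_apply_holomorphic hD _

theorem differentiableOn_det {n : ℕ} {E : Type*} [NormedAddCommGroup E] [NormedSpace ℂ E]
    {M : E → Matrix (Fin n) (Fin n) ℂ} {D : Set E}
    (hM : ∀ i j, DifferentiableOn ℂ (fun z => M z i j) D) :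
    DifferentiableOn ℂ (fun z => (M z).det) D := by
  simp only [Matrix.det_apply']
  refine DifferentiableOn.fun_sum fun σ _ => DifferentiableOn.const_mul ?_ _
  intro z hz
  exact (HasFDerivWithinAt.finsetProd fun l _ =>
    (hM (σ l) l z hz).hasFDerivWithinAt).differentiableWithinAt

theorem differentiableOn_updateCol {n : ℕ} {E : Type*} [NormedAddCommGroup E] [NormedSpace ℂ E]
    {M : E → Matrix (Fin n) (Fin n) ℂ} {D : Set E}
    (hM : ∀ i j, DifferentiableOn ℂ (fun z => M z i j) D) (i : Fin n) (b : Fin n → ℂ)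
    (k l : Fin n) : DifferentiableOn ℂ (fun z => (M z).updateCol i b k l) D := by
  by_cases h : l = i
  · subst h
    simp only [Matrix.updateCol_self]
    exact differentiableOn_const _
  · simp only [Matrix.updateCol_ne h]
    exact hM k l

/-- The columns of the adjugate of the Jacobian matrix, as vector fields. -/
noncomputable def cofactorField {n : ℕ} (f : (Fin n → ℂ) → (Fin n → ℂ)) (j i : Fin n)
    (w : Fin n → ℂ) : ℂ :=
  ((jacobianMatrix f w).updateCol i (Pi.single j 1)).det

theorem differentiableOn_cofactorField {n : ℕ} {f : (Fin n → ℂ) → (Fin n → ℂ)}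
    {D : Set (Fin n → ℂ)} (hD : IsOpen D) (hf : DifferentiableOn ℂ f D) (j i : Fin n) :
    DifferentiableOn ℂ (cofactorField f j i) D :=
  differentiableOn_det (differentiableOn_updateCol (differentiableOn_jacobianMatrix_apply hD hf) _ _)

/-- The Piola identity: the rows of the cofactor matrix are divergence free. -/
theorem sum_fderiv_cofactorField {n : ℕ} {f : (Fin n → ℂ) → (Fin n → ℂ)}
    {D : Set (Fin n → ℂ)} (hD : IsOpen D) (hf : DifferentiableOn ℂ f D) (j : Fin n)
    {w : Fin n → ℂ} (hw : w ∈ D) :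
    ∑ i, fderiv ℂ (cofactorField f j i) w (Pi.single i 1) = 0 := by
  set J := jacobianMatrix f w with hJ
  -- `H i l` is the derivative of column `l` in direction `i`, a vector of second derivatives, hence
  -- symmetric in `i` and `l`.
  let H : Fin n → Fin n → Fin n → ℂ := fun i l k =>
    fderiv ℂ (fun z => jacobianMatrix f z k l) w (Pi.single i 1)
  have hH : ∀ i l, H i l = H l i := by
    intro i l
    ext k
    exact (differentiableOn_pi.1 hf k).fderiv_fderiv_comm hD hw _ _
  -- The contribution of differentiating column `l` in direction `i`. Column `i` is the constant
  -- vector `Pi.single j 1`, hence the zero diagonal; exchanging columns `i` and `l` shows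
  -- antisymmetry, so the double sum vanishes.
  let a : Fin n → Fin n → ℂ := fun i l =>
    if i = l then 0 else ((J.updateCol i (Pi.single j 1)).updateCol l (H i l)).det
  have ha : ∀ i l, a i l = - a l i := by
    intro i l
    by_cases h : i = l
    · simp [a, h]
    · simp only [a, if_neg h, if_neg (Ne.symm h)]
      have h1 : (J.updateCol i (Pi.single j 1)).updateCol l (H i l) =
          ((J.updateCol l (Pi.single j 1)).updateCol i (H l i)).submatrix id (Equiv.swap i l) := by
        ext k m
        rw [Matrix.submatrix_apply, id]
        by_cases hmi : m = i
        · subst hmi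
          rw [Equiv.swap_apply_left, Matrix.updateCol_ne h, Matrix.updateCol_self,
            Matrix.updateCol_ne (Ne.symm h), Matrix.updateCol_self]
        · by_cases hml : m = l
          · subst hml
            rw [Equiv.swap_apply_right, Matrix.updateCol_self, Matrix.updateCol_self, hH]
          · rw [Equiv.swap_apply_of_ne_of_ne hmi hml, Matrix.updateCol_ne hml,
              Matrix.updateCol_ne hmi, Matrix.updateCol_ne hmi, Matrix.updateCol_ne hml]
      rw [h1, Matrix.det_permute', Equiv.Perm.sign_swap h]
      simp
  have hderiv : ∀ i, fderiv ℂ (cofactorField f j i) w (Pi.single i 1) = ∑ l, a i l := by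
    intro i
    have hdiff : ∀ k l, DifferentiableAt ℂ
        (fun z => (jacobianMatrix f z).updateCol i (Pi.single j 1) k l) w := fun k l =>
      (differentiableOn_updateCol (differentiableOn_jacobianMatrix_apply hD hf) i _ k l w
        hw).differentiableAt (hD.mem_nhds hw)
    have h1 := fderiv_det_eq_sum hdiff (Pi.single i 1)
    refine h1.trans (Finset.sum_congr rfl fun l _ => ?_)
    by_cases h : i = l
    · subst h
      simp only [a, if_true, Matrix.updateCol_self]
      refine Matrix.det_eq_zero_of_column_eq_zero i fun k => ?_
      simp
    · simp only [a, if_neg h, Matrix.updateCol_ne (Ne.symm h)]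
      rfl
  simp only [hderiv]
  have hS : ∑ i, ∑ l, a i l = - ∑ i, ∑ l, a i l := by
    conv_lhs => rw [Finset.sum_comm]
    simp only [← Finset.sum_neg_distrib]
    exact Finset.sum_congr rfl fun i _ => Finset.sum_congr rfl fun l _ => ha l i
  linear_combination hS / 2

theorem fderiv_apply_eq_jacobianMatrix {n : ℕ} {f : (Fin n → ℂ) → (Fin n → ℂ)} {w : Fin n → ℂ}
    (hf : DifferentiableAt ℂ f w) (i j : Fin n) :
    fderiv ℂ f w (Pi.single j 1) i = jacobianMatrix f w i j := by
  have h := hasFDerivAt_pi'.1 hf.hasFDerivAt i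
  rw [jacobianMatrix, Matrix.of_apply, h.fderiv]
  rfl

/-- This is Cramer's rule: the derivative of `f` sends the cofactor vector field to the determinant
times a constant coordinate field. It lets a coordinate `∂̄`-derivative on `G` be written through
derivatives on `D` without inverting the Jacobian. -/
theorem sum_cofactorField_smul {n : ℕ} {f : (Fin n → ℂ) → (Fin n → ℂ)} {w : Fin n → ℂ}
    (hf : DifferentiableAt ℂ f w) (j : Fin n) :
    ∑ i, cofactorField f j i w • fderiv ℂ f w (Pi.single i 1) =
      (jacobianMatrix f w).det • (Pi.single j 1 : Fin n → ℂ) := by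
  rw [← Matrix.mulVec_cramer]
  ext k
  simp only [Finset.sum_apply, Pi.smul_apply, smul_eq_mul, fderiv_apply_eq_jacobianMatrix hf,
    Matrix.mulVec, dotProduct, Matrix.cramer_apply, cofactorField]
  exact Finset.sum_congr rfl fun i _ => mul_comm _ _

theorem dbar_fderiv_mul {E : Type*} [NormedAddCommGroup E] [NormedSpace ℂ E] {φ ψ : E → ℂ} {w : E}
    (hφ : DifferentiableAt ℝ φ w) (hψ : DifferentiableAt ℝ ψ w) (v : E) :
    dbar (fderiv ℝ (fun z => φ z * ψ z) w) v =
      φ w * dbar (fderiv ℝ ψ w) v + ψ w * dbar (fderiv ℝ φ w) v := by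
  rw [fderiv_fun_mul hφ hψ]
  simp only [dbar, add_apply, smul_apply, smul_eq_mul]
  ring

theorem dbar_fderiv_holomorphic {E : Type*} [NormedAddCommGroup E] [NormedSpace ℂ E] {g : E → ℂ}
    {w : E} (hg : DifferentiableAt ℂ g w) (v : E) : dbar (fderiv ℝ g w) v = 0 := by
  rw [hg.fderiv_restrictScalars ℝ]
  simp only [dbar, ContinuousLinearMap.coe_restrictScalars', map_smul, smul_eq_mul]
  linear_combination fderiv ℂ g w v * Complex.I_sq

/-- The factor `2` appears because `dbar` is twice the conjugate-linear part. -/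
theorem dbar_fderiv_star {E : Type*} [NormedAddCommGroup E] [NormedSpace ℂ E] {g : E → ℂ}
    {w : E} (hg : DifferentiableAt ℂ g w) (v : E) :
    dbar (fderiv ℝ (fun z => star (g z)) w) v = 2 * star (fderiv ℂ g w v) := by
  have h1 : HasFDerivAt (fun z => star (g z))
      ((Complex.conjCLE : ℂ →L[ℝ] ℂ).comp ((fderiv ℂ g w).restrictScalars ℝ)) w :=
    (Complex.conjCLE : ℂ →L[ℝ] ℂ).hasFDerivAt.comp w (hg.hasFDerivAt.restrictScalars ℝ)
  rw [h1.fderiv]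
  simp only [dbar, ContinuousLinearMap.comp_apply, ContinuousLinearMap.coe_restrictScalars',
    map_smul, smul_eq_mul, ContinuousLinearEquiv.coe_coe, Complex.conjCLE_apply, map_mul,
    Complex.conj_I, Complex.star_def]
  linear_combination (-(starRingEnd ℂ) (fderiv ℂ g w v)) * Complex.I_sq

theorem dbar_fderiv_comp {E F : Type*} [NormedAddCommGroup E] [NormedSpace ℂ E]
    [NormedAddCommGroup F] [NormedSpace ℂ F] {ψ : F → ℂ} {f : E → F}
    {w : E} (hψ : DifferentiableAt ℝ ψ (f w)) (hf : DifferentiableAt ℂ f w) (v : E) :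
    dbar (fderiv ℝ (fun z => ψ (f z)) w) v = dbar (fderiv ℝ ψ (f w)) (fderiv ℂ f w v) := by
  have h1 : HasFDerivAt (fun z => ψ (f z))
      ((fderiv ℝ ψ (f w)).comp ((fderiv ℂ f w).restrictScalars ℝ)) w :=
    hψ.hasFDerivAt.comp w (hf.hasFDerivAt.restrictScalars ℝ)
  rw [h1.fderiv]
  simp [dbar]

theorem integral_fderiv_apply_eq_zero {E : Type*} [NormedAddCommGroup E] [NormedSpace ℝ E]
    [FiniteDimensional ℝ E] [MeasurableSpace E] [BorelSpace E] {μ : Measure E}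
    [μ.IsAddHaarMeasure] {H : E → ℂ} (hH : ContDiff ℝ 1 H) (hc : HasCompactSupport H) (v : E) :
    Integrable (fun w => fderiv ℝ H w v) μ ∧ ∫ w, fderiv ℝ H w v ∂μ = 0 := by
  have hi : Integrable (fun w => fderiv ℝ H w v) μ :=
    ((hH.continuous_fderiv (by simp)).clm_apply continuous_const).integrable_of_hasCompactSupport
      (hc.fderiv_apply (𝕜 := ℝ) v)
  refine ⟨hi, ?_⟩
  have := integral_mul_fderiv_eq_neg_fderiv_mul_of_integrable (μ := μ) (f := fun _ : E => (1 : ℂ))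
    (g := H) (v := v) (by simp) (by simpa using hi)
    (by simpa using hH.continuous.integrable_of_hasCompactSupport hc)
    (fun x _ => differentiableAt_const _) (fun x _ => hH.differentiable (by simp) x)
  simpa using this

/-- Integration by parts: for a proper holomorphic `f : D → G` with Jacobian determinant `u` and
`g` holomorphic on `D`, the push-forward `f_* (g ū)` is `∂̄`-closed on `G`. -/
theorem integral_mul_dbar_comp_eq_zero {n : ℕ} {D G : Set (Fin n → ℂ)} (hD : IsOpen D)
    {f : (Fin n → ℂ) → (Fin n → ℂ)} (hf : DifferentiableOn ℂ f D)
    (hprop : ∀ K, IsCompact K → K ⊆ G → IsCompact (D ∩ f ⁻¹' K))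
    {g : (Fin n → ℂ) → ℂ} (hg : DifferentiableOn ℂ g D) {ψ : (Fin n → ℂ) → ℂ}
    (hψ : IsCompactlySupportedIn G ψ) (hψ1 : ContDiff ℝ 1 ψ) (j : Fin n) :
    ∫ w in D, g w * star (jacobianMatrix f w).det *
      dbar (fderiv ℝ ψ (f w)) (Pi.single j 1) = 0 := by
  classical
  set K₀ := D ∩ f ⁻¹' tsupport ψ with hK₀
  have hK₀c : IsCompact K₀ := hprop _ hψ.hasCompactSupport.isCompact hψ.tsupport_subset
  have hd : ∀ {E : Type} [NormedAddCommGroup E] [NormedSpace ℂ E] {k : (Fin n → ℂ) → E} {w},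
      DifferentiableOn ℂ k D → w ∈ D → DifferentiableAt ℂ k w := fun hk hw =>
    (hk _ hw).differentiableAt (hD.mem_nhds hw)
  -- The components of a conjugate vector field, extended by zero. By properness their supports lie
  -- in the compact `K₀`, so they are globally `C¹` and every derivative has integral zero.
  set H : Fin n → (Fin n → ℂ) → ℂ := fun i =>
    D.indicator fun w => g w * star (cofactorField f j i w) * ψ (f w) with hH
  have hX := differentiableOn_cofactorField hD hf j
  have hfR : ContDiffOn ℝ 1 f D :=
    contDiffOn_pi.2 fun i => (differentiableOn_pi.1 hf i).contDiffOn_one_real hD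
  have hsmooth : ∀ i, ContDiffOn ℝ 1 (fun w => g w * star (cofactorField f j i w) * ψ (f w)) D := by
    intro i
    refine ((hg.contDiffOn_one_real hD).mul ?_).mul (hψ1.comp_contDiffOn hfR)
    exact Complex.conjCLE.contDiff.comp_contDiffOn ((hX i).contDiffOn_one_real hD)
  have hHD : ∀ i, ∀ w ∈ D, H i =ᶠ[𝓝 w] fun w => g w * star (cofactorField f j i w) * ψ (f w) := by
    intro i w hw
    filter_upwards [hD.mem_nhds hw] with z hz
    simp [hH, hz]
  have hH0 : ∀ i, ∀ w ∉ K₀, H i w = 0 := by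
    intro i w hw
    by_cases hwD : w ∈ D
    · have : f w ∉ tsupport ψ := fun h => hw ⟨hwD, h⟩
      simp [hH, hwD, image_eq_zero_of_notMem_tsupport this]
    · simp [hH, hwD]
  have hHev : ∀ i, ∀ w ∉ K₀, H i =ᶠ[𝓝 w] fun _ => 0 := by
    intro i w hw
    filter_upwards [hK₀c.isClosed.isOpen_compl.mem_nhds hw] with z hz using hH0 i z hz
  have hHc : ∀ i, HasCompactSupport (H i) := fun i => HasCompactSupport.intro hK₀c (hH0 i)
  have hHs : ∀ i, ContDiff ℝ 1 (H i) := by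
    intro i
    rw [contDiff_iff_contDiffAt]
    intro w
    by_cases hw : w ∈ K₀
    · exact ((hsmooth i).contDiffAt (hD.mem_nhds hw.1)).congr_of_eventuallyEq (hHD i w hw.1)
    · exact contDiffAt_const.congr_of_eventuallyEq (hHev i w hw)
  -- The `∂̄`-divergence of the field: `g` is holomorphic, the Piola identity removes the
  -- derivatives of the cofactors, and Cramer's rule identifies the remaining term.
  have hpt : ∀ w, ∑ i, dbar (fderiv ℝ (H i) w) (Pi.single i 1) = D.indicator
      (fun w => g w * star (jacobianMatrix f w).det *
        dbar (fderiv ℝ ψ (f w)) (Pi.single j 1)) w := by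
    intro w
    by_cases hw : w ∈ D
    · rw [indicator_of_mem hw]
      have hψw : DifferentiableAt ℝ ψ (f w) := hψ1.differentiable (by simp) _
      have h1 : ∀ i, dbar (fderiv ℝ (H i) w) (Pi.single i 1) =
          2 * g w * ψ (f w) * star (fderiv ℂ (cofactorField f j i) w (Pi.single i 1)) +
          g w * dbar (fderiv ℝ ψ (f w))
            (cofactorField f j i w • fderiv ℂ f w (Pi.single i 1)) := by
        intro i
        have hXw := hd (hX i) hw
        have hXr : DifferentiableAt ℝ (fun z => star (cofactorField f j i z)) w :=
          Complex.conjCLE.differentiableAt.comp w (hXw.restrictScalars ℝ)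
        have hgr : DifferentiableAt ℝ g w := (hd hg hw).restrictScalars ℝ
        have hgX : DifferentiableAt ℝ (fun z => g z * star (cofactorField f j i z)) w := hgr.mul hXr
        have hψf : DifferentiableAt ℝ (fun z => ψ (f z)) w :=
          hψw.comp w ((hd hf hw).restrictScalars ℝ)
        rw [(hHD i w hw).fderiv_eq, dbar_fderiv_mul hgX hψf, dbar_fderiv_mul hgr hXr,
          dbar_fderiv_holomorphic (hd hg hw), dbar_fderiv_star hXw,
          dbar_fderiv_comp hψw (hd hf hw), dbar_smul]
        ring
      simp only [h1, Finset.sum_add_distrib, ← Finset.mul_sum, ← star_sum, ← dbar_sum]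
      rw [sum_fderiv_cofactorField hD hf j hw, sum_cofactorField_smul (hd hf hw), dbar_smul]
      simp only [star_zero, mul_zero, zero_add]
      ring
    · rw [indicator_of_notMem hw]
      refine Finset.sum_eq_zero fun i _ => ?_
      rw [(hHev i w fun h => hw h.1).fderiv_eq]
      simp [dbar]
  have hI := fun i v => integral_fderiv_apply_eq_zero (μ := volume) (hHs i) (hHc i) v
  rw [← integral_indicator hD.measurableSet, ← integral_congr_ae (Eventually.of_forall hpt)]
  rw [integral_finsetSum]
  · refine Finset.sum_eq_zero fun i _ => ?_
    simp only [dbar]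
    rw [integral_add (hI i _).1 ((hI i _).1.const_mul _), integral_const_mul, (hI i _).2, (hI i _).2]
    simp
  · intro i _
    exact (hI i _).1.add ((hI i _).1.const_mul _)

/-! ### Push-forward to the Bergman space of the target. -/

/-- A sequence of cutoff functions exhausting an open set. -/
theorem exists_cutoff_sequence {n : ℕ} {G : Set (Fin n → ℂ)} (hG : IsOpen G) :
    ∃ χ : ℕ → (Fin n → ℂ) → ℂ, (∀ k, IsCompactlySupportedIn G (χ k)) ∧
      (∀ k x, ‖χ k x‖ ≤ 1 ∧ χ k x = ‖χ k x‖) ∧ ∀ x ∈ G, ∀ᶠ k in atTop, χ k x = 1 := by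
  let K : ℕ → Set (Fin n → ℂ) := fun k =>
    closedBall 0 k ∩ {y | ∀ z ∈ Gᶜ, 1 / ((k : ℝ) + 1) ≤ dist y z}
  have hKc : ∀ k, IsCompact (K k) := by
    intro k
    refine (isCompact_closedBall _ _).inter_right ?_
    have : {y : Fin n → ℂ | ∀ z ∈ Gᶜ, 1 / ((k : ℝ) + 1) ≤ dist y z} =
        ⋂ z ∈ Gᶜ, {y | 1 / ((k : ℝ) + 1) ≤ dist y z} := by ext; simp
    rw [this]
    exact isClosed_biInter fun z _ => isClosed_le continuous_const (by fun_prop)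
  have hKG : ∀ k, K k ⊆ G := by
    intro k y hy
    by_contra hyG
    have := hy.2 y hyG
    rw [dist_self] at this
    have : 0 < 1 / ((k : ℝ) + 1) := by positivity
    linarith
  choose χ h1 h2 h3 using fun k => exists_isCompactlySupportedIn_eqOn_one hG (hKc k) (hKG k)
  refine ⟨χ, h1, h3, fun x hx => ?_⟩
  obtain ⟨r, hr, hrG⟩ := Metric.isOpen_iff.1 hG x hx
  have e1 : ∀ᶠ k : ℕ in atTop, 1 / ((k : ℝ) + 1) < r :=
    tendsto_one_div_add_atTop_nhds_zero_nat.eventually (gt_mem_nhds hr)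
  have e2 : ∀ᶠ k : ℕ in atTop, ‖x‖ ≤ k := tendsto_natCast_atTop_atTop.eventually (eventually_ge_atTop _)
  filter_upwards [e1, e2] with k hk1 hk2
  refine h2 k ⟨by simpa using hk2, fun z hz => ?_⟩
  by_contra! hlt
  refine hz (hrG ?_)
  rw [mem_ball, dist_comm]
  linarith

theorem norm_integral_mul_le_sqrt {X : Type*} [MeasurableSpace X] {μ : Measure X} {g F : X → ℂ}
    (hg : MemLp g 2 μ) (hF : MemLp F 2 μ) :
    ‖∫ x, g x * F x ∂μ‖ ≤ √(∫ x, ‖g x‖ ^ 2 ∂μ) * √(∫ x, ‖F x‖ ^ 2 ∂μ) := by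
  have h1 := integral_mul_norm_le_Lp_mul_Lq (μ := μ) (f := g) (g := F) (p := 2) (q := 2)
    (by constructor <;> norm_num) (by simpa using hg) (by simpa using hF)
  calc ‖∫ x, g x * F x ∂μ‖ ≤ ∫ x, ‖g x * F x‖ ∂μ := norm_integral_le_integral_norm _
    _ = ∫ x, ‖g x‖ * ‖F x‖ ∂μ := by simp only [norm_mul]
    _ ≤ _ := by
      refine h1.trans (le_of_eq ?_)
      rw [Real.sqrt_eq_rpow, Real.sqrt_eq_rpow]
      norm_cast

/-- Fatou's lemma in `L²`; it turns uniform bounds on cut-off functions into square integrability.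
-/
theorem memLp_two_of_tendsto_of_integral_le {X : Type*} [MeasurableSpace X] {μ : Measure X}
    {F : ℕ → X → ℂ} {F₀ : X → ℂ} {B : ℝ} (hF : ∀ k, MemLp (F k) 2 μ)
    (hB : ∀ k, ∫ x, ‖F k x‖ ^ 2 ∂μ ≤ B)
    (hlim : ∀ᵐ x ∂μ, Tendsto (fun k => F k x) atTop (𝓝 (F₀ x))) : MemLp F₀ 2 μ := by
  refine ⟨aestronglyMeasurable_of_tendsto_ae atTop (fun k => (hF k).1) hlim, ?_⟩
  have h1 : ∀ k, eLpNorm (F k) 2 μ ≤ ENNReal.ofReal (√B) := by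
    intro k
    rw [(hF k).eLpNorm_eq_integral_rpow_norm (by simp) (by simp)]
    refine ENNReal.ofReal_le_ofReal ?_
    have : (∫ x, ‖F k x‖ ^ (2 : ENNReal).toReal ∂μ) ^ (2 : ENNReal).toReal⁻¹ =
        √(∫ x, ‖F k x‖ ^ 2 ∂μ) := by
      rw [Real.sqrt_eq_rpow]
      simp
    rw [this]
    exact Real.sqrt_le_sqrt (hB k)
  refine (Lp.eLpNorm_lim_le_liminf_eLpNorm (fun k => (hF k).1) F₀ hlim).trans_lt ?_
  refine lt_of_le_of_lt ?_ (ENNReal.ofReal_lt_top (r := √B))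
  exact liminf_le_of_frequently_le' (Frequently.of_forall h1)

/-- By properness the integrand vanishes off a compact subset of `D`, on which it is continuous. -/
theorem integrableOn_mul_comp_of_isCompactlySupportedIn {n : ℕ} {D G : Set (Fin n → ℂ)}
    (hD : IsOpen D) {f : (Fin n → ℂ) → (Fin n → ℂ)} (hf : ContinuousOn f D)
    (hprop : ∀ K, IsCompact K → K ⊆ G → IsCompact (D ∩ f ⁻¹' K)) {a : (Fin n → ℂ) → ℂ}
    (ha : ContinuousOn a D) {ψ : (Fin n → ℂ) → ℂ} (hψ : IsCompactlySupportedIn G ψ) :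
    IntegrableOn (fun w => a w * ψ (f w)) D := by
  have hK := hprop _ hψ.hasCompactSupport.isCompact hψ.tsupport_subset
  have hc : ContinuousOn (fun w => a w * ψ (f w)) D := ha.mul (hψ.continuous.comp_continuousOn hf)
  have h1 : IntegrableOn (fun w => a w * ψ (f w)) (D ∩ f ⁻¹' tsupport ψ) :=
    (hc.mono inter_subset_left).integrableOn_compact hK
  refine h1.of_forall_sdiff_eq_zero hD.measurableSet fun x hx => ?_
  have : f x ∉ tsupport ψ := fun h => hx.2 ⟨hx.1, h⟩
  simp [image_eq_zero_of_notMem_tsupport this]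

theorem differentiableOn_det_jacobianMatrix {n : ℕ} {f : (Fin n → ℂ) → (Fin n → ℂ)}
    {D : Set (Fin n → ℂ)} (hD : IsOpen D) (hf : DifferentiableOn ℂ f D) :
    DifferentiableOn ℂ (fun w => (jacobianMatrix f w).det) D :=
  differentiableOn_det (differentiableOn_jacobianMatrix_apply hD hf)

/-- For a proper holomorphic map `f : D → G`, the push-forward of `g ū` has a holomorphic density. -/
theorem exists_holomorphic_pushforward {n : ℕ} {D G : Set (Fin n → ℂ)} (hD : IsOpen D)
    (hG : IsOpen G) {f : (Fin n → ℂ) → (Fin n → ℂ)} (hf : DifferentiableOn ℂ f D)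
    (hprop : ∀ K, IsCompact K → K ⊆ G → IsCompact (D ∩ f ⁻¹' K))
    {g : (Fin n → ℂ) → ℂ} (hg : DifferentiableOn ℂ g D) :
    ∃ h : (Fin n → ℂ) → ℂ, DifferentiableOn ℂ h G ∧ ∀ ψ, IsCompactlySupportedIn G ψ →
      ∫ w in D, g w * star (jacobianMatrix f w).det * ψ (f w) = ∫ y, h y * ψ y := by
  have hu := differentiableOn_det_jacobianMatrix hD hf
  have ha : ContinuousOn (fun w => g w * star (jacobianMatrix f w).det) D :=
    hg.continuousOn.mul (continuous_star.comp_continuousOn hu.continuousOn)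
  exact exists_holomorphic_of_integral_dbar_eq_zero hG
    (hf.continuousOn.aestronglyMeasurable hD.measurableSet)
    (ha.aestronglyMeasurable hD.measurableSet)
    (fun ψ hψ => integrableOn_mul_comp_of_isCompactlySupportedIn hD hf.continuousOn hprop ha hψ)
    (fun ψ hψ hψ1 j => integral_mul_dbar_comp_eq_zero hD hf hprop hg hψ hψ1 j)

theorem IsCompactlySupportedIn.integrable {n : ℕ} {G : Set (Fin n → ℂ)} {ψ : (Fin n → ℂ) → ℂ}
    (h : IsCompactlySupportedIn G ψ) : Integrable ψ :=
  h.continuous.integrable_of_hasCompactSupport h.hasCompactSupport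

theorem IsCompactlySupportedIn.mul_right {n : ℕ} {G : Set (Fin n → ℂ)}
    {ψ a : (Fin n → ℂ) → ℂ} (h : IsCompactlySupportedIn G ψ) (hG : IsOpen G)
    (ha : ContinuousOn a G) : IsCompactlySupportedIn G (fun y => ψ y * a y) := by
  have hs : tsupport (fun y => ψ y * a y) ⊆ tsupport ψ := by
    refine closure_mono fun y hy h0 => hy ?_
    simp [h0]
  refine ⟨?_, h.hasCompactSupport.mono' ((subset_tsupport _).trans hs), hs.trans h.tsupport_subset⟩
  rw [continuous_iff_continuousAt]
  intro y
  by_cases hy : y ∈ tsupport ψ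
  · exact h.continuous.continuousAt.mul
      (ha.continuousAt (hG.mem_nhds (h.tsupport_subset hy)))
  · refine (continuousAt_const (y := (0 : ℂ))).congr ?_
    filter_upwards [(isClosed_tsupport ψ).isOpen_compl.mem_nhds hy] with z hz
    simp [image_eq_zero_of_notMem_tsupport hz]

/-- Change of variables for a proper holomorphic map: the push-forward of `|u|²` is a constant
multiple of Lebesgue measure. -/
theorem exists_const_integral_normSq_det {n : ℕ} {D G : Set (Fin n → ℂ)} (hD : IsOpen D)
    (hG : IsOpen G) (hGc : IsPreconnected G)
    {f : (Fin n → ℂ) → (Fin n → ℂ)} (hf : DifferentiableOn ℂ f D)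
    (hprop : ∀ K, IsCompact K → K ⊆ G → IsCompact (D ∩ f ⁻¹' K)) :
    ∃ c : ℝ, 0 ≤ c ∧ ∀ φ : (Fin n → ℂ) → ℝ, IsCompactlySupportedIn G (fun y => (φ y : ℂ)) →
      ∫ w in D, ‖(jacobianMatrix f w).det‖ ^ 2 * φ (f w) = c * ∫ y, φ y := by
  obtain ⟨h, hh, hhψ⟩ := exists_holomorphic_pushforward hD hG hf hprop
    (differentiableOn_det_jacobianMatrix hD hf)
  have hsq : ∀ w, (jacobianMatrix f w).det * star (jacobianMatrix f w).det =
      ((‖(jacobianMatrix f w).det‖ ^ 2 : ℝ) : ℂ) := by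
    intro w
    rw [Complex.star_def, Complex.mul_conj, Complex.normSq_eq_norm_sq]
  have hreal : ∀ φ : (Fin n → ℂ) → ℝ, IsCompactlySupportedIn G (fun y => (φ y : ℂ)) →
      ((∫ w in D, ‖(jacobianMatrix f w).det‖ ^ 2 * φ (f w) : ℝ) : ℂ) = ∫ y, h y * φ y := by
    intro φ hφ
    rw [← hhψ _ hφ, ← integral_complex_ofReal]
    simp only [hsq, Complex.ofReal_mul]
  -- By the mean value property, `h y` is the integral of `h` against a nonnegative circular
  -- mollifier centred at `y`, which is the integral of a nonnegative function over `D`.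
  have hpos : ∀ y ∈ G, ∃ t : ℝ, 0 ≤ t ∧ h y = t := by
    intro y hy
    obtain ⟨r, hr, hrG⟩ := nhds_basis_closedBall.mem_iff.1 (hG.mem_nhds hy)
    obtain ⟨ρ, hρ⟩ := exists_isCircularMollifier n hr
    have h1 := integral_mul_of_circular hG hh hrG hρ.contDiff.continuous hρ.circular
      hρ.support_subset
    rw [hρ.integral_eq, one_mul] at h1
    have hφ : IsCompactlySupportedIn G (fun z => ((‖ρ (z - y)‖ : ℝ) : ℂ)) := by
      simp only [← hρ.nonneg]
      have hts : tsupport (fun z => ρ (z - y)) ⊆ closedBall y r := by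
        refine closure_minimal (fun z hz => ?_) isClosed_closedBall
        have := hρ.support_subset hz
        rwa [mem_closedBall_zero_iff, ← dist_eq_norm] at this
      exact ⟨hρ.contDiff.continuous.comp (by fun_prop),
        (isCompact_closedBall y r).of_isClosed_subset (isClosed_tsupport _) hts, hts.trans hrG⟩
    have h2 := hreal _ hφ
    refine ⟨_, ?_, (h1.symm.trans ?_).trans h2.symm⟩
    · exact integral_nonneg fun w => by positivity
    · rw [← integral_add_left_eq_self (fun z => h z * ((‖ρ (z - y)‖ : ℝ) : ℂ)) y]
      congr 1
      ext v
      rw [add_sub_cancel_left, ← hρ.nonneg, mul_comm]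
  -- A real-valued holomorphic function has zero derivative: near `y` it agrees with its conjugate,
  -- whose `dbar` is twice the conjugate derivative.
  have hder : EqOn (fderiv ℂ h) 0 G := by
    intro y hy
    have hd : DifferentiableAt ℂ h y := (hh y hy).differentiableAt (hG.mem_nhds hy)
    ext v
    have hstar : (fun z => star (h z)) =ᶠ[𝓝 y] h := by
      filter_upwards [hG.mem_nhds hy] with z hz
      obtain ⟨t, -, ht⟩ := hpos z hz
      simp [ht]
    have h1 := dbar_fderiv_star hd v
    rw [hstar.fderiv_eq, dbar_fderiv_holomorphic hd] at h1
    simpa using h1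
  obtain ⟨c, hc⟩ := hG.exists_is_const_of_fderiv_eq_zero hGc hh hder
  have key : ∀ c₀ : ℝ, (∀ y ∈ G, h y = c₀) → ∀ φ : (Fin n → ℂ) → ℝ,
      IsCompactlySupportedIn G (fun y => (φ y : ℂ)) →
      ∫ w in D, ‖(jacobianMatrix f w).det‖ ^ 2 * φ (f w) = c₀ * ∫ y, φ y := by
    intro c₀ hc₀ φ hφ
    have h1 := hreal φ hφ
    have h2 : ∀ y, h y * φ y = ((c₀ * φ y : ℝ) : ℂ) := by
      intro y
      by_cases hy : y ∈ tsupport fun y => (φ y : ℂ)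
      · rw [hc₀ y (hφ.tsupport_subset hy)]; push_cast; rfl
      · have := image_eq_zero_of_notMem_tsupport hy
        have h0 : φ y = 0 := by exact_mod_cast this
        simp [h0]
    simp only [h2] at h1
    rw [integral_complex_ofReal] at h1
    rw [← integral_const_mul]
    exact_mod_cast h1
  rcases G.eq_empty_or_nonempty with hGe | ⟨y₀, hy₀⟩
  · exact ⟨0, le_rfl, key 0 fun y hy => by simp [hGe] at hy⟩
  · obtain ⟨t, ht0, ht⟩ := hpos y₀ hy₀
    refine ⟨t, ht0, key t fun y hy => ?_⟩
    rw [hc y hy, ← hc y₀ hy₀, ht]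

/-- The Jacobian determinant of a proper holomorphic map into a bounded set is square integrable. -/
theorem det_jacobianMatrix_mem_bergmanSpace {n : ℕ} {D G : Set (Fin n → ℂ)} (hD : IsOpen D)
    (hG : IsOpen G) (hGc : IsPreconnected G) (hGb : Bornology.IsBounded G)
    {f : (Fin n → ℂ) → (Fin n → ℂ)} (hf : DifferentiableOn ℂ f D) (hm : MapsTo f D G)
    (hprop : ∀ K, IsCompact K → K ⊆ G → IsCompact (D ∩ f ⁻¹' K)) :
    (fun w => (jacobianMatrix f w).det) ∈ bergmanSpace D := by
  have hu := differentiableOn_det_jacobianMatrix hD hf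
  refine ⟨hu, ?_⟩
  obtain ⟨c, hc0, hc⟩ := exists_const_integral_normSq_det hD hG hGc hf hprop
  obtain ⟨χ, h1, h2, h3⟩ := exists_cutoff_sequence hG
  have hm1 : ∀ k, AEStronglyMeasurable (fun w => (jacobianMatrix f w).det * χ k (f w))
      (volume.restrict D) := fun k =>
    (hu.continuousOn.mul ((h1 k).continuous.comp_continuousOn
      hf.continuousOn)).aestronglyMeasurable hD.measurableSet
  have hcs : ∀ k, IsCompactlySupportedIn G (fun y => ((‖χ k y‖ ^ 2 : ℝ) : ℂ)) := by
    intro k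
    have := (h1 k).mul_right hG (h1 k).continuous.continuousOn
    convert this using 2 with y
    rw [(h2 k y).2]; simp [sq]
  have hGfin : volume G ≠ ⊤ := hGb.measure_lt_top.ne
  -- The change of variables bounds the cut-off integrals of the squared modulus of the Jacobian by
  -- `c` times the finite volume of `G`.
  refine memLp_two_of_tendsto_of_integral_le (B := c * volume.real G)
    (F := fun k w => (jacobianMatrix f w).det * χ k (f w)) (fun k => ?_) (fun k => ?_) ?_
  · rw [memLp_two_iff_integrable_sq_norm (hm1 k)]
    have ha : ContinuousOn (fun w => (jacobianMatrix f w).det * star (jacobianMatrix f w).det) D :=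
      hu.continuousOn.mul (continuous_star.comp_continuousOn hu.continuousOn)
    have := (integrableOn_mul_comp_of_isCompactlySupportedIn hD hf.continuousOn hprop ha
      (hcs k)).norm
    refine this.congr (Eventually.of_forall fun w => ?_)
    simp [sq]
    ring
  · have : ∀ w, ‖(jacobianMatrix f w).det * χ k (f w)‖ ^ 2 =
        ‖(jacobianMatrix f w).det‖ ^ 2 * (‖χ k (f w)‖ ^ 2) := fun w => by rw [norm_mul, mul_pow]
    simp only [this]
    rw [hc (fun y => ‖χ k y‖ ^ 2) (hcs k)]
    refine mul_le_mul_of_nonneg_left ?_ hc0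
    have h4 : ∀ y, ‖χ k y‖ ^ 2 ≤ G.indicator (fun _ => (1 : ℝ)) y := by
      intro y
      by_cases hy : y ∈ G
      · rw [indicator_of_mem hy]
        exact pow_le_one₀ (norm_nonneg _) (h2 k y).1
      · have : χ k y = 0 :=
          image_eq_zero_of_notMem_tsupport fun h => hy ((h1 k).tsupport_subset h)
        simp [hy, this]
    have h5 : ∫ y, G.indicator (fun _ => (1 : ℝ)) y = volume.real G := by
      rw [integral_indicator hG.measurableSet]; simp
    rw [← h5]
    refine integral_mono ?_ ?_ h4
    · exact (hcs k).integrable.re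
    · exact (integrable_indicator_iff hG.measurableSet).2 (integrableOn_const hGfin)
  · filter_upwards [ae_restrict_mem hD.measurableSet] with w hw
    refine tendsto_const_nhds.congr' ?_
    filter_upwards [h3 _ (hm hw)] with k hk
    rw [hk, mul_one]

/-- The push-forward of `g ū` is square integrable if `g` is. -/
theorem mem_bergmanSpace_of_pushforward {n : ℕ} {D G : Set (Fin n → ℂ)} (hD : IsOpen D)
    (hG : IsOpen G) (hGc : IsPreconnected G)
    {f : (Fin n → ℂ) → (Fin n → ℂ)} (hf : DifferentiableOn ℂ f D)
    (hprop : ∀ K, IsCompact K → K ⊆ G → IsCompact (D ∩ f ⁻¹' K))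
    {g h : (Fin n → ℂ) → ℂ} (hg : g ∈ bergmanSpace D) (hh : DifferentiableOn ℂ h G)
    (hgh : ∀ ψ, IsCompactlySupportedIn G ψ →
      ∫ w in D, g w * star (jacobianMatrix f w).det * ψ (f w) = ∫ y, h y * ψ y) :
    h ∈ bergmanSpace G := by
  refine ⟨hh, ?_⟩
  have hu := differentiableOn_det_jacobianMatrix hD hf
  obtain ⟨c, hc0, hc⟩ := exists_const_integral_normSq_det hD hG hGc hf hprop
  obtain ⟨χ, h1, h2, h3⟩ := exists_cutoff_sequence hG
  have hχh : ∀ k, IsCompactlySupportedIn G (fun y => χ k y * h y) := fun k =>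
    (h1 k).mul_right hG hh.continuousOn
  have hL2 : ∀ k, MemLp (fun y => χ k y * h y) 2 := fun k =>
    (hχh k).continuous.memLp_of_hasCompactSupport (hχh k).hasCompactSupport
  refine memLp_two_of_tendsto_of_integral_le (F := fun k y => χ k y * h y)
    (B := c * ∫ w in D, ‖g w‖ ^ 2) (fun k => (hL2 k).restrict G) (fun k => ?_) ?_
  · have hA0 : 0 ≤ ∫ y, ‖χ k y * h y‖ ^ 2 := integral_nonneg fun _ => by positivity
    set A := ∫ y, ‖χ k y * h y‖ ^ 2 with hA
    -- Duality: tested against this `ψ`, the density returns `A`. Cauchy–Schwarz on `D` and the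
    -- change of variables give `A ≤ √N * √(c * A)`, where `N` is the squared norm of `g`, and so `A
    -- ≤ c * N` uniformly in `k`.
    set ψ : (Fin n → ℂ) → ℂ := fun y => χ k y * (χ k y * star (h y)) with hψ
    have hψc : IsCompactlySupportedIn G ψ :=
      (h1 k).mul_right hG ((h1 k).continuous.continuousOn.mul
        (continuous_star.comp_continuousOn hh.continuousOn))
    have hAψ : ∫ y, h y * ψ y = A := by
      rw [hA, ← integral_complex_ofReal]
      congr 1
      ext y
      have h4 : h y * star (h y) = ((‖h y‖ ^ 2 : ℝ) : ℂ) := by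
        rw [Complex.star_def, Complex.mul_conj, Complex.normSq_eq_norm_sq]
      calc h y * ψ y = χ k y * χ k y * (h y * star (h y)) := by simp only [hψ]; ring
        _ = _ := by rw [h4, (h2 k y).2]; push_cast; simp [sq]; ring
    have hψn : ∀ y, ‖ψ y‖ ^ 2 ≤ ‖χ k y * h y‖ ^ 2 := by
      intro y
      simp only [hψ, norm_mul, norm_star]
      have := (h2 k y).1
      gcongr
      exact mul_le_of_le_one_left (by positivity) this
    have hψsq : IsCompactlySupportedIn G (fun y => ((‖ψ y‖ ^ 2 : ℝ) : ℂ)) := by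
      have := hψc.mul_right hG (a := fun y => star (ψ y))
        (continuous_star.comp_continuousOn hψc.continuous.continuousOn)
      convert this using 2 with y
      rw [Complex.star_def, Complex.mul_conj, Complex.normSq_eq_norm_sq]
    have hF : MemLp (fun w => star (jacobianMatrix f w).det * ψ (f w)) 2 (volume.restrict D) := by
      have hcon : ContinuousOn (fun w => star (jacobianMatrix f w).det * ψ (f w)) D :=
        (continuous_star.comp_continuousOn hu.continuousOn).mul
          (hψc.continuous.comp_continuousOn hf.continuousOn)
      rw [memLp_two_iff_integrable_sq_norm (hcon.aestronglyMeasurable hD.measurableSet)]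
      have ha : ContinuousOn
          (fun w => (jacobianMatrix f w).det * star (jacobianMatrix f w).det) D :=
        hu.continuousOn.mul (continuous_star.comp_continuousOn hu.continuousOn)
      have := (integrableOn_mul_comp_of_isCompactlySupportedIn hD hf.continuousOn hprop ha
        hψsq).norm
      refine this.congr (Eventually.of_forall fun w => ?_)
      simp [sq]
      ring
    have hFint : ∫ w in D, ‖star (jacobianMatrix f w).det * ψ (f w)‖ ^ 2 ≤ c * A := by
      have : ∀ w, ‖star (jacobianMatrix f w).det * ψ (f w)‖ ^ 2 =
          ‖(jacobianMatrix f w).det‖ ^ 2 * (‖ψ (f w)‖ ^ 2) := fun w => by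
        rw [norm_mul, mul_pow, norm_star]
      simp only [this]
      rw [hc (fun y => ‖ψ y‖ ^ 2) hψsq]
      refine mul_le_mul_of_nonneg_left ?_ hc0
      refine integral_mono ?_ ?_ hψn
      · exact hψsq.integrable.re
      · exact (memLp_two_iff_integrable_sq_norm (hL2 k).1).1 (hL2 k)
    have hCS := norm_integral_mul_le_sqrt hg.2 hF
    have h5 : ∫ w in D, g w * (star (jacobianMatrix f w).det * ψ (f w)) = A := by
      rw [← hAψ, ← hgh ψ hψc]
      simp only [mul_assoc]
    rw [h5, Complex.norm_real, Real.norm_of_nonneg hA0] at hCS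
    set N := ∫ w in D, ‖g w‖ ^ 2 with hN
    have hN0 : 0 ≤ N := integral_nonneg fun _ => by positivity
    have hAle : A ≤ c * N := by
      have h6 : A ≤ √N * √(c * A) := hCS.trans (by gcongr)
      have h7 : A ^ 2 ≤ N * (c * A) := by
        calc A ^ 2 ≤ (√N * √(c * A)) ^ 2 := by gcongr
          _ = N * (c * A) := by
            rw [mul_pow, Real.sq_sqrt hN0, Real.sq_sqrt (mul_nonneg hc0 hA0)]
      rcases hA0.eq_or_lt with h0 | h0
      · rw [← h0]; positivity
      · nlinarith
    refine le_trans ?_ hAle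
    exact setIntegral_le_integral ((memLp_two_iff_integrable_sq_norm (hL2 k).1).1 (hL2 k))
      (Eventually.of_forall fun _ => by positivity)
  · filter_upwards [ae_restrict_mem hG.measurableSet] with y hy
    refine tendsto_const_nhds.congr' ?_
    filter_upwards [h3 _ hy] with k hk
    rw [hk, one_mul]

/-- If a bounded function `η` on `G` (a pointwise limit of test functions) annihilates the Bergman
space of `G`, then `ū · η ∘ f` annihilates the Bergman space of `D`. -/
theorem integral_mul_comp_eq_zero_of_annihilates {n : ℕ} {D G : Set (Fin n → ℂ)} (hD : IsOpen D)
    (hG : IsOpen G) (hGc : IsPreconnected G) (hGb : Bornology.IsBounded G)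
    {f : (Fin n → ℂ) → (Fin n → ℂ)} (hf : DifferentiableOn ℂ f D) (hm : MapsTo f D G)
    (hprop : ∀ K, IsCompact K → K ⊆ G → IsCompact (D ∩ f ⁻¹' K))
    {η : (Fin n → ℂ) → ℂ} {ηk : ℕ → (Fin n → ℂ) → ℂ} {B : ℝ}
    (hη : ∀ k, IsCompactlySupportedIn G (ηk k)) (hB : ∀ k y, ‖ηk k y‖ ≤ B)
    (hlim : ∀ y ∈ G, Tendsto (fun k => ηk k y) atTop (𝓝 (η y)))
    (hann : ∀ h ∈ bergmanSpace G, ∫ y in G, h y * η y = 0)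
    {g : (Fin n → ℂ) → ℂ} (hg : g ∈ bergmanSpace D) :
    ∫ w in D, g w * star (jacobianMatrix f w).det * η (f w) = 0 := by
  have hu := det_jacobianMatrix_mem_bergmanSpace hD hG hGc hGb hf hm hprop
  obtain ⟨h, hh, hgh⟩ := exists_holomorphic_pushforward hD hG hf hprop hg.1
  have hhG := mem_bergmanSpace_of_pushforward hD hG hGc hf hprop hg hh hgh
  have hfin : IsFiniteMeasure (volume.restrict G) :=
    ⟨by simpa using hGb.measure_lt_top⟩
  have hgu : Integrable (fun w => g w * star (jacobianMatrix f w).det) (volume.restrict D) :=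
    hg.2.integrable_mul hu.2.star
  have l1 : Tendsto (fun k => ∫ w in D, g w * star (jacobianMatrix f w).det * ηk k (f w)) atTop
      (𝓝 (∫ w in D, g w * star (jacobianMatrix f w).det * η (f w))) := by
    refine tendsto_integral_of_dominated_convergence
      (fun w => ‖g w * star (jacobianMatrix f w).det‖ * B) (fun k => ?_) (hgu.norm.mul_const B)
      (fun k => Eventually.of_forall fun w => ?_) ?_
    · exact hgu.1.mul (((hη k).continuous.comp_continuousOn hf.continuousOn).aestronglyMeasurable
        hD.measurableSet)
    · rw [norm_mul]
      gcongr
      exact hB k _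
    · filter_upwards [ae_restrict_mem hD.measurableSet] with w hw
      exact (hlim _ (hm hw)).const_mul _
  have l2 : Tendsto (fun k => ∫ y in G, h y * ηk k y) atTop (𝓝 (∫ y in G, h y * η y)) := by
    have hi : Integrable h (volume.restrict G) := hhG.2.integrable (by norm_num)
    refine tendsto_integral_of_dominated_convergence (fun y => ‖h y‖ * B) (fun k => ?_)
      (hi.norm.mul_const B) (fun k => Eventually.of_forall fun w => ?_) ?_
    · exact hi.1.mul (hη k).continuous.aestronglyMeasurable
    · rw [norm_mul]
      gcongr
      exact hB k _
    · filter_upwards [ae_restrict_mem hG.measurableSet] with y hy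
      exact (hlim _ hy).const_mul _
  rw [hann h hhG] at l2
  refine tendsto_nhds_unique l1 (l2.congr fun k => ?_)
  rw [hgh _ (hη k)]
  refine setIntegral_eq_integral_of_forall_compl_eq_zero fun y hy => ?_
  rw [image_eq_zero_of_notMem_tsupport fun h => hy ((hη k).tsupport_subset h), mul_zero]

/-! ### Non-vanishing of the Jacobian determinant of a proper map. -/

/-- The real determinant of a complex-linear map is the norm from `ℂ` to `ℝ` of its complex
determinant. -/
theorem det_fderiv_real_eq {n : ℕ} {f : (Fin n → ℂ) → (Fin n → ℂ)} {w : Fin n → ℂ}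
    (hf : DifferentiableAt ℂ f w) :
    (fderiv ℝ f w).det = ‖(jacobianMatrix f w).det‖ ^ 2 := by
  have h1 : LinearMap.det (fderiv ℂ f w : (Fin n → ℂ) →ₗ[ℂ] (Fin n → ℂ)) =
      (jacobianMatrix f w).det := by
    rw [← LinearMap.det_toMatrix']
    congr 1
    ext i j
    rw [LinearMap.toMatrix'_apply]
    exact fderiv_apply_eq_jacobianMatrix hf i j
  rw [hf.fderiv_restrictScalars ℝ]
  have h2 : ((fderiv ℂ f w).restrictScalars ℝ).det = LinearMap.det
      ((fderiv ℂ f w : (Fin n → ℂ) →ₗ[ℂ] (Fin n → ℂ)).restrictScalars ℝ) := rfl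
  rw [h2, LinearMap.det_restrictScalars, h1, Algebra.norm_complex_apply,
    Complex.normSq_eq_norm_sq]

theorem contDiffOn_one_real_pi {n : ℕ} {D : Set (Fin n → ℂ)} (hD : IsOpen D)
    {f : (Fin n → ℂ) → (Fin n → ℂ)} (hf : DifferentiableOn ℂ f D) : ContDiffOn ℝ 1 f D :=
  contDiffOn_pi.2 fun i => (differentiableOn_pi.1 hf i).contDiffOn_one_real hD

/-- The multiplicity of a proper holomorphic map is at least one if its Jacobian determinant does not
vanish identically. -/
theorem one_le_of_integral_normSq_det {n : ℕ} {D G : Set (Fin n → ℂ)} (hD : IsOpen D)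
    (hG : IsOpen G) {f : (Fin n → ℂ) → (Fin n → ℂ)} (hf : DifferentiableOn ℂ f D)
    (hprop : ∀ K, IsCompact K → K ⊆ G → IsCompact (D ∩ f ⁻¹' K)) {c : ℝ}
    (hc : ∀ φ : (Fin n → ℂ) → ℝ, IsCompactlySupportedIn G (fun y => (φ y : ℂ)) →
      ∫ w in D, ‖(jacobianMatrix f w).det‖ ^ 2 * φ (f w) = c * ∫ y, φ y)
    {p : Fin n → ℂ} (hp : p ∈ D) (hpG : f p ∈ G) (hdet : (jacobianMatrix f p).det ≠ 0) :
    1 ≤ c := by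
  have hd : ∀ {w}, w ∈ D → DifferentiableAt ℂ f w := fun hw =>
    (hf _ hw).differentiableAt (hD.mem_nhds hw)
  have hstrict : HasStrictFDerivAt f (fderiv ℝ f p) p :=
    ((contDiffOn_one_real_pi hD hf).contDiffAt (hD.mem_nhds hp)).hasStrictFDerivAt (by simp)
  have hdet' : (fderiv ℝ f p).det ≠ 0 := by
    rw [det_fderiv_real_eq (hd hp)]
    exact pow_ne_zero 2 (norm_ne_zero_iff.2 hdet)
  have hS : HasStrictFDerivAt f
      ((fderiv ℝ f p).toContinuousLinearEquivOfDetNeZero hdet' : _ →L[ℝ] _) p := by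
    rwa [ContinuousLinearMap.coe_toContinuousLinearEquivOfDetNeZero]
  set e := hS.toOpenPartialHomeomorph f with he
  set N : Set (Fin n → ℂ) := D ∩ e.source with hN
  have hNo : IsOpen N := hD.inter e.open_source
  have hpN : p ∈ N := ⟨hp, hS.mem_toOpenPartialHomeomorph_source⟩
  have himo : IsOpen (f '' N) := e.isOpen_image_of_subset_source hNo inter_subset_right
  have hinj : InjOn f N := e.injOn.mono inter_subset_right
  obtain ⟨χ, hχ, h1, h2⟩ := exists_isCompactlySupportedIn_eqOn_one (himo.inter hG)
    (isCompact_singleton (x := f p)) (by simpa using ⟨mem_image_of_mem f hpN, hpG⟩)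
  have hφeq : (fun y => ((‖χ y‖ : ℝ) : ℂ)) = χ := funext fun y => (h2 y).2.symm
  have hφ : IsCompactlySupportedIn G (fun y => ((‖χ y‖ : ℝ) : ℂ)) := by
    rw [hφeq]
    exact ⟨hχ.continuous, hχ.hasCompactSupport, hχ.tsupport_subset.trans inter_subset_right⟩
  have hpos : 0 < ∫ y, ‖χ y‖ := by
    refine hχ.continuous.norm.integral_pos_of_hasCompactSupport_nonneg_nonzero (x := f p)
      hχ.hasCompactSupport.norm (fun _ => norm_nonneg _) ?_
    simp [h1 (mem_singleton (f p))]
  -- On `N` the map is injective, so the ordinary change of variables computes the part of the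
  -- integral over `D` that comes from `N`; the rest is nonnegative.
  have hle : ∫ y, ‖χ y‖ ≤ c * ∫ y, ‖χ y‖ := by
    rw [← hc _ hφ]
    have h3 : ∫ y, ‖χ y‖ = ∫ y in f '' N, ‖χ y‖ := by
      refine (setIntegral_eq_integral_of_forall_compl_eq_zero fun y hy => ?_).symm
      rw [image_eq_zero_of_notMem_tsupport fun h => hy (hχ.tsupport_subset h).1, norm_zero]
    rw [h3, integral_image_eq_integral_abs_det_fderiv_smul volume hNo.measurableSet
      (f' := fderiv ℝ f) (fun w hw =>
        ((hd hw.1).restrictScalars ℝ).hasFDerivAt.hasFDerivWithinAt) hinj]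
    have h4 : ∫ w in N, |(fderiv ℝ f w).det| • ‖χ (f w)‖ =
        ∫ w in N, ‖(jacobianMatrix f w).det‖ ^ 2 * ‖χ (f w)‖ := by
      refine setIntegral_congr_fun hNo.measurableSet fun w hw => ?_
      simp only [det_fderiv_real_eq (hd hw.1), smul_eq_mul]
      rw [abs_of_nonneg (by positivity)]
    rw [h4]
    refine setIntegral_mono_set ?_ (Eventually.of_forall fun w => by positivity)
      (Eventually.of_forall inter_subset_left)
    have hu := (differentiableOn_det_jacobianMatrix hD hf).continuousOn
    refine (integrableOn_mul_comp_of_isCompactlySupportedIn hD hf.continuousOn hprop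
      (hu.mul (continuous_star.comp_continuousOn hu)) hφ).norm.congr
      (Eventually.of_forall fun w => ?_)
    simp [sq]
  nlinarith

/-- The Jacobian determinant of a proper holomorphic map between open sets of the same dimension
does not vanish identically. -/
theorem exists_det_jacobianMatrix_ne_zero {n : ℕ} {D G : Set (Fin n → ℂ)} (hD : IsOpen D)
    (hG : IsOpen G) (hDne : D.Nonempty)
    {f : (Fin n → ℂ) → (Fin n → ℂ)} (hf : DifferentiableOn ℂ f D) (hm : MapsTo f D G)
    (hprop : ∀ K, IsCompact K → K ⊆ G → IsCompact (D ∩ f ⁻¹' K)) :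
    ∃ w ∈ D, (jacobianMatrix f w).det ≠ 0 := by
  by_contra! hzero
  obtain ⟨p, hp⟩ := hDne
  set y₀ := f p with hy₀
  obtain ⟨r', hr', hrG'⟩ := nhds_basis_closedBall.mem_iff.1 (hG.mem_nhds (hm hp))
  obtain ⟨r, hr, hrr⟩ : ∃ r > 0, r' = 2 * r := ⟨r' / 2, by positivity, by ring⟩
  rw [hrr] at hrG'
  set K := D ∩ f ⁻¹' closedBall y₀ (2 * r) with hK
  have hKc : IsCompact K := hprop _ (isCompact_closedBall _ _) hrG'
  set Ω := D ∩ f ⁻¹' ball y₀ (2 * r) with hΩ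
  have hΩo : IsOpen Ω := hf.continuousOn.isOpen_inter_preimage hD isOpen_ball
  have hΩD : Ω ⊆ D := inter_subset_left
  have hΩK : Ω ⊆ K := inter_subset_inter_right _ (preimage_mono ball_subset_closedBall)
  have hpΩ : p ∈ Ω := ⟨hp, mem_ball_self (by positivity)⟩
  obtain ⟨χ, hχ, h1, h2⟩ := exists_isCompactlySupportedIn_eqOn_one (isOpen_ball (x := y₀) (ε := r))
    (isCompact_singleton (x := y₀)) (by simpa using hr)
  have hφeq : (fun y => ((‖χ y‖ : ℝ) : ℂ)) = χ := funext fun y => (h2 y).2.symm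
  have hφ : IsCompactlySupportedIn (ball y₀ r) (fun y => ((‖χ y‖ : ℝ) : ℂ)) := by rwa [hφeq]
  have hpos : 0 < ∫ y, ‖χ y‖ := by
    refine hχ.continuous.norm.integral_pos_of_hasCompactSupport_nonneg_nonzero (x := y₀)
      hχ.hasCompactSupport.norm (fun _ => norm_nonneg _) ?_
    simp [h1 (mem_singleton y₀)]
  set I := ∫ y, ‖χ y‖ with hI
  set V := volume.real K with hV
  have hV0 : 0 ≤ V := measureReal_nonneg
  -- Chosen so that `ε * V < I`. The plan is to perturb `f` slightly to a map with nonzero Jacobian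
  -- at `p`: its multiplicity is at least one, yet its squared Jacobian stays below `ε` on a set of
  -- volume at most `V`, too little to cover mass `I`.
  set ε := I / (2 * (V + 1)) with hε
  have hε0 : 0 < ε := by positivity
  have e1 : ∀ᶠ t : ℂ in 𝓝 0, ∀ w ∈ K, ‖t • (w - p)‖ < r / 2 := by
    refine hKc.eventually_forall_of_forall_eventually fun w _ => ?_
    have hc : Continuous fun q : ℂ × (Fin n → ℂ) => ‖q.1 • (q.2 - p)‖ := by fun_prop
    refine hc.continuousAt.eventually_lt continuousAt_const ?_
    simpa using hr
  have e2 : ∀ᶠ t : ℂ in 𝓝 0, ∀ w ∈ K, ‖(jacobianMatrix f w + t • 1).det‖ ^ 2 < ε := by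
    refine hKc.eventually_forall_of_forall_eventually fun w hw => ?_
    have hJ : ContinuousAt (jacobianMatrix f) w := by
      refine continuousAt_pi.2 fun i => continuousAt_pi.2 fun j => ?_
      exact (differentiableOn_jacobianMatrix_apply hD hf i j).continuousOn.continuousAt
        (hD.mem_nhds hw.1)
    have hc : ContinuousAt (fun q : ℂ × (Fin n → ℂ) =>
        ‖(jacobianMatrix f q.2 + q.1 • (1 : Matrix (Fin n) (Fin n) ℂ)).det‖ ^ 2) (0, w) := by
      refine ContinuousAt.pow (ContinuousAt.norm ?_) 2
      refine (continuous_id.matrix_det).continuousAt.comp (x := (0, w)) (f := fun q : ℂ × _ =>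
        (jacobianMatrix f q.2 + q.1 • (1 : Matrix (Fin n) (Fin n) ℂ))) ?_
      exact (ContinuousAt.comp (x := ((0 : ℂ), w)) (g := jacobianMatrix f) (f := Prod.snd) hJ
        continuousAt_snd).add (continuousAt_fst.smul continuousAt_const)
    refine hc.eventually_lt continuousAt_const ?_
    simpa [hzero w hw.1] using hε0
  -- The bad parameters are roots of a characteristic polynomial, hence finite in number.
  have e3 : ∀ᶠ t : ℂ in 𝓝[≠] 0, (jacobianMatrix f p + t • 1).det ≠ 0 := by
    have hfin : {t : ℂ | (-jacobianMatrix f p).charpoly.IsRoot t}.Finite :=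
      Polynomial.finite_setOfPred_isRoot (Matrix.charpoly_monic _).ne_zero
    filter_upwards [hfin.eventually_cofinite_notMem.filter_mono (nhdsNE_le_cofinite 0)] with t ht h0
    refine ht ?_
    rw [Polynomial.IsRoot, Matrix.eval_charpoly, ← h0]
    congr 1
    ext i j
    simp [Matrix.scalar_apply, Matrix.diagonal, Matrix.one_apply, add_comm]
  obtain ⟨t, ⟨ht1, ht2⟩, ht3⟩ :=
    (((e1.and e2).filter_mono nhdsWithin_le_nhds).and e3).exists
  set F : (Fin n → ℂ) → (Fin n → ℂ) := fun w => f w + t • (w - p) with hF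
  have hFd : DifferentiableOn ℂ F D := hf.add (by fun_prop)
  have hFJ : ∀ w ∈ D, jacobianMatrix F w = jacobianMatrix f w + t • 1 := by
    intro w hw
    ext i j
    have hfi : DifferentiableAt ℂ (fun z => f z i) w :=
      (differentiableOn_pi.1 hf i w hw).differentiableAt (hD.mem_nhds hw)
    have h3 : HasFDerivAt (fun z => F z i) (fderiv ℂ (fun z => f z i) w +
        t • (ContinuousLinearMap.proj i : (Fin n → ℂ) →L[ℂ] ℂ)) w := by
      refine hfi.hasFDerivAt.add ?_
      exact ((hasFDerivAt_apply i w).sub_const (p i)).const_mul t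
    simp [jacobianMatrix, h3.fderiv, Matrix.one_apply, Pi.single_apply]
  -- The perturbation is smaller than `r / 2` on `K`, so points of `K` that `F` sends into the ball
  -- of radius `r` are sent by `f` into the open ball of radius `2 * r`; no point of the boundary of
  -- `Ω` is reached.
  have hFprop : ∀ K', IsCompact K' → K' ⊆ ball y₀ r → IsCompact (Ω ∩ F ⁻¹' K') := by
    intro K' hK' hK'B
    have h3 : Ω ∩ F ⁻¹' K' = K ∩ F ⁻¹' K' := by
      refine Subset.antisymm (inter_subset_inter_left _ hΩK) ?_
      rintro w ⟨hwK, hwF⟩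
      refine ⟨⟨hwK.1, ?_⟩, hwF⟩
      have h4 := hK'B hwF
      have h5 := ht1 w hwK
      have h6 : f w = F w - t • (w - p) := by simp [hF]
      rw [mem_ball, dist_eq_norm] at h4
      rw [mem_preimage, mem_ball, dist_eq_norm, h6]
      calc ‖F w - t • (w - p) - y₀‖ = ‖(F w - y₀) - t • (w - p)‖ := by congr 1; abel
        _ ≤ ‖F w - y₀‖ + ‖t • (w - p)‖ := norm_sub_le _ _
        _ < 2 * r := by linarith
    rw [h3]
    refine hKc.of_isClosed_subset ?_ inter_subset_left
    exact (hFd.continuousOn.mono inter_subset_left).preimage_isClosed_of_isClosed hKc.isClosed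
      hK'.isClosed
  obtain ⟨c, hc0, hc⟩ := exists_const_integral_normSq_det hΩo isOpen_ball
    (convex_ball y₀ r).isPreconnected (hFd.mono hΩD) hFprop
  have hFp : F p = y₀ := by simp [hF, hy₀]
  have hc1 : 1 ≤ c := one_le_of_integral_normSq_det hΩo isOpen_ball (hFd.mono hΩD) hFprop hc hpΩ
    (by rw [hFp]; exact mem_ball_self hr) (by rwa [hFJ p hp])
  have h3 := hc _ hφ
  have h4 : ∫ w in Ω, ‖(jacobianMatrix F w).det‖ ^ 2 * ‖χ (F w)‖ ≤ ε * V := by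
    have hΩfin : volume Ω < ⊤ := (measure_mono hΩK).trans_lt hKc.measure_lt_top
    have h5 := norm_setIntegral_le_of_norm_le_const (C := ε)
      (f := fun w => ‖(jacobianMatrix F w).det‖ ^ 2 * ‖χ (F w)‖) hΩfin (fun w hw => by
        rw [hFJ w hw.1, norm_mul, norm_norm, norm_pow, norm_norm]
        have h6 := (ht2 w (hΩK hw)).le
        calc _ ≤ ε * 1 := by
              gcongr
              exact (h2 _).1
          _ = ε := mul_one _)
    refine (le_abs_self _).trans (h5.trans ?_)
    have : volume.real Ω ≤ V := measureReal_mono hΩK hKc.measure_lt_top.ne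
    gcongr
  rw [h3] at h4
  have h5 : ε * V < I := by
    rw [hε, div_mul_eq_mul_div, div_lt_iff₀ (by positivity)]
    nlinarith
  nlinarith

/-! ### Division of holomorphic functions. -/

/-- If `a` is locally divisible by `b` and `b` has dense support, then `a` is divisible by `b`. -/
theorem exists_differentiableOn_eq_mul_of_locally {E : Type*} [NormedAddCommGroup E]
    [NormedSpace ℂ E] {a b : E → ℂ} {C : Set E} (hC : C ⊆ closure {x | b x ≠ 0})
    (hloc : ∀ z ∈ C, ∃ g : E → ℂ, ∀ᶠ x in 𝓝 z,
      x ∈ C ∧ DifferentiableAt ℂ g x ∧ a x = b x * g x) :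
    ∃ F : E → ℂ, DifferentiableOn ℂ F C ∧ ∀ z ∈ C, a z = b z * F z := by
  -- Taking the limit of `a / b` along the set where `b ≠ 0` gives a quotient independent of
  -- choices; by continuity it agrees with every local quotient, so no gluing is needed.
  set F : E → ℂ := fun z => limUnder (𝓝[{x | b x ≠ 0}] z) fun x => a x / b x with hF
  have key : ∀ z ∈ C, ∀ g : E → ℂ, (∀ᶠ x in 𝓝 z, x ∈ C ∧ DifferentiableAt ℂ g x ∧
      a x = b x * g x) → F z = g z := by
    intro z hz g hg
    have : (𝓝[{x | b x ≠ 0}] z).NeBot := mem_closure_iff_nhdsWithin_neBot.1 (hC hz)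
    refine Tendsto.limUnder_eq ?_
    have h1 : Tendsto g (𝓝[{x | b x ≠ 0}] z) (𝓝 (g z)) :=
      hg.self_of_nhds.2.1.continuousAt.tendsto.mono_left nhdsWithin_le_nhds
    refine h1.congr' ?_
    filter_upwards [self_mem_nhdsWithin, hg.filter_mono nhdsWithin_le_nhds] with x hx hx2
    rw [hx2.2.2, mul_div_cancel_left₀ _ hx]
  have hev : ∀ z ∈ C, ∃ g : E → ℂ, DifferentiableAt ℂ g z ∧ F =ᶠ[𝓝 z] g ∧ a z = b z * g z := by
    intro z hz
    obtain ⟨g, hg⟩ := hloc z hz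
    refine ⟨g, hg.self_of_nhds.2.1, ?_, hg.self_of_nhds.2.2⟩
    filter_upwards [hg.eventually_nhds] with x hx
    exact key x hx.self_of_nhds.1 g hx
  refine ⟨F, fun z hz => ?_, fun z hz => ?_⟩
  · obtain ⟨g, hg, hFg, -⟩ := hev z hz
    exact (hg.congr_of_eventuallyEq hFg).differentiableWithinAt
  · obtain ⟨g, -, hFg, ha⟩ := hev z hz
    rw [ha, hFg.self_of_nhds]

/-- In one variable: if `b^k` divides `a^k b` for all `k`, then `b` divides `a`. -/
theorem exists_analyticAt_eq_mul_of_pow_dvd {a b : ℂ → ℂ} {c : ℕ → ℂ → ℂ} {z : ℂ}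
    (ha : AnalyticAt ℂ a z) (hb : AnalyticAt ℂ b z) (hc : ∀ k, AnalyticAt ℂ (c k) z)
    (hb0 : ¬ ∀ᶠ x in 𝓝 z, b x = 0) (h : ∀ k, ∀ᶠ x in 𝓝 z, a x ^ k * b x = b x ^ k * c k x) :
    ∃ g : ℂ → ℂ, AnalyticAt ℂ g z ∧ ∀ᶠ x in 𝓝 z, a x = b x * g x := by
  have hfin : analyticOrderAt b z ≠ ⊤ := fun h0 => hb0 (analyticOrderAt_eq_top.1 h0)
  obtain ⟨m, hm⟩ := ENat.ne_top_iff_exists.1 hfin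
  have hle : (m : ℕ∞) ≤ analyticOrderAt a z := by
    by_contra! hlt
    obtain ⟨l, hl⟩ := ENat.ne_top_iff_exists.1 (ne_top_of_lt hlt)
    rw [← hl, Nat.cast_lt] at hlt
    -- With orders `l` of `a` and `m` of `b`, the relation for exponent `k` forces `k * m ≤ k * l +
    -- m`. If `l < m`, the exponent `k = m + 1` already contradicts this.
    have h1 : analyticOrderAt (a ^ (m + 1) * b) z = analyticOrderAt (b ^ (m + 1) * c (m + 1)) z :=
      analyticOrderAt_congr (h (m + 1))
    rw [analyticOrderAt_mul (ha.pow _) hb, analyticOrderAt_mul (hb.pow _) (hc _),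
      analyticOrderAt_pow ha, analyticOrderAt_pow hb, ← hl, ← hm] at h1
    have h2 : (m + 1) • (m : ℕ∞) ≤ (m + 1) • (l : ℕ∞) + m := by
      rw [h1]; exact le_self_add
    simp only [nsmul_eq_mul] at h2
    have h3 : (m + 1) * m ≤ (m + 1) * l + m := by exact_mod_cast h2
    nlinarith
  obtain ⟨a', ha', haa⟩ := (natCast_le_analyticOrderAt ha).1 hle
  obtain ⟨b', hb', hb'0, hbb⟩ := (hb.analyticOrderAt_eq_natCast).1 hm.symm
  refine ⟨fun x => a' x / b' x, ha'.div hb' hb'0, ?_⟩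
  filter_upwards [haa, hbb, hb'.continuousAt.eventually_ne hb'0] with x h1 h2 h3
  rw [h1, h2, smul_eq_mul, smul_eq_mul]
  field_simp

/-- If `h₀^k` divides `h₁^k h₀` for all `k`, then `h₀` divides `h₁`. -/
theorem exists_differentiableOn_eq_mul_of_pow_dvd {E : Type*} [NormedAddCommGroup E]
    [NormedSpace ℂ E] [FiniteDimensional ℂ E] {C : Set E} (hC : IsOpen C) (hCc : IsPreconnected C)
    {h₀ h₁ : E → ℂ} {h : ℕ → E → ℂ} (hh₀ : DifferentiableOn ℂ h₀ C)
    (hh₁ : DifferentiableOn ℂ h₁ C) (hh : ∀ k, DifferentiableOn ℂ (h k) C)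
    (hne : ∃ z ∈ C, h₀ z ≠ 0) (hdvd : ∀ k, ∀ z ∈ C, h₁ z ^ k * h₀ z = h₀ z ^ k * h k z) :
    ∃ F : E → ℂ, DifferentiableOn ℂ F C ∧ ∀ z ∈ C, h₁ z = h₀ z * F z := by
  obtain ⟨p, hp, hp0⟩ := hne
  have hdense := subset_closure_ne_zero_of_holomorphic hC hCc hh₀ hp hp0
  refine exists_differentiableOn_eq_mul_of_locally
    (hdense.trans (closure_mono fun x hx => hx.2)) fun z₀ hz₀ => ?_
  obtain ⟨r, hr, hrC⟩ := Metric.isOpen_iff.1 hC z₀ hz₀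
  obtain ⟨z₁, ⟨-, hz₁⟩, hz₁r⟩ := Metric.mem_closure_iff.1 (hdense hz₀) r hr
  -- A direction along which `h₀` does not vanish identically. Quotients are taken on the complex
  -- lines parallel to `v`.
  set v := z₁ - z₀ with hv
  have hvr : ‖v‖ < r := by rwa [dist_comm, dist_eq_norm] at hz₁r
  set s := r - ‖v‖ with hs
  have hs0 : 0 < s := by linarith
  have hmem : ∀ z ∈ ball z₀ s, ∀ ζ ∈ closedBall (0 : ℂ) 1, z + ζ • v ∈ C := by
    intro z hz ζ hζ
    apply hrC
    rw [mem_ball, dist_eq_norm] at hz ⊢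
    rw [mem_closedBall_zero_iff] at hζ
    calc ‖z + ζ • v - z₀‖ = ‖(z - z₀) + ζ • v‖ := by congr 1; abel
      _ ≤ ‖z - z₀‖ + ‖ζ‖ * ‖v‖ := (norm_add_le _ _).trans (by rw [norm_smul])
      _ < r := by nlinarith [norm_nonneg v, norm_nonneg ζ]
  have hAo : ∀ z, IsOpen ((fun ζ : ℂ => z + ζ • v) ⁻¹' C) := fun z =>
    hC.preimage (by fun_prop)
  have hslice : ∀ z, ∀ k : E → ℂ, DifferentiableOn ℂ k C →
      AnalyticOnNhd ℂ (fun ζ : ℂ => k (z + ζ • v)) ((fun ζ : ℂ => z + ζ • v) ⁻¹' C) := by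
    intro z k hk
    refine DifferentiableOn.analyticOnNhd ?_ (hAo z)
    exact hk.comp (f := fun ζ : ℂ => z + ζ • v) (by fun_prop) fun ζ hζ => hζ
  have hball : ∀ z ∈ ball z₀ s, closedBall (0 : ℂ) 1 ⊆ (fun ζ : ℂ => z + ζ • v) ⁻¹' C :=
    fun z hz ζ hζ => hmem z hz ζ hζ
  have hconn : IsPreconnected (closedBall (0 : ℂ) 1) := (convex_closedBall _ _).isPreconnected
  -- the slices do not vanish identically
  have hnz : ∀ z ∈ ball z₀ s, ∀ ζ₁ ∈ closedBall (0 : ℂ) 1, h₀ (z + ζ₁ • v) ≠ 0 →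
      ∀ ζ ∈ closedBall (0 : ℂ) 1, ¬ ∀ᶠ x in 𝓝 ζ, h₀ (z + x • v) = 0 := by
    intro z hz ζ₁ hζ₁ hne ζ hζ h0
    have := ((hslice z h₀ hh₀).mono (hball z hz)).eqOn_zero_of_preconnected_of_eventuallyEq_zero
      hconn hζ h0 hζ₁
    exact hne this
  have hz₀s : z₀ ∈ ball z₀ s := mem_ball_self hs0
  have h0m : (0 : ℂ) ∈ closedBall (0 : ℂ) 1 := mem_closedBall_self zero_le_one
  have hpunct : ∀ᶠ ζ : ℂ in 𝓝[≠] 0, h₀ (z₀ + ζ • v) ≠ 0 := by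
    refine (((hslice z₀ h₀ hh₀) 0 (hball z₀ hz₀s h0m)).eventually_eq_zero_or_eventually_ne_zero).resolve_left ?_
    refine hnz z₀ hz₀s 1 (by simp) ?_ 0 h0m
    simpa [hv] using hz₁
  obtain ⟨δ, hδ, hδne⟩ := Metric.mem_nhdsWithin_iff.1 hpunct
  -- Zeros of the slice through `z₀` are isolated, so `h₀` has no zero on this circle; by
  -- compactness the same circle works for all nearby parallel slices.
  set R := min δ 1 / 2 with hR
  have hR0 : 0 < R := by have : 0 < min δ 1 := lt_min hδ one_pos; positivity
  have hRδ : R < δ := by have := min_le_left δ 1; linarith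
  have hR1 : R < 1 := by have := min_le_right δ 1; linarith
  have hsphne : ∀ ζ ∈ sphere (0 : ℂ) R, h₀ (z₀ + ζ • v) ≠ 0 := by
    intro ζ hζ
    rw [mem_sphere_zero_iff_norm] at hζ
    refine hδne ⟨by rw [mem_ball_zero_iff]; linarith, ?_⟩
    intro h0
    rw [mem_singleton_iff] at h0
    rw [h0, norm_zero] at hζ
    linarith
  have hsph1 : sphere (0 : ℂ) R ⊆ closedBall 0 1 :=
    sphere_subset_closedBall.trans (closedBall_subset_closedBall hR1.le)
  have hev : ∀ᶠ z in 𝓝 z₀, ∀ ζ ∈ sphere (0 : ℂ) R, h₀ (z + ζ • v) ≠ 0 := by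
    refine (isCompact_sphere (0 : ℂ) R).eventually_forall_of_forall_eventually fun ζ hζ => ?_
    have hc : ContinuousAt h₀ (z₀ + ζ • v) :=
      hh₀.continuousOn.continuousAt (hC.mem_nhds (hmem z₀ hz₀s ζ (hsph1 hζ)))
    have hc2 : ContinuousAt (fun q : E × ℂ => h₀ (q.1 + q.2 • v)) (z₀, ζ) :=
      ContinuousAt.comp (x := (z₀, ζ)) (g := h₀) (f := fun q : E × ℂ => q.1 + q.2 • v) hc
        (by fun_prop)
    exact hc2.eventually_ne (hsphne ζ hζ)
  obtain ⟨t, ht, htne⟩ := Metric.eventually_nhds_iff_ball.1 hev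
  set N := ball z₀ (min s t) with hN
  have hNs : N ⊆ ball z₀ s := ball_subset_ball (min_le_left _ _)
  have hNt : N ⊆ ball z₀ t := ball_subset_ball (min_le_right _ _)
  have hN0 : z₀ ∈ N := mem_ball_self (lt_min hs0 ht)
  set Q : E → ℂ → ℂ := fun z ζ => ζ⁻¹ * (h₁ (z + ζ • v) / h₀ (z + ζ • v)) with hQ
  -- Cauchy's formula for the value at the centre of the slice. Only points of the circle occur,
  -- where `h₀ ≠ 0`, so `g` is holomorphic in all variables.
  set g : E → ℂ := fun z => (2 * Real.pi * Complex.I)⁻¹ * ∮ ζ in C(0, R), Q z ζ with hg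
  have hgd : DifferentiableOn ℂ g N := by
    refine DifferentiableOn.const_mul ?_ _
    refine differentiableOn_circleIntegral isOpen_ball hR0.le ?_ ?_
    · have hmaps : MapsTo (fun q : E × ℂ => q.1 + q.2 • v) (N ×ˢ sphere 0 R) C := fun q hq =>
        hmem _ (hNs hq.1) _ (hsph1 hq.2)
      have hinv : ContinuousOn (fun p : E × ℂ => p.2⁻¹) (N ×ˢ sphere 0 R) := by
        refine continuousOn_snd.inv₀ fun p hp h0 => ?_
        have := hp.2
        rw [h0] at this
        simp at this
        exact hR0.ne this
      refine hinv.mul (ContinuousOn.div ?_ ?_ ?_)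
      · exact hh₁.continuousOn.comp (by fun_prop) hmaps
      · exact hh₀.continuousOn.comp (by fun_prop) hmaps
      · exact fun q hq => htne _ (hNt hq.1) _ hq.2
    · intro ζ hζ
      have hmaps : MapsTo (fun z : E => z + ζ • v) N C := fun z hz => hmem _ (hNs hz) _ (hsph1 hζ)
      simp only [hQ, div_eq_mul_inv]
      refine DifferentiableOn.const_mul (DifferentiableOn.mul ?_ (DifferentiableOn.inv ?_ ?_)) _
      · exact hh₁.comp (by fun_prop) hmaps
      · exact hh₀.comp (by fun_prop) hmaps
      · exact fun z hz => htne _ (hNt hz) _ hζ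
  refine ⟨g, ?_⟩
  filter_upwards [isOpen_ball.mem_nhds hN0] with z hz
  have hzC : z ∈ C := by simpa using hmem z (hNs hz) 0 h0m
  refine ⟨hzC, (hgd z hz).differentiableAt (isOpen_ball.mem_nhds hz), ?_⟩
  have hRm : (R : ℂ) ∈ sphere (0 : ℂ) R := by simp [abs_of_pos hR0]
  have hnzz := hnz z (hNs hz) R (hsph1 hRm) (htne z (hNt hz) R hRm)
  -- On a single slice the one-variable division yields a holomorphic quotient `q` on the whole
  -- disc, and Cauchy's formula identifies `q 0` with `g z`.
  obtain ⟨q, hq, hqab⟩ := exists_differentiableOn_eq_mul_of_locally (C := ball (0 : ℂ) 1)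
    (a := fun ζ => h₁ (z + ζ • v)) (b := fun ζ => h₀ (z + ζ • v)) (fun ζ hζ => by
      by_contra hcl
      refine hnzz ζ (ball_subset_closedBall hζ) ?_
      filter_upwards [isClosed_closure.isOpen_compl.mem_nhds hcl] with x hx
      by_contra h0
      exact hx (subset_closure h0)) (fun ζ hζ => by
      have hζ' := ball_subset_closedBall hζ
      have hζC := hball z (hNs hz) hζ'
      obtain ⟨q, hq, hab⟩ := exists_analyticAt_eq_mul_of_pow_dvd (hslice z h₁ hh₁ ζ hζC)
        (hslice z h₀ hh₀ ζ hζC) (c := fun k ζ => h k (z + ζ • v)) (fun k => hslice z _ (hh k) ζ hζC)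
        (hnzz ζ hζ') (fun k => by
          filter_upwards [(hAo z).mem_nhds hζC] with x hx using hdvd k _ hx)
      refine ⟨q, ?_⟩
      filter_upwards [isOpen_ball.mem_nhds hζ, hq.eventually_analyticAt, hab] with x h1 h2 h3
      exact ⟨h1, h2.differentiableAt, h3⟩)
  have h1 : q 0 = g z := by
    have hsub : closedBall (0 : ℂ) R ⊆ ball 0 1 := closedBall_subset_ball hR1
    have h2 := Complex.two_pi_I_inv_smul_circleIntegral_sub_inv_smul_of_differentiable_on_off_countable
      (c := (0 : ℂ)) (R := R) (w := 0) (f := q) countable_empty (mem_ball_self hR0)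
      (hq.continuousOn.mono hsub) (fun x hx =>
        (hq x (hsub (ball_subset_closedBall hx.1))).differentiableAt
          (isOpen_ball.mem_nhds (hsub (ball_subset_closedBall hx.1))))
    rw [← h2, hg, smul_eq_mul]
    congr 1
    refine circleIntegral.integral_congr hR0.le fun ζ hζ => ?_
    have h3 := hqab ζ (hsub (sphere_subset_closedBall hζ))
    simp only [hQ, sub_zero, smul_eq_mul]
    rw [h3, mul_div_cancel_left₀ _ (htne z (hNt hz) ζ hζ)]
  have h4 := hqab 0 (mem_ball_self one_pos)
  simp only [zero_smul, add_zero] at h4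
  rw [h4, h1]

/-! ### The weighted circle action and homogeneous components. -/

/-- The weighted action `(c^{m₁} x₁, …, c^{mₙ} xₙ)` of the scalar `c`. -/
def weightedDilation {n : ℕ} (m : Fin n → ℕ) (c : ℂ) (x : Fin n → ℂ) : Fin n → ℂ :=
  fun i => c ^ m i * x i

theorem weightedDilation_weightedDilation {n : ℕ} (m : Fin n → ℕ) (c c' : ℂ) (x : Fin n → ℂ) :
    weightedDilation m c (weightedDilation m c' x) = weightedDilation m (c * c') x := by
  ext i; simp only [weightedDilation, mul_pow, mul_assoc]

theorem weightedDilation_one {n : ℕ} (m : Fin n → ℕ) (x : Fin n → ℂ) : weightedDilation m 1 x = x := by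
  ext i; simp [weightedDilation]

theorem weightedDilation_injective {n : ℕ} (m : Fin n → ℕ) {c : ℂ} (hc : c ≠ 0) :
    Function.Injective (weightedDilation m c) := by
  intro x y h
  have := congrArg (weightedDilation m c⁻¹) h
  simpa only [weightedDilation_weightedDilation, inv_mul_cancel₀ hc, weightedDilation_one] using this

theorem continuous_weightedDilation_uncurry {n : ℕ} (m : Fin n → ℕ) :
    Continuous fun p : ℂ × (Fin n → ℂ) => weightedDilation m p.1 p.2 := by
  unfold weightedDilation; fun_prop

theorem differentiable_weightedDilation {n : ℕ} (m : Fin n → ℕ) (c : ℂ) :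
    Differentiable ℂ (weightedDilation m c) := by
  unfold weightedDilation; fun_prop

theorem continuous_weightedDilation {n : ℕ} (m : Fin n → ℕ) (c : ℂ) :
    Continuous (weightedDilation m c) := (differentiable_weightedDilation m c).continuous

/-- Positive weights make the dilations contract at least linearly. -/
theorem norm_weightedDilation_le {n : ℕ} {m : Fin n → ℕ} (hm : ∀ i, 0 < m i) {c : ℂ} (hc : ‖c‖ ≤ 1)
    (x : Fin n → ℂ) : ‖weightedDilation m c x‖ ≤ ‖c‖ * ‖x‖ := by
  rw [pi_norm_le_iff_of_nonneg (by positivity)]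
  intro i
  simp only [weightedDilation, norm_mul, norm_pow]
  have h1 : ‖c‖ ^ m i ≤ ‖c‖ := pow_le_of_le_one (norm_nonneg _) hc (hm i).ne'
  have h2 := norm_le_pi_norm x i
  gcongr

theorem measurableEmbedding_weightedDilation {n : ℕ} (m : Fin n → ℕ) {c : ℂ} (hc : c ≠ 0) :
    MeasurableEmbedding (weightedDilation m c) :=
  (continuous_weightedDilation m c).measurableEmbedding (weightedDilation_injective m hc)

theorem IsQuasiCircular.preimage_eq {n : ℕ} {m : Fin n → ℕ} {G : Set (Fin n → ℂ)}
    (hG : IsQuasiCircular m G) {c : ℂ} (hc : ‖c‖ = 1) : weightedDilation m c ⁻¹' G = G := by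
  have hc0 : c ≠ 0 := fun h => by simp [h] at hc
  refine Subset.antisymm (fun x hx => ?_) fun x hx => hG c hc x hx
  have := hG c⁻¹ (by simp [hc]) _ hx
  change weightedDilation m c⁻¹ (weightedDilation m c x) ∈ G at this
  rwa [weightedDilation_weightedDilation, inv_mul_cancel₀ hc0, weightedDilation_one] at this

theorem IsQuasiCircular.measurePreserving {n : ℕ} {m : Fin n → ℕ} {G : Set (Fin n → ℂ)}
    (hG : IsQuasiCircular m G) (hGo : IsOpen G) {c : ℂ} (hc : ‖c‖ = 1) :
    MeasurePreserving (weightedDilation m c) (volume.restrict G) (volume.restrict G) := by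
  have h1 : MeasurePreserving (weightedDilation m c) volume volume := by
    refine volume_preserving_pi (f := fun i (z : ℂ) => c ^ m i * z) fun i => ?_
    exact (rotation ⟨c ^ m i, by simp [Submonoid.unitSphere, hc]⟩).measurePreserving
  have h2 := h1.restrict_preimage hGo.measurableSet
  rwa [hG.preimage_eq hc] at h2

/-- The part of `h` that is homogeneous of weighted degree `d`. -/
noncomputable def weightedComponent {n : ℕ} (m : Fin n → ℕ) (d : ℕ) (h : (Fin n → ℂ) → ℂ)
    (z : Fin n → ℂ) : ℂ :=
  ∮ c in C(0, 1), c⁻¹ ^ (d + 1) * h (weightedDilation m c z)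

theorem differentiableOn_weightedComponent {n : ℕ} {m : Fin n → ℕ} {G : Set (Fin n → ℂ)}
    (hG : IsQuasiCircular m G) (hGo : IsOpen G) {h : (Fin n → ℂ) → ℂ}
    (hh : DifferentiableOn ℂ h G) (d : ℕ) : DifferentiableOn ℂ (weightedComponent m d h) G := by
  have hmem : ∀ c ∈ sphere (0 : ℂ) 1, MapsTo (weightedDilation m c) G G := fun c hc z hz =>
    hG c (by simpa using hc) z hz
  refine differentiableOn_circleIntegral hGo zero_le_one ?_ ?_
  · have hinv : ContinuousOn (fun p : (Fin n → ℂ) × ℂ => p.2⁻¹) (G ×ˢ sphere 0 1) := by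
      refine continuousOn_snd.inv₀ fun p hp h0 => ?_
      have := hp.2
      rw [h0] at this
      simp at this
    refine (hinv.pow _).mul (hh.continuousOn.comp
      (f := fun p : (Fin n → ℂ) × ℂ => weightedDilation m p.2 p.1) ?_ fun p hp => hmem _ hp.2 hp.1)
    exact ((continuous_weightedDilation_uncurry m).comp continuous_swap).continuousOn
  · intro c hc
    exact (hh.comp (differentiable_weightedDilation m c).differentiableOn (hmem c hc)).const_mul _

theorem circleIntegral_comp_mul_real {F : ℂ → ℂ} {t : ℝ} :
    (∮ c in C(0, t), F c) = ∮ c in C(0, 1), (t : ℂ) * F (t * c) := by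
  simp only [circleIntegral, deriv_circleMap, circleMap, smul_eq_mul]
  congr 1
  ext θ
  push_cast
  simp only [zero_add, one_mul]
  ring

/-- Homogeneity of the weighted components. -/
theorem weightedComponent_weightedDilation {n : ℕ} {m : Fin n → ℕ} (hm : ∀ i, 0 < m i)
    {G : Set (Fin n → ℂ)} (hG : IsQuasiCircular m G) (hGo : IsOpen G) (hGc : IsPreconnected G)
    {h : (Fin n → ℂ) → ℂ} (hh : DifferentiableOn ℂ h G) (d : ℕ) {r : ℝ} (hr : 0 < r)
    (hrG : ball 0 r ⊆ G) {t : ℝ} (ht : 0 < t) (ht1 : t ≤ 1)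
    (htG : ∀ z ∈ G, weightedDilation m t z ∈ G) {z : Fin n → ℂ} (hz : z ∈ G) :
    weightedComponent m d h (weightedDilation m t z) = t ^ d * weightedComponent m d h z := by
  have hπ := differentiableOn_weightedComponent hG hGo hh d
  -- A point of `G` need not keep its whole disc of dilates in `G`. Near `0` the dilates do stay in
  -- a ball inside `G`, and the identity theorem spreads the relation over `G`.
  refine eqOn_of_preconnected_of_eventuallyEq_holomorphic hGo hGc
    (f := fun z => weightedComponent m d h (weightedDilation m t z))
    (hπ.comp (differentiable_weightedDilation m t).differentiableOn htG) (hπ.const_mul _)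
    (hrG (mem_ball_self hr)) ?_ hz
  filter_upwards [ball_mem_nhds (0 : Fin n → ℂ) hr] with z hz
  have hW : ∀ c ∈ closedBall (0 : ℂ) 1, weightedDilation m c z ∈ ball (0 : Fin n → ℂ) r := by
    intro c hc
    rw [mem_closedBall_zero_iff] at hc
    rw [mem_ball_zero_iff] at hz ⊢
    refine (norm_weightedDilation_le hm hc z).trans_lt ?_
    nlinarith [norm_nonneg z, norm_nonneg c]
  have hdiff : ∀ c ∈ closedBall (0 : ℂ) 1, c ≠ 0 →
      DifferentiableAt ℂ (fun c => c⁻¹ ^ (d + 1) * h (weightedDilation m c z)) c := by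
    intro c hc hc0
    have h1 : DifferentiableAt ℂ h (weightedDilation m c z) :=
      (hh _ (hrG (hW c hc))).differentiableAt (hGo.mem_nhds (hrG (hW c hc)))
    have h2 : DifferentiableAt ℂ (fun c => weightedDilation m c z) c := by
      unfold weightedDilation; fun_prop
    exact ((differentiableAt_inv hc0).pow _).mul (h1.comp c h2)
  -- The integrand is singular only at `0`, so the radius of the circle may be changed from `1` to
  -- `t`; rescaling then produces the factor `t ^ d`.
  have h1 := Complex.circleIntegral_eq_of_differentiable_on_annulus_off_countable (c := 0) ht ht1
    (f := fun c => c⁻¹ ^ (d + 1) * h (weightedDilation m c z)) countable_empty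
    (fun c hc => (hdiff c hc.1 fun h0 => hc.2 (by
      rw [h0]; exact mem_ball_self ht)).continuousAt.continuousWithinAt)
    (fun c hc => hdiff c (ball_subset_closedBall hc.1.1) fun h0 => hc.1.2 (by
      rw [h0]; exact mem_closedBall_self ht.le))
  simp only [weightedComponent]
  rw [h1.trans (circleIntegral_comp_mul_real
    (F := fun c => c⁻¹ ^ (d + 1) * h (weightedDilation m c z)) (t := t)),
    ← circleIntegral.integral_const_mul]
  refine circleIntegral.integral_congr zero_le_one fun c _ => ?_
  have ht0 : (t : ℂ) ≠ 0 := by exact_mod_cast ht.ne'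
  have h2 : (t : ℂ) * (t : ℂ)⁻¹ ^ (d + 1) * (t : ℂ) ^ d = 1 := by
    rw [inv_pow, pow_succ]
    field_simp
  simp only [weightedDilation_weightedDilation, mul_comm c (t : ℂ), mul_inv, mul_pow]
  linear_combination (-(c⁻¹ ^ (d + 1) * h (weightedDilation m (t * c) z))) * h2

/-- The action of the circle preserves the measure on `G`, and for `‖c‖ = 1` moving it onto `star q`
gives the inverse of `star c ^ d`, which is `c ^ d`. -/
theorem integral_comp_weightedDilation_mul {n : ℕ} {m : Fin n → ℕ} {G : Set (Fin n → ℂ)}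
    (hG : IsQuasiCircular m G) (hGo : IsOpen G) {h q : (Fin n → ℂ) → ℂ} {d : ℕ}
    (hq : ∀ c z, q (weightedDilation m c z) = c ^ d * q z) {c : ℂ} (hc : ‖c‖ = 1) :
    ∫ z in G, h (weightedDilation m c z) * star (q z) = c ^ d * ∫ z in G, h z * star (q z) := by
  have hc0 : c ≠ 0 := fun h => by simp [h] at hc
  have hcc : c * star c = 1 := by
    rw [Complex.star_def, Complex.mul_conj, Complex.normSq_eq_norm_sq, hc]; simp
  rw [← (hG.measurePreserving hGo hc).integral_comp (measurableEmbedding_weightedDilation m hc0)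
    (fun z => h z * star (q z)), ← integral_const_mul]
  congr 1
  ext z
  rw [hq, star_mul', star_pow]
  have : c ^ d * star c ^ d = 1 := by rw [← mul_pow, hcc, one_pow]
  linear_combination (-(h (weightedDilation m c z) * star (q z))) * this

/-- Pairing with a homogeneous function only sees the homogeneous component. -/
theorem integral_weightedComponent_mul {n : ℕ} {m : Fin n → ℕ} {G : Set (Fin n → ℂ)}
    (hG : IsQuasiCircular m G) (hGo : IsOpen G) {h q : (Fin n → ℂ) → ℂ} {d : ℕ}
    (hh : ContinuousOn h G) (hi : IntegrableOn h G) (hqc : Continuous q) {B : ℝ}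
    (hB : ∀ z ∈ G, ‖q z‖ ≤ B) (hq : ∀ c z, q (weightedDilation m c z) = c ^ d * q z) :
    ∫ z in G, weightedComponent m d h z * star (q z) =
      2 * Real.pi * Complex.I * ∫ z in G, h z * star (q z) := by
  have hcm : ∀ θ : ℝ, ‖circleMap 0 1 θ‖ = 1 := by intro θ; simp
  have hcm0 : ∀ θ : ℝ, circleMap 0 1 θ ≠ 0 := by
    intro θ h0; have := hcm θ; rw [h0] at this; simp at this
  set Φ : ℝ → (Fin n → ℂ) → ℂ := fun θ z => deriv (circleMap 0 1) θ *
    ((circleMap 0 1 θ)⁻¹ ^ (d + 1) * (h (weightedDilation m (circleMap 0 1 θ) z) * star (q z))) with hΦ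
  have hhq : IntegrableOn (fun z => h z * star (q z)) G := by
    refine hi.mul_bdd (c := B) ?_ ?_
    · exact (continuous_star.comp hqc).aestronglyMeasurable
    · filter_upwards [ae_restrict_mem hGo.measurableSet] with z hz
      rw [norm_star]
      exact hB z hz
  have hnorm : ∀ θ z, ‖Φ θ z‖ = ‖(fun z => h z * star (q z))
      (weightedDilation m (circleMap 0 1 θ) z)‖ := by
    intro θ z
    simp only [hΦ, norm_mul, norm_pow, norm_inv, hcm, norm_star, hq, deriv_circleMap,
      Complex.norm_I]
    simp
  have hmeas : ContinuousOn (Function.uncurry Φ) (univ ×ˢ G) := by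
    have h1 := continuous_circleMap 0 1
    have h2 : Continuous fun θ => deriv (circleMap 0 1) θ := by
      simp only [deriv_circleMap]; fun_prop
    refine (h2.comp continuous_fst).continuousOn.mul (ContinuousOn.mul ?_ (ContinuousOn.mul ?_ ?_))
    · exact ((h1.inv₀ hcm0).comp continuous_fst).continuousOn.pow _
    · refine hh.comp (f := fun p : ℝ × (Fin n → ℂ) => weightedDilation m (circleMap 0 1 p.1) p.2) ?_ ?_
      · exact ((continuous_weightedDilation_uncurry m).comp
          (f := fun p : ℝ × (Fin n → ℂ) => (circleMap 0 1 p.1, p.2)) (by fun_prop)).continuousOn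
      · exact fun p hp => hG _ (hcm _) _ hp.2
    · exact (continuous_star.comp (hqc.comp continuous_snd)).continuousOn
  have : IsFiniteMeasure (volume.restrict (uIoc 0 (2 * Real.pi))) :=
    ⟨by rw [Measure.restrict_apply_univ, uIoc]; exact measure_Ioc_lt_top⟩
  have hmp := fun θ => hG.measurePreserving hGo (hcm θ)
  have hint : Integrable (Function.uncurry Φ)
      ((volume.restrict (uIoc 0 (2 * Real.pi))).prod (volume.restrict G)) := by
    have hm' : AEStronglyMeasurable (Function.uncurry Φ)
        ((volume.restrict (uIoc 0 (2 * Real.pi))).prod (volume.restrict G)) := by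
      rw [Measure.prod_restrict, ← Measure.volume_eq_prod]
      refine (hmeas.mono (prod_mono (subset_univ _) le_rfl)).aestronglyMeasurable ?_
      exact measurableSet_uIoc.prod hGo.measurableSet
    rw [integrable_prod_iff hm']
    constructor
    · filter_upwards [hm'.prodMk_left] with θ hθ
      have h1 : Integrable (fun z => (fun z => h z * star (q z))
          (weightedDilation m (circleMap 0 1 θ) z)) (volume.restrict G) :=
        (hmp θ).integrable_comp_of_integrable hhq
      exact h1.mono hθ (Eventually.of_forall fun z => (hnorm θ z).le)
    · simp only [Function.uncurry, hnorm]
      have : ∀ θ, ∫ z in G, ‖(fun z => h z * star (q z)) (weightedDilation m (circleMap 0 1 θ) z)‖ =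
          ∫ z in G, ‖h z * star (q z)‖ := fun θ =>
        (hmp θ).integral_comp (measurableEmbedding_weightedDilation m (hcm0 θ))
          (fun z => ‖h z * star (q z)‖)
      simp only [this]
      exact integrable_const _
  have hswap := intervalIntegral_integral_swap hint
  have h1 : ∀ z, ∫ θ in (0 : ℝ)..2 * Real.pi, Φ θ z = weightedComponent m d h z * star (q z) := by
    intro z
    rw [weightedComponent, circleIntegral, ← intervalIntegral.integral_mul_const]
    congr 1
    ext θ
    simp only [hΦ, smul_eq_mul]
    ring
  -- All powers of `circleMap 0 1 θ` cancel, leaving the factor `Complex.I` from the derivative of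
  -- the circle. Integrating over `θ` gives `2πi`, since `weightedComponent` is not normalised.
  have h2 : ∀ θ, ∫ z in G, Φ θ z = Complex.I * ∫ z in G, h z * star (q z) := by
    intro θ
    simp only [hΦ]
    rw [integral_const_mul, integral_const_mul, integral_comp_weightedDilation_mul hG hGo hq (hcm θ),
      deriv_circleMap]
    have h3 : circleMap 0 1 θ * ((circleMap 0 1 θ)⁻¹ ^ (d + 1) * circleMap 0 1 θ ^ d) = 1 := by
      have := hcm0 θ
      rw [inv_pow, pow_succ]
      field_simp
    linear_combination (Complex.I * ∫ z in G, h z * star (q z)) * h3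
  simp only [h1, h2] at hswap
  rw [← hswap, intervalIntegral.integral_const, Complex.real_smul]
  push_cast
  ring

/-- On a quasi-circular domain, the pairing of the Bergman space with a homogeneous function can be
computed on a dilated copy of the domain. -/
theorem exists_integral_eq_integral_image_weightedDilation {n : ℕ} {m : Fin n → ℕ} (hm : ∀ i, 0 < m i)
    {G : Set (Fin n → ℂ)} (hG : IsQuasiCircular m G) (hGd : IsBoundedDomain G) {r : ℝ} (hr : 0 < r)
    (hrG : closedBall 0 r ⊆ G) {t : ℝ} (ht : 0 < t) (ht1 : t ≤ 1)
    (htG : ∀ z ∈ G, weightedDilation m t z ∈ closedBall 0 r) {q : (Fin n → ℂ) → ℂ} {d : ℕ}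
    (hqc : Continuous q) (hq : ∀ c z, q (weightedDilation m c z) = c ^ d * q z) :
    ∃ C : ℂ, ∀ h ∈ bergmanSpace G, ∫ z in G, h z * star (q z) =
      C * ∫ z in weightedDilation m t '' G, h z * star (q z) := by
  have hGo := hGd.isOpen
  have hfin : IsFiniteMeasure (volume.restrict G) :=
    ⟨by simpa using hGd.isBounded.measure_lt_top⟩
  have ht0 : (t : ℂ) ≠ 0 := by exact_mod_cast ht.ne'
  obtain ⟨B, hB⟩ : ∃ B, ∀ z ∈ G, ‖q z‖ ≤ B := by
    obtain ⟨B, hB⟩ := hGd.isBounded.isCompact_closure.exists_bound_of_continuousOn hqc.continuousOn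
    exact ⟨B, fun z hz => hB z (subset_closure hz)⟩
  -- the dilation as a real-linear map
  let A : (Fin n → ℂ) →L[ℝ] (Fin n → ℂ) :=
    ContinuousLinearMap.pi fun i => ((t : ℂ) ^ m i) • ContinuousLinearMap.proj i
  have hA : ∀ z, A z = weightedDilation m t z := fun z => by
    ext i; simp [A, weightedDilation]
  have hAdet : A.det ≠ 0 := by
    intro h0
    have h1 := LinearMap.bot_lt_ker_of_det_eq_zero (f := (A : (Fin n → ℂ) →ₗ[ℝ] (Fin n → ℂ))) h0
    refine h1.ne' (LinearMap.ker_eq_bot.2 fun x y hxy => weightedDilation_injective m ht0 ?_)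
    rw [← hA, ← hA]
    exact hxy
  have hchange : ∀ k : (Fin n → ℂ) → ℂ, ∫ z in G, k (weightedDilation m t z) =
      ((|A.det| : ℝ) : ℂ)⁻¹ * ∫ z in weightedDilation m t '' G, k z := by
    intro k
    have h1 := integral_image_eq_integral_abs_det_fderiv_smul volume hGo.measurableSet
      (f := weightedDilation m t) (f' := fun _ => A) (fun z _ => by
        have : HasFDerivAt A A z := A.hasFDerivAt
        rw [funext hA] at this
        exact this.hasFDerivWithinAt) (weightedDilation_injective m ht0).injOn k
    rw [h1, integral_smul, Complex.real_smul, inv_mul_cancel_left₀]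
    exact_mod_cast abs_ne_zero.2 hAdet
  -- The pairing of `z ↦ h (t · z)` with `q` is computed twice: its degree `d` component gives `t ^
  -- d` times the pairing of `h` over `G`, and the change of variables gives `t ^ (-d) / |A.det|`
  -- times the pairing over the dilated copy.
  refine ⟨((t : ℂ) ^ d)⁻¹ * ((t : ℂ) ^ d)⁻¹ * ((|A.det| : ℝ) : ℂ)⁻¹, fun h hh => ?_⟩
  set hₜ : (Fin n → ℂ) → ℂ := fun z => h (weightedDilation m t z) with hht
  have htG' : MapsTo (weightedDilation m t) G G := fun z hz => hrG (htG z hz)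
  have hcont : ContinuousOn hₜ G :=
    hh.1.continuousOn.comp (continuous_weightedDilation m t).continuousOn htG'
  have hi : IntegrableOn h G := hh.2.integrable (by norm_num)
  have hit : IntegrableOn hₜ G := by
    obtain ⟨M, hM⟩ := (isCompact_closedBall (0 : Fin n → ℂ) r).exists_bound_of_continuousOn
      (hh.1.continuousOn.mono hrG)
    refine Integrable.of_bound (hcont.aestronglyMeasurable hGo.measurableSet) M ?_
    filter_upwards [ae_restrict_mem hGo.measurableSet] with z hz using hM _ (htG z hz)
  have e1 := integral_weightedComponent_mul hG hGo hh.1.continuousOn hi hqc hB hq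
  have e2 := integral_weightedComponent_mul hG hGo hcont hit hqc hB hq
  have e3 : ∫ z in G, weightedComponent m d hₜ z * star (q z) =
      (t : ℂ) ^ d * ∫ z in G, weightedComponent m d h z * star (q z) := by
    rw [← integral_const_mul]
    refine setIntegral_congr_fun hGo.measurableSet fun z hz => ?_
    have h1 := weightedComponent_weightedDilation hm hG hGo hGd.isConnected.isPreconnected hh.1 d hr
      (ball_subset_closedBall.trans hrG) ht ht1 htG' hz
    have h2 : weightedComponent m d hₜ z = weightedComponent m d h (weightedDilation m t z) := by
      simp only [weightedComponent, hht, weightedDilation_weightedDilation, mul_comm]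
    simp only [h2, h1, mul_assoc]
  have e4 : ∫ z in G, hₜ z * star (q z) =
      ((t : ℂ) ^ d)⁻¹ * (((|A.det| : ℝ) : ℂ)⁻¹ * ∫ z in weightedDilation m t '' G, h z * star (q z)) := by
    rw [← hchange fun z => h z * star (q z), ← integral_const_mul]
    congr 1
    ext z
    have h1 : star ((t : ℂ) ^ d) = (t : ℂ) ^ d := by simp
    rw [hq, star_mul', h1]
    field_simp
    rw [hht, mul_comm]
  rw [e1, e2] at e3
  have hpi : (2 * Real.pi * Complex.I : ℂ) ≠ 0 := by simp [Real.pi_ne_zero]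
  have e5 : ∫ z in G, hₜ z * star (q z) = (t : ℂ) ^ d * ∫ z in G, h z * star (q z) := by
    apply mul_left_cancel₀ hpi
    rw [e3]; ring
  rw [e5] at e4
  rw [mul_assoc, mul_assoc, ← e4, inv_mul_cancel_left₀ (pow_ne_zero d ht0)]

/-! ### Localisation of pairings and extension through the Bergman kernel. -/

theorem image_weightedDilation {n : ℕ} (m : Fin n → ℕ) {c : ℂ} (hc : c ≠ 0) (G : Set (Fin n → ℂ)) :
    weightedDilation m c '' G = weightedDilation m c⁻¹ ⁻¹' G := by
  refine congrFun (image_eq_preimage_of_inverse (fun x => ?_) fun x => ?_) G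
  · rw [weightedDilation_weightedDilation, inv_mul_cancel₀ hc, weightedDilation_one]
  · rw [weightedDilation_weightedDilation, mul_inv_cancel₀ hc, weightedDilation_one]

/-- It turns cutoffs exhausting `G` into cutoffs exhausting the dilated copy. -/
theorem IsCompactlySupportedIn.comp_weightedDilation_inv {n : ℕ} {m : Fin n → ℕ}
    {G : Set (Fin n → ℂ)} {ψ : (Fin n → ℂ) → ℂ} (h : IsCompactlySupportedIn G ψ) {c : ℂ}
    (hc : c ≠ 0) (hcG : weightedDilation m c '' G ⊆ G) :
    IsCompactlySupportedIn G (fun y => ψ (weightedDilation m c⁻¹ y)) := by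
  have hK : IsCompact (weightedDilation m c '' tsupport ψ) :=
    h.hasCompactSupport.isCompact.image (continuous_weightedDilation m c)
  have hs : Function.support (fun y => ψ (weightedDilation m c⁻¹ y)) ⊆
      weightedDilation m c '' tsupport ψ := by
    rw [image_weightedDilation m hc]
    exact fun y hy => subset_tsupport _ hy
  refine ⟨h.continuous.comp (continuous_weightedDilation m _), hK.of_isClosed_subset
    (isClosed_tsupport _) (closure_minimal hs hK.isClosed), ?_⟩
  exact (closure_minimal hs hK.isClosed).trans ((image_mono h.tsupport_subset).trans hcG)

theorem IsCompactlySupportedIn.sub_const_mul {n : ℕ} {G : Set (Fin n → ℂ)}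
    {ψ φ : (Fin n → ℂ) → ℂ} (h : IsCompactlySupportedIn G ψ) (h' : IsCompactlySupportedIn G φ)
    (C : ℂ) : IsCompactlySupportedIn G (fun y => ψ y - C * φ y) := by
  have hK := h.hasCompactSupport.isCompact.union h'.hasCompactSupport.isCompact
  have hs : Function.support (fun y => ψ y - C * φ y) ⊆ tsupport ψ ∪ tsupport φ := by
    intro y hy
    by_contra hn
    rw [mem_union, not_or] at hn
    apply hy
    simp [image_eq_zero_of_notMem_tsupport hn.1, image_eq_zero_of_notMem_tsupport hn.2]
  have hs' := closure_minimal hs hK.isClosed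
  exact ⟨h.continuous.sub (h'.continuous.const_mul C),
    hK.of_isClosed_subset (isClosed_tsupport _) hs',
    hs'.trans (union_subset h.tsupport_subset h'.tsupport_subset)⟩

/-- Hermitian symmetry: reproduce each of the two kernel functions by means of the other. -/
theorem IsBergmanKernel.star_swap {n : ℕ} {D : Set (Fin n → ℂ)}
    {k : (Fin n → ℂ) → (Fin n → ℂ) → ℂ} (hk : IsBergmanKernel D k) {z w : Fin n → ℂ}
    (hz : z ∈ D) (hw : w ∈ D) : star (k w z) = k z w := by
  have h1 := hk.reproducing _ (hk.mem w hw) z hz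
  have h2 := hk.reproducing _ (hk.mem z hz) w hw
  rw [h1, h2]
  simp only [Complex.star_def]
  rw [← integral_conj]
  congr 1
  ext u
  simp [mul_comm]

theorem mul_mem_bergmanSpace {n : ℕ} {D : Set (Fin n → ℂ)} (hD : IsOpen D)
    {u v : (Fin n → ℂ) → ℂ} (hu : u ∈ bergmanSpace D) (hv : DifferentiableOn ℂ v D) {B : ℝ}
    (hB : ∀ w ∈ D, ‖v w‖ ≤ B) : (fun w => u w * v w) ∈ bergmanSpace D := by
  refine ⟨hu.1.mul hv, (hu.2.const_mul (B : ℂ)).mono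
    ((hu.1.mul hv).continuousOn.aestronglyMeasurable hD.measurableSet) ?_⟩
  filter_upwards [ae_restrict_mem hD.measurableSet] with w hw
  rw [norm_mul, norm_mul, mul_comm]
  gcongr
  exact (hB w hw).trans ((le_abs_self B).trans (by simp))

/-- Pairings of the Bergman space with the pull-back of a homogeneous function are supported, up to
a constant factor, in the preimage of a dilated copy of the target. -/
theorem exists_integral_mul_star_comp {n : ℕ} {m : Fin n → ℕ} (hm : ∀ i, 0 < m i)
    {D G : Set (Fin n → ℂ)} (hD : IsOpen D) (hG : IsQuasiCircular m G) (hGd : IsBoundedDomain G)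
    {f : (Fin n → ℂ) → (Fin n → ℂ)} (hf : DifferentiableOn ℂ f D) (hfm : MapsTo f D G)
    (hprop : ∀ K, IsCompact K → K ⊆ G → IsCompact (D ∩ f ⁻¹' K)) {r : ℝ} (hr : 0 < r)
    (hrG : closedBall 0 r ⊆ G) {t : ℝ} (ht : 0 < t) (ht1 : t ≤ 1)
    (htG : ∀ z ∈ G, weightedDilation m t z ∈ closedBall 0 r) {q : (Fin n → ℂ) → ℂ} {d : ℕ}
    (hqc : Continuous q) (hq : ∀ c z, q (weightedDilation m c z) = c ^ d * q z) :
    ∃ C : ℂ, ∀ g ∈ bergmanSpace D,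
      ∫ w in D, g w * star (jacobianMatrix f w).det * star (q (f w)) =
      C * ∫ w in D, g w * star (jacobianMatrix f w).det *
        star ((weightedDilation m t '' G).indicator q (f w)) := by
  obtain ⟨C, hC⟩ := exists_integral_eq_integral_image_weightedDilation hm hG hGd hr hrG ht ht1 htG
    hqc hq
  refine ⟨C, fun g hg => ?_⟩
  have hGo := hGd.isOpen
  have ht0 : (t : ℂ) ≠ 0 := by exact_mod_cast ht.ne'
  obtain ⟨B, hB⟩ : ∃ B, ∀ z ∈ G, ‖q z‖ ≤ B := by
    obtain ⟨B, hB⟩ := hGd.isBounded.isCompact_closure.exists_bound_of_continuousOn hqc.continuousOn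
    exact ⟨B, fun z hz => hB z (subset_closure hz)⟩
  have hB0 : 0 ≤ B := (norm_nonneg _).trans (hB 0 (hrG (mem_closedBall_self hr.le)))
  set T := weightedDilation m t '' G with hT
  have hTG : T ⊆ G := by
    rintro _ ⟨z, hz, rfl⟩
    exact hrG (htG z hz)
  have hTo : IsOpen T := by
    rw [hT, image_weightedDilation m ht0]
    exact hGo.preimage (continuous_weightedDilation m _)
  -- By the choice of `C` this function annihilates the Bergman space of `G`, so its pull-back,
  -- multiplied by the conjugate Jacobian, annihilates that of `D`.
  set η : (Fin n → ℂ) → ℂ := fun y => star (q y) - C * star (T.indicator q y) with hη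
  obtain ⟨χ, hχ1, hχ2, hχ3⟩ := exists_cutoff_sequence hGo
  have hψ := fun k => (hχ1 k).comp_weightedDilation_inv ht0 hTG
  have hsc : ContinuousOn (fun y => star (q y)) G := (continuous_star.comp hqc).continuousOn
  -- Test functions converging boundedly to `η`: cutoffs of `G` tend to `1`, while their dilates
  -- tend to the indicator of `T`, which is open and contained in `G`.
  have hηk := fun k => ((hχ1 k).sub_const_mul (hψ k) C).mul_right hGo hsc
  have hzero := integral_mul_comp_eq_zero_of_annihilates hD hGo hGd.isConnected.isPreconnected
    hGd.isBounded hf hfm hprop (η := η) (B := (1 + ‖C‖) * B) hηk ?_ ?_ ?_ hg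
  · have hu := det_jacobianMatrix_mem_bergmanSpace hD hGo hGd.isConnected.isPreconnected
      hGd.isBounded hf hfm hprop
    have hgu : IntegrableOn (fun w => g w * star (jacobianMatrix f w).det) D :=
      hg.2.integrable_mul (q := 2) hu.2.star
    have hi1 : IntegrableOn (fun w => g w * star (jacobianMatrix f w).det * star (q (f w))) D := by
      refine hgu.mul_bdd (c := B) ?_ ?_
      · exact ((continuous_star.comp hqc).comp_continuousOn hf.continuousOn).aestronglyMeasurable
          hD.measurableSet
      · filter_upwards [ae_restrict_mem hD.measurableSet] with w hw
        rw [norm_star]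
        exact hB _ (hfm hw)
    have hi2 : IntegrableOn (fun w => g w * star (jacobianMatrix f w).det *
        star (T.indicator q (f w))) D := by
      refine (hi1.indicator (hf.continuousOn.isOpen_inter_preimage hD hTo).measurableSet).congr ?_
      filter_upwards [ae_restrict_mem hD.measurableSet] with w hw
      by_cases hwT : f w ∈ T
      · rw [indicator_of_mem (show w ∈ D ∩ f ⁻¹' T from ⟨hw, hwT⟩), indicator_of_mem hwT]
      · rw [indicator_of_notMem (fun h => hwT h.2), indicator_of_notMem hwT]
        simp
    rw [← sub_eq_zero, ← integral_const_mul, ← integral_sub hi1 (hi2.const_mul C), ← hzero]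
    congr 1
    ext w
    simp only [hη]
    ring
  · intro k y
    by_cases hy : y ∈ G
    · rw [norm_mul, norm_star]
      refine mul_le_mul ((norm_sub_le _ _).trans ?_) (hB y hy) (norm_nonneg _) (by positivity)
      rw [norm_mul]
      have h1 := (hχ2 k y).1
      have h2 := (hχ2 k (weightedDilation m (t : ℂ)⁻¹ y)).1
      nlinarith [norm_nonneg C]
    · have h1 := image_eq_zero_of_notMem_tsupport fun h => hy ((hηk k).tsupport_subset h)
      simp only [h1, norm_zero]
      positivity
  · intro y hy
    refine tendsto_const_nhds.congr' ?_
    by_cases hyT : y ∈ T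
    · have hyT' : weightedDilation m (t : ℂ)⁻¹ y ∈ G := by
        rwa [hT, image_weightedDilation m ht0] at hyT
      filter_upwards [hχ3 y hy, hχ3 _ hyT'] with k h1 h2
      simp only [hη, h1, h2, indicator_of_mem hyT]
      ring
    · have hyT' : weightedDilation m (t : ℂ)⁻¹ y ∉ G := by
        rwa [hT, image_weightedDilation m ht0] at hyT
      filter_upwards [hχ3 y hy] with k h1
      have h2 := image_eq_zero_of_notMem_tsupport fun h => hyT' ((hχ1 k).tsupport_subset h)
      simp only [hη, h1, h2, indicator_of_notMem hyT]
      simp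
  · intro h hh
    have hfin : IsFiniteMeasure (volume.restrict G) :=
      ⟨by simpa using hGd.isBounded.measure_lt_top⟩
    have hi : IntegrableOn (fun y => h y * star (q y)) G := by
      have hi : IntegrableOn h G := hh.2.integrable (by norm_num)
      refine hi.mul_bdd (c := B)
        (hsc.aestronglyMeasurable hGo.measurableSet) ?_
      filter_upwards [ae_restrict_mem hGo.measurableSet] with z hz
      rw [norm_star]
      exact hB z hz
    have he : ∀ y, h y * η y = h y * star (q y) -
        C * T.indicator (fun y => h y * star (q y)) y := by
      intro y
      by_cases hy : y ∈ T
      · simp only [hη, indicator_of_mem hy]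
        ring
      · simp [hη, indicator_of_notMem hy]
    simp only [he]
    rw [integral_sub hi ((hi.indicator hTo.measurableSet).const_mul C), integral_const_mul,
      setIntegral_indicator hTo.measurableSet, inter_eq_right.2 hTG, hC h hh, sub_self]

/-- The function `det f' · q ∘ f` extends past the boundary for homogeneous `q`. -/
theorem exists_extension_det_mul_comp {n : ℕ} {m : Fin n → ℕ} (hm : ∀ i, 0 < m i)
    {D G : Set (Fin n → ℂ)} (hD : IsOpen D) (hG : IsQuasiCircular m G) (hGd : IsBoundedDomain G)
    {f : (Fin n → ℂ) → (Fin n → ℂ)} (hf : DifferentiableOn ℂ f D) (hfm : MapsTo f D G)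
    (hprop : ∀ K, IsCompact K → K ⊆ G → IsCompact (D ∩ f ⁻¹' K)) {r : ℝ} (hr : 0 < r)
    (hrG : closedBall 0 r ⊆ G) {t : ℝ} (ht : 0 < t) (ht1 : t ≤ 1)
    (htG : ∀ z ∈ G, weightedDilation m t z ∈ closedBall 0 r)
    {U K : Set (Fin n → ℂ)} (hU : IsOpen U) (hK : D ∩ f ⁻¹' closedBall 0 r ⊆ K)
    {F : (Fin n → ℂ) × (Fin n → ℂ) → ℂ} (hF : DifferentiableOn ℂ F (U ×ˢ conjSet K))
    (hFk : ∀ z ∈ D, ∀ w ∈ conjSet K, F (z, w) = bergmanKernel D z (star w))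
    {q : (Fin n → ℂ) → ℂ} {d : ℕ}
    (hqd : Differentiable ℂ q) (hq : ∀ c z, q (weightedDilation m c z) = c ^ d * q z) :
    ∃ H : (Fin n → ℂ) → ℂ, DifferentiableOn ℂ H U ∧
      ∀ z ∈ D, H z = (jacobianMatrix f z).det * q (f z) := by
  have hGo := hGd.isOpen
  have ht0 : (t : ℂ) ≠ 0 := by exact_mod_cast ht.ne'
  have hk := isBergmanKernel_bergmanKernel hD
  obtain ⟨C, hC⟩ := exists_integral_mul_star_comp hm hD hG hGd hf hfm hprop hr hrG ht ht1 htG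
    hqd.continuous hq
  set T := weightedDilation m t '' G with hT
  have hTr : T ⊆ closedBall 0 r := by
    rintro _ ⟨z, hz, rfl⟩
    exact htG z hz
  have hTo : IsOpen T := by
    rw [hT, image_weightedDilation m ht0]
    exact hGo.preimage (continuous_weightedDilation m _)
  set K₀ := D ∩ f ⁻¹' closedBall 0 r with hK₀
  have hK₀c : IsCompact K₀ := hprop _ (isCompact_closedBall _ _) hrG
  have hu := det_jacobianMatrix_mem_bergmanSpace hD hGo hGd.isConnected.isPreconnected
    hGd.isBounded hf hfm hprop
  set a : (Fin n → ℂ) → ℂ := fun w => (jacobianMatrix f w).det * T.indicator q (f w) with ha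
  have hac : ContinuousOn (fun w => (jacobianMatrix f w).det * q (f w)) D :=
    hu.1.continuousOn.mul (hqd.continuous.comp_continuousOn hf.continuousOn)
  have hai : IntegrableOn a K₀ := by
    refine (((hac.mono inter_subset_left).integrableOn_compact hK₀c).indicator
      (hf.continuousOn.isOpen_inter_preimage hD hTo).measurableSet).congr ?_
    filter_upwards [ae_restrict_mem hK₀c.measurableSet] with w hw
    by_cases hwT : f w ∈ T
    · rw [indicator_of_mem (show w ∈ D ∩ f ⁻¹' T from ⟨hw.1, hwT⟩)]
      simp only [ha, indicator_of_mem hwT]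
    · rw [indicator_of_notMem (fun h => hwT h.2)]
      simp only [ha, indicator_of_notMem hwT, mul_zero]
  -- The extension formula. The variable `w` runs only over the compact `K₀`, which lies in `K`, so
  -- the continued kernel is available for every `z ∈ U`.
  refine ⟨fun z => star C * ∫ w in K₀, F (z, star w) * a w,
    (differentiableOn_setIntegral_of_continuousOn (F := fun z w => F (z, star w)) hU hK₀c ?_ ?_
      hai).const_mul _, fun z hz => ?_⟩
  · refine hF.continuousOn.comp (f := fun p : (Fin n → ℂ) × (Fin n → ℂ) => (p.1, star p.2))
      (by fun_prop) fun p hp => ⟨hp.1, p.2, hK hp.2, rfl⟩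
  · intro w hw
    exact hF.comp (f := fun z : Fin n → ℂ => (z, star w)) (by fun_prop)
      fun z hz => ⟨hz, w, hK hw, rfl⟩
  · obtain ⟨B, hB⟩ : ∃ B, ∀ z ∈ G, ‖q z‖ ≤ B := by
      obtain ⟨B, hB⟩ := hGd.isBounded.isCompact_closure.exists_bound_of_continuousOn
        hqd.continuous.continuousOn
      exact ⟨B, fun z hz => hB z (subset_closure hz)⟩
    have hmem := mul_mem_bergmanSpace hD hu (hqd.comp_differentiableOn hf)
      (fun w hw => hB _ (hfm hw))
    have h1 := hk.reproducing _ hmem z hz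
    -- The localised pairing is applied to `g = k_D(·, z)` and conjugated; by Hermitian symmetry
    -- this brings in `k_D(z, w)`.
    have h2 := congrArg star (hC _ (hk.mem z hz))
    rw [star_mul'] at h2
    simp only [Complex.star_def] at h2
    rw [← integral_conj, ← integral_conj] at h2
    have h3 : ∫ w in K₀, F (z, star w) * a w = ∫ w in D, bergmanKernel D z w * a w := by
      refine Eq.trans ?_ (setIntegral_eq_of_subset_of_forall_sdiff_eq_zero hD.measurableSet
        (inter_subset_left : K₀ ⊆ D) ?_).symm
      · refine setIntegral_congr_fun hK₀c.measurableSet fun w hw => ?_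
        simp only [hFk z hz (star w) ⟨w, hK hw, rfl⟩, star_star]
      · intro w hw
        have : f w ∉ T := fun h => hw.2 ⟨hw.1, hTr h⟩
        simp [ha, indicator_of_notMem this]
    simp only [Function.comp_apply] at h1
    rw [h1]
    beta_reduce
    rw [h3]
    refine Eq.trans ?_ (Eq.trans h2.symm ?_)
    · rw [Complex.star_def]
      congr 1
      refine setIntegral_congr_fun hD.measurableSet fun w hw => ?_
      have := hk.star_swap hz hw
      rw [Complex.star_def] at this
      simp only [map_mul, this, Complex.conj_conj, ha]
      ring
    · refine setIntegral_congr_fun hD.measurableSet fun w hw => ?_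
      simp only [map_mul, Complex.conj_conj, Complex.star_def]
      ring

/-! ### Conclusion. -/

theorem IsProperHolomorphic.isCompact_inter_preimage {n : ℕ} {D G : Set (Fin n → ℂ)}
    {f : (Fin n → ℂ) → (Fin n → ℂ)} (hf : IsProperHolomorphic f D G) {K : Set (Fin n → ℂ)}
    (hK : IsCompact K) (hKG : K ⊆ G) : IsCompact (D ∩ f ⁻¹' K) := by
  have h1 : IsCompact ((↑) ⁻¹' K : Set G) := by
    rw [Subtype.isCompact_iff, Subtype.image_preimage_coe, inter_eq_right.2 hKG]
    exact hK
  have h2 := (hf.proper.isCompact_preimage h1).image continuous_subtype_val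
  convert h2 using 1
  ext w
  simp [and_comm]

theorem mainTheorem5 {n : ℕ} (D G : Set (Fin n → ℂ))
    (hD : IsBoundedDomain D) (hG : IsBoundedDomain G)
    (m : Fin n → ℕ) (hm_pos : ∀ i, 0 < m i) (hm_gcd : Finset.univ.gcd m = 1)
    (hG_circ : IsQuasiCircular m G) (hG_zero : 0 ∈ G)
    (hker : BergmanKernelExtends D)
    (f : (Fin n → ℂ) → (Fin n → ℂ)) (hf : IsProperHolomorphic f D G) :
    ∃ V : Set (Fin n → ℂ), IsOpen V ∧ closure D ⊆ V ∧
      ∃ F : (Fin n → ℂ) → (Fin n → ℂ), DifferentiableOn ℂ F V ∧ EqOn F f D := by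
  have hprop : ∀ K, IsCompact K → K ⊆ G → IsCompact (D ∩ f ⁻¹' K) := fun K =>
    hf.isCompact_inter_preimage
  obtain ⟨r, hr, hrG⟩ := nhds_basis_closedBall.mem_iff.1 (hG.isOpen.mem_nhds hG_zero)
  obtain ⟨M, hM0, hM⟩ := hG.isBounded.exists_pos_norm_le
  -- The dilation factor: at most `1`, so that dilations contract norms by it, and at most `r / M`,
  -- so that `G`, bounded by `M`, is mapped into the ball of radius `r`.
  have ht : 0 < min 1 (r / M) := by positivity
  have htG : ∀ z ∈ G, weightedDilation m (min 1 (r / M) : ℝ) z ∈ closedBall 0 r := by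
    intro z hz
    have h1 : ‖((min 1 (r / M) : ℝ) : ℂ)‖ = min 1 (r / M) := by
      rw [Complex.norm_real, Real.norm_of_nonneg ht.le]
    rw [mem_closedBall_zero_iff]
    refine (norm_weightedDilation_le hm_pos (h1.trans_le (min_le_left _ _)) z).trans ?_
    rw [h1]
    calc min 1 (r / M) * ‖z‖ ≤ r / M * M := by
          gcongr
          · exact min_le_right _ _
          · exact hM z hz
      _ = r := div_mul_cancel₀ r hM0.ne'
  obtain ⟨K, hKo, hK, hKD, hKc⟩ := exists_open_between_and_isCompact_closure
    (hprop _ (isCompact_closedBall 0 r) hrG) hD.isOpen inter_subset_left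
  obtain ⟨U, hU, hDU, Φ, hΦ, hΦk⟩ := hker K hKo hKc hKD
  obtain ⟨p, hp, hp0⟩ := exists_det_jacobianMatrix_ne_zero hD.isOpen hG.isOpen hD.isConnected.nonempty
    hf.holomorphic hf.mapsTo hprop
  have hDc := hD.isConnected.isPreconnected
  -- The set `U` may be disconnected, and relations known on `D` propagate only within a connected
  -- set. As `D` is connected, the component of `p` still contains its closure.
  set V := connectedComponentIn U p with hV
  have hVo : IsOpen V := hU.connectedComponentIn
  have hVc : IsPreconnected V := isPreconnected_connectedComponentIn
  have hDV : closure D ⊆ V :=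
    hDc.closure.subset_connectedComponentIn (subset_closure hp) hDU
  have hDV' : D ⊆ V := subset_closure.trans hDV
  have hVU : V ⊆ U := connectedComponentIn_subset _ _
  have hext : ∀ i, ∃ F : (Fin n → ℂ) → ℂ, DifferentiableOn ℂ F V ∧
      ∀ z ∈ D, (jacobianMatrix f z).det * f z i = (jacobianMatrix f z).det * F z := by
    intro i
    -- `H k` extends the Jacobian determinant times the `k`-th power of the `i`-th component of `f`;
    -- `H 0` extends the determinant itself. The monomial `z i ^ k` has weighted degree `m i * k`.
    choose H hH hHD using fun k : ℕ => exists_extension_det_mul_comp hm_pos hD.isOpen hG_circ hG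
      hf.holomorphic hf.mapsTo hprop hr hrG ht (min_le_left _ _) htG hU hK hΦ hΦk
      (q := fun z => z i ^ k) (d := m i * k) (by fun_prop)
      (fun c z => by simp only [weightedDilation, mul_pow, pow_mul])
    have hHV := fun k => (hH k).mono hVU
    obtain ⟨F, hF, hFeq⟩ := exists_differentiableOn_eq_mul_of_pow_dvd hVo hVc (hHV 0) (hHV 1) hHV
      ⟨p, hDV' hp, by simpa [hHD 0 p hp] using hp0⟩ fun k =>
        eqOn_of_preconnected_of_eventuallyEq_holomorphic hVo hVc
          (((hHV 1).pow k).mul (hHV 0)) (((hHV 0).pow k).mul (hHV k)) (hDV' hp) (by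
            filter_upwards [hD.isOpen.mem_nhds hp] with z hz
            simp only [hHD _ z hz]
            ring)
    refine ⟨F, hF, fun z hz => ?_⟩
    have h1 := hFeq z (hDV' hz)
    simpa only [hHD _ z hz, pow_one, pow_zero, mul_one] using h1
  choose F hF hFf using hext
  refine ⟨V, hVo, hDV, fun z i => F i z, differentiableOn_pi.2 hF, fun z hz => ?_⟩
  -- On `D` only the equality multiplied by the determinant is known. It can be cancelled on a dense
  -- subset of `D`, and continuity gives the rest.
  ext i
  have hdense := subset_closure_ne_zero_of_holomorphic hD.isOpen hDc
    (differentiableOn_det_jacobianMatrix hD.isOpen hf.holomorphic) hp hp0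
  have hne : (𝓝[{z | z ∈ D ∧ (jacobianMatrix f z).det ≠ 0}] z).NeBot :=
    mem_closure_iff_nhdsWithin_neBot.1 (hdense hz)
  have h1 : Tendsto (F i) (𝓝[{z | z ∈ D ∧ (jacobianMatrix f z).det ≠ 0}] z) (𝓝 (F i z)) :=
    (((hF i).continuousOn.continuousAt (hVo.mem_nhds (hDV' hz))).tendsto).mono_left
      nhdsWithin_le_nhds
  have h2 : Tendsto (fun w => f w i) (𝓝[{z | z ∈ D ∧ (jacobianMatrix f z).det ≠ 0}] z)
      (𝓝 (f z i)) :=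
    (((continuous_apply i).comp_continuousOn hf.holomorphic.continuousOn).continuousAt
      (hD.isOpen.mem_nhds hz)).tendsto.mono_left nhdsWithin_le_nhds
  refine tendsto_nhds_unique h1 (h2.congr' ?_)
  filter_upwards [self_mem_nhdsWithin] with w hw
  exact mul_left_cancel₀ hw.2 (hFf i w hw.1)
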